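/- Let $d\ge 2$ and let $\Omega\subset\mathbb R^d$ be a bounded domain with Lipschitz boundary $\partial\Omega=\Gamma_D\cup\Gamma_N$, where $\Gamma_D\subset\partial\Omega$ is measurable with positive $(d-1)$-dimensional measure and $\Gamma_N=\partial\Omega\setminus\Gamma_D$. Let $A:\overline\Omega\times\mathbb R^d\to\mathbb R^{d\times d}$ be Borel measurable and bounded, and suppose that there are constants $C_A\ge M_A>0$ such that for all $x\in\overline\Omega$ and $v_1,v_2\in\mathbb R^d$ $$|A(x,v_1)v_1-A(x,v_2)v_2|\le C_A|v_1-v_2|,\qquad (A(x,v_1)v_1-A(x,v_2)v_2)\cdot(v_1-v_2)\ge M_A|v_1-v_2|^2 .$$ Let $f\in L^2(\Omega)$, $g_D\in L^2(\Gamma_D)$ (for instance $g_D\in H^{1/2}(\Gamma_D)$) and $g_N\in L^2(\Gamma_N)$. We write $A(v)$ for $A(x,v)$. **Mesh and finite element space.** Let $\mathcal T_h$ be a finite family of pairwise disjoint open sets $K\subset\Omega$ with $\overline\Omega=\bigcup_K\overline K$, and let $h_K=\operatorname{diam}K$. Each $K=T_K(\hat K)$ is the image of a reference domain $\hat K$,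 the open unit simplex or the open unit hypercube, under a $C^{r_K}$-diffeomorphism $T_K:\hat K\to K$, $r_K\ge2$, that extends to a continuous one-to-one map on $\overline{\hat K}$. Let $p_K\ge1$ be integers. Suppose that for some constants $\beta_1,\beta_2,\beta_3$, with $\beta_2,\beta_3>0$: $|T_K|_{W^s_\infty(\hat K)}\le\beta_1h_K^s$ and $|T_K^{-1}|_{W^s_\infty(K)}\le\beta_1h_K^{-s}$ for all integers $0\le s\le r_K$; and $\beta_2^{-1}\le h_K/h_{K'}\le\beta_2$, $\beta_3^{-1}\le p_K/p_{K'}\le\beta_3$ whenever $K,K'$ share an interior face. Interior faces are the sets $\partial K\cap\partial K'$ ($K\ne K'$), and Dirichlet (Neumann) faces the sets $\partial K\cap\Gamma_D$ ($\partial K\cap\Gamma_N$), that have positive $(d-1)$-dimensional measure; $\Gamma_{h,0},\Gamma_{h,D},\Gamma_{h,N}$ denote the unions of these faces and $\mathcal F_h$ the set of all faces. Non-affine elements and hanging nodes are allowed. Let $$V_{h,p}=\{v\in L^2(\Omega): v|_K\circ T_K\in\hat S_{p_K}(\hat K)\ \text{for all }K\in\mathcal T_h\},$$ where $\hat S_k(\hat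 K)$ consists of the polynomials of total degree at most $k$ if $\hat K$ is the simplex, and of degree at most $k$ in each variable if $\hat K$ is the hypercube. **The method.** Let $n_K$ be the outward unit normal of $K$. On an interior face between $K$ and $K'$ put $[\![v]\!]=v|_Kn_K+v|_{K'}n_{K'}$, and let $\{q\}$ be the mean of the two one-sided values of $q$; on a boundary face of $K$ let $n=n_K$ and let $\{q\}=q|_K$. Let $|\cdot|$ also denote $d$- and $(d-1)$-dimensional measure. Let $\mu_F=\frac12(|K|+|K'|)/|F|$, $p_F=\frac12(p_K+p_{K'})$ on interior faces, $\mu_F=|K|/|F|$, $p_F=p_K$ on boundary faces, and $\sigma|_F=\alpha\,p_F^2/\mu_F$. Integrals involving $\nabla v$ or traces are taken elementwise. For $w,v\in V_{h,p}$ let $L(v)=\sum_K\int_Kfv\,dx+\int_{\Gamma_{h,N}}g_Nv\,ds$ and $N(w;v)=\sum_K\int_KA(\nabla w)\nabla w\cdot\nabla v\,dx+B_0(w;v)+B_D(w;v)$, where, with the abbreviations $z=\nabla w-\sigma[\![w]\!]$ on interior faces and $z=\nabla w-\sigma n(w-g_D)$ on Dirichlet faces, $$\begin{aligned}B_0(w;v)=&-\int_{\Gamma_{h,0}}\{A(z)\nabla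 w\}\cdot[\![v]\!]\,ds+\theta\int_{\Gamma_{h,0}}\{A^T(z)\nabla v\}\cdot[\![w]\!]\,ds\\&+\int_{\Gamma_{h,0}}\sigma\{A(z)\}[\![w]\!]\cdot[\![v]\!]\,ds+\theta\int_{\Gamma_{h,0}}\sigma^{-1}\{(A(\nabla w)-A(z))\nabla w\cdot\nabla v\}\,ds,\end{aligned}$$ $$\begin{aligned}B_D(w;v)=&-\int_{\Gamma_{h,D}}A(z)\nabla w\cdot n\,v\,ds+\theta\int_{\Gamma_{h,D}}A^T(z)\nabla v\cdot n\,(w-g_D)\,ds\\&+\int_{\Gamma_{h,D}}\sigma A(z)n\,v\cdot n\,(w-g_D)\,ds+\theta\int_{\Gamma_{h,D}}\sigma^{-1}(A(\nabla w)-A(z))\nabla w\cdot\nabla v\,ds.\end{aligned}$$ **Theorem (Existence and uniqueness).** Call $C$ an inverse-trace constant for $V_{h,p}$ if $$\sum_{F\in\mathcal F_h}\frac{\mu_F}{p_F^2}\int_F\{|\nabla v|\}^2\,ds\le C\sum_{K\in\mathcal T_h}\int_K|\nabla v|^2\,dx\qquad\text{for all }v\in V_{h,p}.$$ Such constants exist.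 Let $\theta\in[-1,1]$, let $C$ be any inverse-trace constant for $V_{h,p}$, let $\lambda_\theta=1+|1+\theta|$, and let $\alpha>\alpha_0=2C(1+\lambda_\theta C_A/M_A)^2$. Then there is exactly one $u_{h,p}\in V_{h,p}$ such that $N(u_{h,p};v)=L(v)$ for all $v\in V_{h,p}$. -/

import Mathlib

open MeasureTheory Set
open scoped RealInnerProductSpace

noncomputable section

namespace DG

/-- Euclidean space `ℝ^d`. -/
abbrev E (d : ℕ) := EuclideanSpace ℝ (Fin d)

/-- The `(d-1)`-dimensional surface measure on `ℝ^d`: the Hausdorff measure, normalised so that it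
agrees with Lebesgue measure on hyperplanes. -/
def surf (d : ℕ) : Measure (E d) := μHE[d - 1]

/-- The boundary of `Ω` is Lipschitz: near each of its points, `Ω` is the region above the graph
of a Lipschitz function over a hyperplane `e^⊥`. The function on `e^⊥` is extended to `ℝ^d`
so as to be constant in the direction `e`. -/
def HasLipschitzBoundary {d : ℕ} (Ω : Set (E d)) : Prop :=
  ∀ x ∈ frontier Ω, ∃ e : E d, ‖e‖ = 1 ∧ ∃ (L : NNReal) (γ : E d → ℝ), LipschitzWith L γ ∧
    (∀ (y : E d) (t : ℝ), γ (y + t • e) = γ y) ∧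
    ∃ r > 0, ∀ y ∈ Metric.ball x r, (y ∈ Ω ↔ γ y < ⟪y, e⟫)

/-- `ν` is the outward unit normal of `K` at `x`: near `x`, the set `K` agrees with the half-space
`{y | ⟪y - x, ν⟫ < 0}` up to arbitrarily thin cones around the hyperplane `x + ν^⊥`. -/
def IsOutwardNormal {d : ℕ} (K : Set (E d)) (x ν : E d) : Prop :=
  ‖ν‖ = 1 ∧ ∀ ε > 0, ∃ r > 0, ∀ y ∈ Metric.ball x r,
    (⟪y - x, ν⟫ < -ε * ‖y - x‖ → y ∈ K) ∧ (ε * ‖y - x‖ < ⟪y - x, ν⟫ → y ∉ K)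

open Classical in
/-- The outward unit normal `n_K`, set to `0` at the points where it does not exist. -/
def normal {d : ℕ} (K : Set (E d)) (x : E d) : E d :=
  if h : ∃ ν, IsOutwardNormal K x ν then h.choose else 0

/-- The two kinds of reference elements. -/
inductive RefShape
  | simplex
  | cube

/-- The open unit simplex, respectively the open unit hypercube. -/
def RefShape.domain (d : ℕ) : RefShape → Set (E d)
  | .simplex => {x | (∀ i, 0 < x i) ∧ ∑ i, x i < 1}
  | .cube => {x | ∀ i, 0 < x i ∧ x i < 1}

/-- Polynomials of total degree at most `k` on the simplex, and of degree at most `k` in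
each variable on the hypercube. -/
def RefShape.polys (d k : ℕ) : RefShape → Submodule ℝ (MvPolynomial (Fin d) ℝ)
  | .simplex => MvPolynomial.restrictTotalDegree (Fin d) ℝ k
  | .cube => MvPolynomial.restrictDegree (Fin d) ℝ k

/-- A subdivision of `Ω` into finitely many open elements `K_i = T_i(K̂_i)`, with a
polynomial degree on each element. Each `T_i` is a `C^{r_i}`-diffeomorphism from the open reference
domain onto the element, with inverse `S_i`, and is one-to-one and continuous up to the boundary.
Non-affine elements and hanging nodes are allowed. -/
structure HpMesh {d : ℕ} (Ω : Set (E d)) where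
  /-- number of elements -/
  n : ℕ
  /-- shape of the reference domain of each element -/
  shape : Fin n → RefShape
  /-- element maps -/
  T : Fin n → E d → E d
  /-- inverse element maps -/
  S : Fin n → E d → E d
  /-- orders of smoothness of the element maps -/
  r : Fin n → ℕ
  /-- local polynomial degrees -/
  p : Fin n → ℕ
  two_le_r : ∀ i, 2 ≤ r i
  one_le_p : ∀ i, 1 ≤ p i
  contDiffOn_T : ∀ i, ContDiffOn ℝ (r i) (T i) ((shape i).domain d)
  contDiffOn_S : ∀ i, ContDiffOn ℝ (r i) (S i) (T i '' (shape i).domain d)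
  leftInvOn : ∀ i, LeftInvOn (S i) (T i) ((shape i).domain d)
  continuousOn_T : ∀ i, ContinuousOn (T i) (closure ((shape i).domain d))
  injOn_T : ∀ i, InjOn (T i) (closure ((shape i).domain d))
  isOpen_elem : ∀ i, IsOpen (T i '' (shape i).domain d)
  elem_subset : ∀ i, T i '' (shape i).domain d ⊆ Ω
  disjoint_elem : ∀ i j, i ≠ j →
    Disjoint (T i '' (shape i).domain d) (T j '' (shape j).domain d)
  closure_eq : closure Ω = ⋃ i, closure (T i '' (shape i).domain d)

namespace HpMesh

variable {d : ℕ} {Ω : Set (E d)} (M : HpMesh Ω)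

/-- The reference domain `K̂_i`. -/
def ref (i : Fin M.n) : Set (E d) := (M.shape i).domain d

/-- The element `K_i`. -/
def elem (i : Fin M.n) : Set (E d) := M.T i '' M.ref i

/-- The diameter `h_K`. -/
def h (i : Fin M.n) : ℝ := Metric.diam (M.elem i)

/-! ### Faces

The face of a pair of elements is `∂K ∩ ∂K'`, and the boundary faces are the sets `∂K ∩ Γ_D`
and `∂K ∩ Γ_N`, provided that they have positive surface measure. -/

/-- The common boundary `∂K_i ∩ ∂K_j`. -/
def iface (i j : Fin M.n) : Set (E d) := frontier (M.elem i) ∩ frontier (M.elem j)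

/-- The part of the boundary of `K_i` in `Γ`. -/
def bface (Γ : Set (E d)) (i : Fin M.n) : Set (E d) := frontier (M.elem i) ∩ Γ

open Classical in
/-- The interior faces, indexed by pairs `i < j` of neighbouring elements. -/
def intFaces : Finset (Fin M.n × Fin M.n) :=
  Finset.univ.filter fun q => q.1 < q.2 ∧ 0 < surf d (M.iface q.1 q.2)

open Classical in
/-- The boundary faces on `Γ`, indexed by their elements. -/
def bdryFaces (Γ : Set (E d)) : Finset (Fin M.n) :=
  Finset.univ.filter fun i => 0 < surf d (M.bface Γ i)

/-- `μ_F` on an interior face. -/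
def muI (q : Fin M.n × Fin M.n) : ℝ :=
  (1 / 2) * (volume.real (M.elem q.1) + volume.real (M.elem q.2)) /
    (surf d).real (M.iface q.1 q.2)

/-- `μ_F` on a boundary face. -/
def muB (Γ : Set (E d)) (i : Fin M.n) : ℝ :=
  volume.real (M.elem i) / (surf d).real (M.bface Γ i)

/-- `p_F` on an interior face. -/
def pI (q : Fin M.n × Fin M.n) : ℝ := (1 / 2) * ((M.p q.1 : ℝ) + (M.p q.2 : ℝ))

/-- The structural assumptions on the subdivision: bounds `|T_K|_{W^s_∞} ≤ β₁ h_K^s` and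
`|T_K⁻¹|_{W^s_∞} ≤ β₁ h_K^{-s}` for integers `0 ≤ s ≤ r_K`, uniform grading, and bounded local
variation of the polynomial degrees. -/
structure Admissible (β₁ β₂ β₃ : ℝ) : Prop where
  bound_T : ∀ i, ∀ s ≤ M.r i, ∀ x ∈ M.ref i,
    ‖iteratedFDeriv ℝ s (M.T i) x‖ ≤ β₁ * M.h i ^ s
  bound_S : ∀ i, ∀ s ≤ M.r i, ∀ x ∈ M.elem i,
    ‖iteratedFDeriv ℝ s (M.S i) x‖ ≤ β₁ * (M.h i ^ s)⁻¹
  pos₂ : 0 < β₂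
  graded : ∀ q ∈ M.intFaces, β₂⁻¹ ≤ M.h q.1 / M.h q.2 ∧ M.h q.1 / M.h q.2 ≤ β₂
  pos₃ : 0 < β₃
  degrees : ∀ q ∈ M.intFaces,
    β₃⁻¹ ≤ (M.p q.1 : ℝ) / M.p q.2 ∧ (M.p q.1 : ℝ) / M.p q.2 ≤ β₃

/-- The finite element space `V_{h,p}`. Its members are piecewise smooth with bounded
derivatives, so they lie in the broken Sobolev space. The elements cover `Ω` up to a null set;
of each class of almost everywhere equal functions we take the member that vanishes outside the
open elements. -/
def V : Set (E d → ℝ) :=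
  {v | (∀ i, ∃ P ∈ (M.shape i).polys d (M.p i), ∀ x ∈ M.ref i,
      v (M.T i x) = MvPolynomial.eval (fun k => x k) P) ∧
    ∀ x, x ∉ ⋃ i, M.elem i → v x = 0}

/-- The trace of `v|_{K_i}` on `∂K_i`: the limit from inside `K_i`. -/
def tr (i : Fin M.n) (v : E d → ℝ) : E d → ℝ := extendFrom (M.elem i) v

/-- The trace of `(∇v)|_{K_i}` on `∂K_i`: the limit from inside `K_i`. -/
def trGrad (i : Fin M.n) (v : E d → ℝ) : E d → E d := extendFrom (M.elem i) (gradient v)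

/-- The outward unit normal of `K_i`. -/
def nrm (i : Fin M.n) : E d → E d := normal (M.elem i)

/-- The jump on an interior face, `v|_K n_K + v|_{K'} n_{K'}`. -/
def jump (q : Fin M.n × Fin M.n) (v : E d → ℝ) (x : E d) : E d :=
  M.tr q.1 v x • M.nrm q.1 x + M.tr q.2 v x • M.nrm q.2 x

/-- The average of a quantity given on both sides of an interior face. -/
def avg {F : Type*} [AddCommGroup F] [Module ℝ F] (q : Fin M.n × Fin M.n) (a : Fin M.n → F) : F :=
  (1 / 2 : ℝ) • (a q.1 + a q.2)

/-- `C` is an inverse-trace constant for `V_{h,p}`: for all `v` in `V_{h,p}`,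
`∑_F μ_F / p_F² ∫_F {|∇v|}² ds ≤ C ∑_K ∫_K |∇v|² dx`, where `F` runs over all faces. -/
def IsInvTraceConst (ΓD ΓN : Set (E d)) (C : ℝ) : Prop :=
  ∀ v ∈ M.V,
    (∑ q ∈ M.intFaces, M.muI q / M.pI q ^ 2 *
        ∫ x in M.iface q.1 q.2, M.avg q (fun i => ‖M.trGrad i v x‖) ^ 2 ∂(surf d)) +
    (∑ i ∈ M.bdryFaces ΓD, M.muB ΓD i / (M.p i : ℝ) ^ 2 *
        ∫ x in M.bface ΓD i, ‖M.trGrad i v x‖ ^ 2 ∂(surf d)) +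
    (∑ i ∈ M.bdryFaces ΓN, M.muB ΓN i / (M.p i : ℝ) ^ 2 *
        ∫ x in M.bface ΓN i, ‖M.trGrad i v x‖ ^ 2 ∂(surf d)) ≤
    C * ∑ i, ∫ x in M.elem i, ‖gradient v x‖ ^ 2

/-- The penalty function `σ = α p_F² / μ_F` on an interior face. -/
def sigmaI (α : ℝ) (q : Fin M.n × Fin M.n) : ℝ := α * M.pI q ^ 2 / M.muI q

/-- The penalty function `σ = α p_F² / μ_F` on a boundary face. -/
def sigmaB (α : ℝ) (Γ : Set (E d)) (i : Fin M.n) : ℝ := α * (M.p i : ℝ) ^ 2 / M.muB Γ i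

variable (A : E d → E d → (E d →L[ℝ] E d)) (θ α : ℝ)

/-- The terms on the interior faces. -/
def B0 (w v : E d → ℝ) : ℝ :=
  ∑ q ∈ M.intFaces,
    let F := M.iface q.1 q.2
    let σ := M.sigmaI α q
    -- one-sided value of `∇w - σ ⟦w⟧`
    let s : Fin M.n → E d → E d := fun i x => M.trGrad i w x - σ • M.jump q w x
    (-(∫ x in F, ⟪M.avg q (fun i => A x (s i x) (M.trGrad i w x)), M.jump q v x⟫ ∂(surf d))
      + θ * (∫ x in F,
          ⟪M.avg q (fun i => (A x (s i x)).adjoint (M.trGrad i v x)), M.jump q w x⟫ ∂(surf d))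
      + (∫ x in F,
          σ * ⟪M.avg q (fun i => A x (s i x)) (M.jump q w x), M.jump q v x⟫ ∂(surf d))
      + θ * (∫ x in F, σ⁻¹ * M.avg q (fun i =>
          ⟪(A x (M.trGrad i w x) - A x (s i x)) (M.trGrad i w x), M.trGrad i v x⟫) ∂(surf d)))

/-- The terms on the Dirichlet faces. -/
def BD (ΓD : Set (E d)) (gD : E d → ℝ) (w v : E d → ℝ) : ℝ :=
  ∑ i ∈ M.bdryFaces ΓD,
    let F := M.bface ΓD i
    let σ := M.sigmaB α ΓD i
    -- one-sided value of `∇w - σ n (w - g_D)`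
    let s : E d → E d := fun x => M.trGrad i w x - σ • ((M.tr i w x - gD x) • M.nrm i x)
    (-(∫ x in F, ⟪A x (s x) (M.trGrad i w x), M.nrm i x⟫ * M.tr i v x ∂(surf d))
      + θ * (∫ x in F, ⟪(A x (s x)).adjoint (M.trGrad i v x), M.nrm i x⟫ *
          (M.tr i w x - gD x) ∂(surf d))
      + (∫ x in F, σ * (⟪A x (s x) (M.tr i v x • M.nrm i x), M.nrm i x⟫ *
          (M.tr i w x - gD x)) ∂(surf d))
      + θ * (∫ x in F, σ⁻¹ *
          ⟪(A x (M.trGrad i w x) - A x (s x)) (M.trGrad i w x), M.trGrad i v x⟫ ∂(surf d)))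

/-- The semilinear form `N(w; v)`. -/
def N (ΓD : Set (E d)) (gD : E d → ℝ) (w v : E d → ℝ) : ℝ :=
  (∑ i, ∫ x in M.elem i, ⟪A x (gradient w x) (gradient w x), gradient v x⟫)
    + M.B0 A θ α w v + M.BD A θ α ΓD gD w v

/-- The linear form `L(v)`. -/
def load (ΓN : Set (E d)) (f gN : E d → ℝ) (v : E d → ℝ) : ℝ :=
  (∑ i, ∫ x in M.elem i, f x * v x)
    + ∑ i ∈ M.bdryFaces ΓN, ∫ x in M.bface ΓN i, gN x * M.tr i v x ∂(surf d)

end HpMesh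

end DG

end

/-! On one side of a face let z be ∇w - σ⟦w⟧ (with w - g_D in the jump on Dirichlet faces). The four
face terms of `N` collapse to -A(z)z·⟦v⟧ + θσ⁻¹(A(∇w)∇w - A(z)z)·∇v. Hence only the fluxes A(x,v)v
occur, and these are Lipschitz and strongly monotone (`sideIntegrand_eq`, `B0_eq`, `BD_eq`).

Take two arguments and test with their difference. Let g, J and z now denote the differences of
gradients, jumps and z-values, and G and D the differences of the fluxes at the gradients and at the
z-values. The data g_D cancel, and J = σ⁻¹(g - z) turns the integrand into σ⁻¹(D·z - (1+θ)D·g +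
θG·g). Monotonicity gives D·z ≥ M_A|z|², Young's inequality absorbs the mixed term, and θ ≥ -1 with
0 ≤ G·g ≤ C_A|g|² controls the last one. This leaves σ⁻¹(M_A/2 |z|² - κ|g|²) with κ =
|1+θ|²C_A²/(2M_A) + C_A (`le_side_of_flux`). Since σ⁻¹ = α⁻¹μ_F/p_F², the inverse-trace inequality
bounds the total loss by 2κC/α times the element energy ∑_K ∫_K |g|². For α > α₀ this is less than
the gain M_A ∑_K ∫_K |g|² of the elements (`le_N_sub`, `energy_weight_pos`).

The remaining energy is definite (`eq_zero_of_energy`). If it vanishes, the function is constant on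
each element, so z = 0 forces the jumps to vanish almost everywhere on faces. Outward normals exist
almost everywhere on element boundaries, and those of two disjoint elements at a common point are
opposite, so neighbouring constants agree. The adjacency graph is connected because a closed set of
vanishing surface measure cannot separate a ball (`exists_adjacent`), and the constant is 0 next to
a Dirichlet face.

The space `V` is finite-dimensional, so a definite quadratic energy dominates a norm. The form is
thus Lipschitz and strongly monotone, and Zarantonello's fixed point argument
(`IsLipForm.existsUnique`) gives exactly one solution. Inverse-trace constants exist by the same
compactness: a function without element energy has vanishing gradient traces
(`exists_le_mul_of_ker_le`). -/

noncomputable section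

namespace DG

open Filter Topology

/-! ### Surface measure and the geometry of the reference polyhedra -/

section

variable {d : ℕ}

/-- The normalising factor between the two measures is finite and nonzero. Null sets and sets of
finite measure are therefore those of the Hausdorff measure, for which estimates of Lipschitz images
are available. -/
theorem surf_eq_zero_iff {s : Set (E d)} : surf d s = 0 ↔ μH[((d - 1 : ℕ) : ℝ)] s = 0 := by
  rw [surf, Measure.euclideanHausdorffMeasure_def, Measure.smul_apply, smul_eq_zero]
  simp [Measure.addHaarScalarFactor_volume_hausdorffMeasure_ne_zero]

theorem surf_lt_top_iff {s : Set (E d)} : surf d s < ⊤ ↔ μH[((d - 1 : ℕ) : ℝ)] s < ⊤ := by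
  rw [surf, Measure.euclideanHausdorffMeasure_def, Measure.smul_apply, ENNReal.smul_def, smul_eq_mul,
    ENNReal.mul_lt_top_iff]
  have h := Measure.addHaarScalarFactor_volume_hausdorffMeasure_ne_zero (d - 1)
  constructor
  · rintro (h' | h' | h')
    · exact h'.2
    · exact absurd (by exact_mod_cast h') h
    · simp [h']
  · intro h'
    exact Or.inl ⟨ENNReal.coe_lt_top, h'⟩

theorem surf_image_eq_zero {T : E d → E d} {s t : Set (E d)} {K : NNReal}
    (hT : LipschitzOnWith K T s) (hts : t ⊆ s) (ht : surf d t = 0) : surf d (T '' t) = 0 := by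
  rw [surf_eq_zero_iff] at ht ⊢
  have := (hT.mono hts).hausdorffMeasure_image_le (d := ((d - 1 : ℕ) : ℝ)) (by positivity)
  rw [ht, mul_zero] at this
  exact le_antisymm this bot_le

theorem surf_image_lt_top {T : E d → E d} {s : Set (E d)} {K : NNReal}
    (hT : LipschitzOnWith K T s) (hs : surf d s < ⊤) : surf d (T '' s) < ⊤ := by
  rw [surf_lt_top_iff] at hs ⊢
  refine (hT.hausdorffMeasure_image_le (d := ((d - 1 : ℕ) : ℝ)) (by positivity)).trans_lt ?_
  exact ENNReal.mul_lt_top (ENNReal.rpow_lt_top_of_nonneg (by positivity) ENNReal.coe_ne_top) hs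

theorem finrank_orthogonal_singleton {a : E d} (ha : a ≠ 0) :
    Module.finrank ℝ (ℝ ∙ a)ᗮ = d - 1 := by
  have h1 := Submodule.finrank_add_finrank_orthogonal (ℝ ∙ a)
  rw [finrank_span_singleton ha, finrank_euclideanSpace_fin] at h1
  omega

/-- Bounded subsets of a hyperplane have finite surface measure. -/
theorem surf_hyperplane_inter_lt_top {a : E d} (ha : a ≠ 0) (b : ℝ) {s : Set (E d)}
    (hs : Bornology.IsBounded s) : surf d ({x | ⟪a, x⟫ = b} ∩ s) < ⊤ := by
  rcases ({x | ⟪a, x⟫ = b} ∩ s).eq_empty_or_nonempty with h | ⟨x₀, hx₀, -⟩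
  · simp [h]
  set H := (ℝ ∙ a)ᗮ
  obtain ⟨R, hR⟩ := hs.subset_closedBall x₀
  have hsub : {x | ⟪a, x⟫ = b} ∩ s ⊆ (fun y : H => x₀ + (y : E d)) '' Metric.closedBall 0 R := by
    rintro x ⟨hx, hxs⟩
    refine ⟨⟨x - x₀, ?_⟩, ?_, by simp⟩
    · rw [Submodule.mem_orthogonal_singleton_iff_inner_right, inner_sub_right]
      simp only [mem_ofPred_eq] at hx hx₀
      rw [hx, hx₀, sub_self]
    · have := hR hxs
      rw [mem_closedBall_iff_norm] at this
      simpa using this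
  have hiso : Isometry (fun y : H => x₀ + (y : E d)) :=
    (isometry_add_left x₀).comp H.subtypeₗᵢ.isometry
  refine (measure_mono hsub).trans_lt ?_
  rw [surf, hiso.euclideanHausdorffMeasure_image, ← finrank_orthogonal_singleton ha]
  exact (isCompact_closedBall _ _).measure_lt_top

/-- The intersection of two transversal hyperplanes has surface measure zero. -/
theorem surf_inter_hyperplanes {a a' : E d} (h : LinearIndependent ℝ ![a, a']) (b b' : ℝ) :
    surf d {x | ⟪a, x⟫ = b ∧ ⟪a', x⟫ = b'} = 0 := by
  rcases {x : E d | ⟪a, x⟫ = b ∧ ⟪a', x⟫ = b'}.eq_empty_or_nonempty with h0 | ⟨x₀, hx₀, hx₀'⟩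
  · simp [h0]
  set H := (Submodule.span ℝ (Set.range ![a, a']))ᗮ
  -- The intersection is a translate of a subset of a space of dimension d - 2, which is null for
  -- the (d-1)-dimensional measure.
  have hrank : (Module.finrank ℝ H : ℝ) < ((d - 1 : ℕ) : ℝ) := by
    have h1 := Submodule.finrank_add_finrank_orthogonal (Submodule.span ℝ (Set.range ![a, a']))
    rw [finrank_span_eq_card h, finrank_euclideanSpace_fin, Fintype.card_fin] at h1
    have : Module.finrank ℝ H < d - 1 := by simp only [H]; omega
    exact_mod_cast this
  have hsub : {x | ⟪a, x⟫ = b ∧ ⟪a', x⟫ = b'} ⊆ (fun y : H => x₀ + (y : E d)) '' univ := by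
    rintro x ⟨hx, hx'⟩
    refine ⟨⟨x - x₀, ?_⟩, mem_univ _, by simp⟩
    rw [Submodule.mem_orthogonal]
    intro u hu
    induction hu using Submodule.span_induction with
    | mem u hu =>
      obtain ⟨i, rfl⟩ := hu
      fin_cases i
      · simp [inner_sub_right, hx, hx₀]
      · simp [inner_sub_right, hx', hx₀']
    | zero => simp
    | add u v _ _ hu hv => rw [inner_add_left, hu, hv, add_zero]
    | smul c u _ hu => rw [inner_smul_left, hu, mul_zero]
  have hiso : Isometry (fun y : H => x₀ + (y : E d)) :=
    (isometry_add_left x₀).comp H.subtypeₗᵢ.isometry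
  refine measure_mono_null hsub ?_
  rw [surf_eq_zero_iff, hiso.hausdorffMeasure_image (Or.inl (by positivity)),
    Real.hausdorffMeasure_of_finrank_lt hrank]
  simp

/-- The reference domains are polyhedra whose facets lie in pairwise different hyperplanes. -/
theorem RefShape.exists_halfspaces (hd : 2 ≤ d) (σ : RefShape) :
    ∃ (ι : Type) (_ : Fintype ι) (a : ι → E d) (b : ι → ℝ),
      σ.domain d = {x | ∀ j, ⟪a j, x⟫ < b j} ∧ (∀ j, a j ≠ 0) ∧
      ∀ j k, j ≠ k → surf d {x | ⟪a j, x⟫ = b j ∧ ⟪a k, x⟫ = b k} = 0 := by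
  cases σ with
  | simplex =>
    let o : E d := WithLp.toLp 2 fun _ => 1
    have ho : ∀ x : E d, ⟪o, x⟫ = ∑ i, x i := fun x => by simp [o, PiLp.inner_apply]
    have he : ∀ (i : Fin d) (x : E d), ⟪-EuclideanSpace.single i (1 : ℝ), x⟫ = -x i :=
      fun i x => by simp [EuclideanSpace.inner_single_left]
    have hLI : ∀ i : Fin d, LinearIndependent ℝ ![o, -EuclideanSpace.single i (1 : ℝ)] := by
      intro i
      rw [LinearIndependent.pair_iff]
      intro s t hst
      obtain ⟨k, hk⟩ : ∃ k : Fin d, k ≠ i := by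
        have : Nontrivial (Fin d) := Fin.nontrivial_iff_two_le.2 hd
        exact exists_ne i
      have h1 := congrArg (fun x : E d => x k) hst
      have h2 := congrArg (fun x : E d => x i) hst
      simp [o, hk] at h1 h2
      constructor <;> linarith
    refine ⟨Option (Fin d), inferInstance,
      fun j => j.elim o fun i => -EuclideanSpace.single i (1 : ℝ), fun j => j.elim 1 fun _ => 0,
      ?_, ?_, ?_⟩
    · ext x
      simp only [RefShape.domain, mem_ofPred_eq, Option.forall, Option.elim_none, Option.elim_some,
        ho, he, neg_lt_zero]
      tauto
    · rintro (_ | i)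
      · exact (hLI ⟨0, by omega⟩).ne_zero 0
      · simp
    · rintro (_ | i) (_ | k) hjk
      · exact absurd rfl hjk
      · exact surf_inter_hyperplanes (hLI k) _ _
      · refine measure_mono_null ?_ (surf_inter_hyperplanes (hLI i) 1 0)
        rintro x ⟨h1, h2⟩
        exact ⟨h2, h1⟩
      · refine surf_inter_hyperplanes ?_ _ _
        have hik : i ≠ k := fun h => hjk (by rw [h])
        rw [LinearIndependent.pair_iff]
        intro s t hst
        have h1 := congrArg (fun x : E d => x k) hst
        have h2 := congrArg (fun x : E d => x i) hst
        simp [hik, hik.symm] at h1 h2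
        exact ⟨h2, h1⟩
  | cube =>
    have he : ∀ (i : Fin d) (c : ℝ) (x : E d), ⟪EuclideanSpace.single i c, x⟫ = c * x i :=
      fun i c x => by simp [EuclideanSpace.inner_single_left]
    refine ⟨Fin d × Bool, inferInstance,
      fun j => EuclideanSpace.single j.1 (if j.2 then (1 : ℝ) else -1),
      fun j => if j.2 then 1 else 0, ?_, ?_, ?_⟩
    · ext x
      simp only [RefShape.domain, mem_ofPred_eq, Prod.forall, Bool.forall_bool, he]
      simp
    · rintro ⟨i, b⟩
      cases b <;> simp
    · rintro ⟨i, b⟩ ⟨k, b'⟩ hjk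
      by_cases hik : i = k
      · subst hik
        have : {x : E d | ⟪EuclideanSpace.single i (if b then (1 : ℝ) else -1), x⟫ =
            (if b then 1 else 0) ∧ ⟪EuclideanSpace.single i (if b' then (1 : ℝ) else -1), x⟫ =
            (if b' then 1 else 0)} = ∅ := by
          ext x
          simp only [he, mem_ofPred_eq, mem_empty_iff_false, iff_false]
          cases b <;> cases b' <;> simp at hjk ⊢ <;> intro h <;> simp [h]
        simp only [this, measure_empty]
      · refine surf_inter_hyperplanes ?_ _ _
        rw [LinearIndependent.pair_iff]
        intro s t hst
        have h1 := congrArg (fun x : E d => x k) hst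
        have h2 := congrArg (fun x : E d => x i) hst
        have hki : ¬ k = i := fun h => hik h.symm
        cases b <;> cases b' <;> simp [hik, hki] at h1 h2 <;> exact ⟨h2, h1⟩

theorem RefShape.domain_nonempty (hd : 2 ≤ d) (σ : RefShape) : (σ.domain d).Nonempty := by
  cases σ with
  | simplex =>
    refine ⟨WithLp.toLp 2 fun _ => 1 / (d + 1 : ℝ), fun i => by simp; positivity, ?_⟩
    simp only [Finset.sum_const, Finset.card_univ, Fintype.card_fin, nsmul_eq_mul]
    rw [mul_one_div, div_lt_one (by positivity)]
    linarith
  | cube => exact ⟨WithLp.toLp 2 fun _ => 1 / 2, fun i => by norm_num⟩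

theorem RefShape.isBounded_domain (σ : RefShape) : Bornology.IsBounded (σ.domain d) := by
  rw [isBounded_iff_forall_norm_le]
  refine ⟨Real.sqrt (∑ _i : Fin d, 1), fun x hx => ?_⟩
  have key : ∀ i, 0 ≤ x i ∧ x i ≤ 1 := by
    intro i
    cases σ with
    | simplex =>
      exact ⟨(hx.1 i).le, (Finset.single_le_sum (fun j _ => (hx.1 j).le)
        (Finset.mem_univ i)).trans hx.2.le⟩
    | cube => exact ⟨(hx i).1.le, (hx i).2.le⟩
  rw [EuclideanSpace.norm_eq]
  refine Real.sqrt_le_sqrt (Finset.sum_le_sum fun i _ => ?_)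
  rw [Real.norm_eq_abs, sq_abs]
  nlinarith [key i]

theorem isOpen_polyhedron {ι : Type} [Fintype ι] {a : ι → E d} {b : ι → ℝ} :
    IsOpen {x : E d | ∀ j, ⟪a j, x⟫ < b j} := by
  rw [ofPred_forall]
  exact isOpen_iInter_of_finite fun j => isOpen_lt (by fun_prop) continuous_const

theorem convex_polyhedron {ι : Type} {a : ι → E d} {b : ι → ℝ} :
    Convex ℝ {x : E d | ∀ j, ⟪a j, x⟫ < b j} := by
  rw [ofPred_forall]
  exact convex_iInter fun j => convex_halfSpace_lt (innerSL ℝ (a j)).toLinearMap.isLinear _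

theorem closure_polyhedron_subset {ι : Type} {a : ι → E d} {b : ι → ℝ} :
    closure {x : E d | ∀ j, ⟪a j, x⟫ < b j} ⊆ {x | ∀ j, ⟪a j, x⟫ ≤ b j} := by
  refine closure_minimal (fun x hx j => (hx j).le) ?_
  rw [ofPred_forall]
  exact isClosed_iInter fun j => isClosed_le (by fun_prop) continuous_const

theorem exists_active_of_mem_frontier {ι : Type} [Fintype ι] {a : ι → E d} {b : ι → ℝ} {x : E d}
    (hx : x ∈ frontier {x : E d | ∀ j, ⟪a j, x⟫ < b j}) : ∃ j, ⟪a j, x⟫ = b j := by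
  rw [isOpen_polyhedron.frontier_eq] at hx
  obtain ⟨j, hj⟩ := not_forall.1 hx.2
  exact ⟨j, le_antisymm (closure_polyhedron_subset hx.1 j) (not_lt.1 hj)⟩

theorem RefShape.isOpen_domain (hd : 2 ≤ d) (σ : RefShape) : IsOpen (σ.domain d) := by
  obtain ⟨ι, _, a, b, h, -⟩ := σ.exists_halfspaces hd
  rw [h]; exact isOpen_polyhedron

theorem RefShape.convex_domain (hd : 2 ≤ d) (σ : RefShape) : Convex ℝ (σ.domain d) := by
  obtain ⟨ι, _, a, b, h, -⟩ := σ.exists_halfspaces hd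
  rw [h]; exact convex_polyhedron

theorem RefShape.isCompact_closure_domain (σ : RefShape) : IsCompact (closure (σ.domain d)) :=
  σ.isBounded_domain.isCompact_closure

/-- A boundary point satisfies one of the defining inequalities with equality, so the boundary is
covered by finitely many bounded pieces of hyperplanes. -/
theorem RefShape.surf_frontier_lt_top (hd : 2 ≤ d) (σ : RefShape) :
    surf d (frontier (σ.domain d)) < ⊤ := by
  obtain ⟨ι, _, a, b, h, ha, -⟩ := σ.exists_halfspaces hd
  have hsub : frontier (σ.domain d) ⊆ ⋃ j, ({x | ⟪a j, x⟫ = b j} ∩ closure (σ.domain d)) := by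
    intro x hx
    have hx' := hx
    rw [h] at hx
    obtain ⟨j, hj⟩ := exists_active_of_mem_frontier hx
    exact mem_iUnion.2 ⟨j, hj, frontier_subset_closure hx'⟩
  refine (measure_mono hsub).trans_lt ((measure_iUnion_fintype_le _ _).trans_lt ?_)
  exact ENNReal.sum_lt_top.2 fun j _ =>
    surf_hyperplane_inter_lt_top (ha j) _ σ.isBounded_domain.closure

end

/-! ### Element maps up to the boundary, and traces of finite element functions -/

section

variable {d : ℕ}

theorem exists_lipschitzOnWith_of_bounded_fderiv {F : Type*} [NormedAddCommGroup F]
    [NormedSpace ℝ F] {f : E d → F} {f' : E d → E d →L[ℝ] F} {s : Set (E d)} (hs : Convex ℝ s)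
    {C : ℝ} (hf : ∀ x ∈ s, HasFDerivAt f (f' x) x) (hC : ∀ x ∈ s, ‖f' x‖ ≤ C) :
    ∃ K, LipschitzOnWith K f s := by
  refine ⟨C.toNNReal, hs.lipschitzOnWith_of_nnnorm_hasFDerivWithin_le
    (fun x hx => (hf x hx).hasFDerivWithinAt) fun x hx => ?_⟩
  rw [← NNReal.coe_le_coe, coe_nnnorm]
  exact (hC x hx).trans (Real.le_coe_toNNReal C)

/-- On a convex set a bounded derivative gives a Lipschitz bound, and Lipschitz maps into
finite-dimensional spaces extend to the whole space. -/
theorem exists_continuous_extension_of_bounded_fderiv {F : Type*} [NormedAddCommGroup F]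
    [NormedSpace ℝ F] [FiniteDimensional ℝ F] {f : E d → F} {f' : E d → E d →L[ℝ] F}
    {s : Set (E d)} (hs : Convex ℝ s) {C : ℝ} (hf : ∀ x ∈ s, HasFDerivAt f (f' x) x)
    (hC : ∀ x ∈ s, ‖f' x‖ ≤ C) : ∃ g : E d → F, Continuous g ∧ EqOn f g s := by
  obtain ⟨K, hK⟩ := exists_lipschitzOnWith_of_bounded_fderiv hs hf hC
  obtain ⟨g, hg, hfg⟩ := hK.extend_finite_dimension
  exact ⟨g, hg.continuous, hfg⟩

theorem contDiff_eval_mvPolynomial (P : MvPolynomial (Fin d) ℝ) {n : WithTop ℕ∞} :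
    ContDiff ℝ n fun x : E d => MvPolynomial.eval (fun k => x k) P := by
  have h := AnalyticOnNhd.eval_continuousLinearMap
    ((EuclideanSpace.equiv (Fin d) ℝ : E d ≃L[ℝ] (Fin d → ℝ)) : E d →L[ℝ] (Fin d → ℝ)) P
  exact contDiff_iff_contDiffAt.2 fun x => (h x (mem_univ x)).contDiffAt

namespace HpMesh

variable {Ω : Set (E d)} (M : HpMesh Ω) {β₁ β₂ β₃ : ℝ} (i : Fin M.n)

theorem isOpen_ref (hd : 2 ≤ d) : IsOpen (M.ref i) := RefShape.isOpen_domain hd _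

theorem convex_ref (hd : 2 ≤ d) : Convex ℝ (M.ref i) := RefShape.convex_domain hd _

theorem ref_nonempty (hd : 2 ≤ d) : (M.ref i).Nonempty := RefShape.domain_nonempty hd _

theorem isCompact_closure_ref : IsCompact (closure (M.ref i)) :=
  RefShape.isCompact_closure_domain _

theorem isOpen_elem' : IsOpen (M.elem i) := M.isOpen_elem i

theorem elem_nonempty (hd : 2 ≤ d) : (M.elem i).Nonempty := (M.ref_nonempty i hd).image _

theorem S_T {x : E d} (hx : x ∈ M.ref i) : M.S i (M.T i x) = x := M.leftInvOn i hx

theorem closure_elem : closure (M.elem i) = M.T i '' closure (M.ref i) := by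
  refine subset_antisymm ?_ ?_
  · refine closure_minimal (image_mono subset_closure) ?_
    exact ((M.isCompact_closure_ref i).image_of_continuousOn (M.continuousOn_T i)).isClosed
  · exact (M.continuousOn_T i).image_closure

theorem isCompact_closure_elem : IsCompact (closure (M.elem i)) := by
  rw [closure_elem]
  exact (M.isCompact_closure_ref i).image_of_continuousOn (M.continuousOn_T i)

theorem frontier_elem_subset (hd : 2 ≤ d) :
    frontier (M.elem i) ⊆ M.T i '' frontier (M.ref i) := by
  rw [(M.isOpen_elem' i).frontier_eq, (M.isOpen_ref i hd).frontier_eq, closure_elem]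
  rintro _ ⟨⟨x, hx, rfl⟩, hx'⟩
  exact ⟨x, ⟨hx, fun h => hx' ⟨x, h, rfl⟩⟩, rfl⟩

theorem isPreconnected_elem (hd : 2 ≤ d) : IsPreconnected (M.elem i) :=
  (M.convex_ref i hd).isPreconnected.image _ ((M.continuousOn_T i).mono subset_closure)

theorem contDiffAt_T (hd : 2 ≤ d) {x : E d} (hx : x ∈ M.ref i) : ContDiffAt ℝ 2 (M.T i) x :=
  ((M.contDiffOn_T i).contDiffAt ((M.isOpen_ref i hd).mem_nhds hx)).of_le
    (by exact_mod_cast M.two_le_r i)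

theorem contDiffAt_S {y : E d} (hy : y ∈ M.elem i) : ContDiffAt ℝ 2 (M.S i) y :=
  ((M.contDiffOn_S i).contDiffAt ((M.isOpen_elem' i).mem_nhds hy)).of_le
    (by exact_mod_cast M.two_le_r i)

theorem hasFDerivAt_T (hd : 2 ≤ d) {x : E d} (hx : x ∈ M.ref i) :
    HasFDerivAt (M.T i) (fderiv ℝ (M.T i) x) x :=
  ((M.contDiffAt_T i hd hx).differentiableAt (by norm_num)).hasFDerivAt

theorem hasFDerivAt_S {y : E d} (hy : y ∈ M.elem i) :
    HasFDerivAt (M.S i) (fderiv ℝ (M.S i) y) y :=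
  ((M.contDiffAt_S i hy).differentiableAt (by norm_num)).hasFDerivAt

variable {M}

namespace Admissible

variable (hM : M.Admissible β₁ β₂ β₃)

include hM

theorem norm_fderiv_T_le {x : E d} (hx : x ∈ M.ref i) : ‖fderiv ℝ (M.T i) x‖ ≤ β₁ * M.h i ^ 1 := by
  have := hM.bound_T i 1 ((by norm_num : 1 ≤ 2).trans (M.two_le_r i)) x hx
  rwa [norm_iteratedFDeriv_one] at this

theorem norm_fderiv_fderiv_T_le {x : E d} (hx : x ∈ M.ref i) :
    ‖fderiv ℝ (fderiv ℝ (M.T i)) x‖ ≤ β₁ * M.h i ^ 2 := by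
  have := hM.bound_T i 2 (M.two_le_r i) x hx
  rwa [← norm_iteratedFDeriv_fderiv, norm_iteratedFDeriv_one] at this

theorem norm_fderiv_fderiv_S_le {y : E d} (hy : y ∈ M.elem i) :
    ‖fderiv ℝ (fderiv ℝ (M.S i)) y‖ ≤ β₁ * (M.h i ^ 2)⁻¹ := by
  have := hM.bound_S i 2 (M.two_le_r i) y hy
  rwa [← norm_iteratedFDeriv_fderiv, norm_iteratedFDeriv_one] at this

theorem exists_lipschitzOnWith_T (hd : 2 ≤ d) :
    ∃ K, LipschitzOnWith K (M.T i) (closure (M.ref i)) := by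
  obtain ⟨K, hK⟩ := exists_lipschitzOnWith_of_bounded_fderiv (M.convex_ref i hd)
    (fun x hx => M.hasFDerivAt_T i hd hx) (fun x hx => norm_fderiv_T_le i hM hx)
  exact ⟨K, hK.closure (M.continuousOn_T i)⟩

/-- The bound on second derivatives, available because r_K ≥ 2, makes the first derivative Lipschitz
on the convex reference domain. -/
theorem exists_extension_fderiv_T (hd : 2 ≤ d) :
    ∃ D : E d → E d →L[ℝ] E d, Continuous D ∧ EqOn (fderiv ℝ (M.T i)) D (M.ref i) := by
  refine exists_continuous_extension_of_bounded_fderiv (M.convex_ref i hd)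
    (f' := fderiv ℝ (fderiv ℝ (M.T i))) (fun x hx => ?_)
    (fun x hx => norm_fderiv_fderiv_T_le i hM hx)
  have h : ContDiffAt ℝ 1 (fderiv ℝ (M.T i)) x :=
    (M.contDiffAt_T i hd hx).fderiv_right (by norm_num [one_add_one_eq_two])
  exact (h.differentiableAt (by norm_num)).hasFDerivAt

/-- The element itself need not be convex, so the derivative of the inverse map is pulled back to
the reference domain, where the chain rule bounds its derivative. -/
theorem exists_extension_fderiv_S_comp_T (hd : 2 ≤ d) :
    ∃ D : E d → E d →L[ℝ] E d, Continuous D ∧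
      EqOn (fun x => fderiv ℝ (M.S i) (M.T i x)) D (M.ref i) := by
  refine exists_continuous_extension_of_bounded_fderiv (M.convex_ref i hd)
    (f' := fun x => (fderiv ℝ (fderiv ℝ (M.S i)) (M.T i x)).comp (fderiv ℝ (M.T i) x))
    (C := β₁ * (M.h i ^ 2)⁻¹ * (β₁ * M.h i ^ 1)) (fun x hx => ?_) (fun x hx => ?_)
  · have hy : M.T i x ∈ M.elem i := ⟨x, hx, rfl⟩
    have h : ContDiffAt ℝ 1 (fderiv ℝ (M.S i)) (M.T i x) :=
      (M.contDiffAt_S i hy).fderiv_right (by norm_num [one_add_one_eq_two])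
    exact (h.differentiableAt (by norm_num)).hasFDerivAt.comp x (M.hasFDerivAt_T i hd hx)
  · have h1 := norm_fderiv_fderiv_S_le i hM (⟨x, hx, rfl⟩ : M.T i x ∈ M.elem i)
    exact (ContinuousLinearMap.opNorm_comp_le _ _).trans
      (mul_le_mul h1 (norm_fderiv_T_le i hM hx) (norm_nonneg _) (le_trans (by positivity) h1))

theorem surf_frontier_elem_lt_top (hd : 2 ≤ d) : surf d (frontier (M.elem i)) < ⊤ := by
  obtain ⟨K, hK⟩ := exists_lipschitzOnWith_T i hM hd
  refine (measure_mono (M.frontier_elem_subset i hd)).trans_lt ?_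
  exact surf_image_lt_top (hK.mono frontier_subset_closure) (RefShape.surf_frontier_lt_top hd _)

end Admissible

variable (M)

/-- The inverse of the element map, on the closed element. -/
def inv : E d → E d := Function.invFunOn (M.T i) (closure (M.ref i))

theorem inv_T {x : E d} (hx : x ∈ closure (M.ref i)) : M.inv i (M.T i x) = x :=
  (M.injOn_T i).leftInvOn_invFunOn hx

theorem inv_mem {y : E d} (hy : y ∈ closure (M.elem i)) : M.inv i y ∈ closure (M.ref i) := by
  rw [closure_elem] at hy
  obtain ⟨x, hx, rfl⟩ := hy
  rwa [inv_T M i hx]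

theorem T_inv {y : E d} (hy : y ∈ closure (M.elem i)) : M.T i (M.inv i y) = y := by
  rw [closure_elem] at hy
  obtain ⟨x, hx, rfl⟩ := hy
  rw [inv_T M i hx]

theorem inv_mem_ref {y : E d} (hy : y ∈ M.elem i) : M.inv i y ∈ M.ref i := by
  obtain ⟨x, hx, rfl⟩ := hy
  have := inv_T M i (subset_closure hx)
  rwa [this]

/-- A continuous injection on a compact set is a homeomorphism onto its image: the preimage of a
closed set under the inverse is a compact image under `T`. -/
theorem continuousOn_inv : ContinuousOn (M.inv i) (closure (M.elem i)) := by
  rw [continuousOn_iff_isClosed]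
  intro t ht
  refine ⟨M.T i '' (closure (M.ref i) ∩ t), ?_, ?_⟩
  · exact (((M.isCompact_closure_ref i).inter_right ht).image_of_continuousOn
      ((M.continuousOn_T i).mono inter_subset_left)).isClosed
  · rw [closure_elem]
    ext y
    constructor
    · rintro ⟨h, x, hx, rfl⟩
      rw [mem_preimage, inv_T M i hx] at h
      exact ⟨⟨x, ⟨hx, h⟩, rfl⟩, x, hx, rfl⟩
    · rintro ⟨⟨x, ⟨hx, hxt⟩, rfl⟩, -⟩
      refine ⟨?_, x, hx, rfl⟩
      rwa [mem_preimage, inv_T M i hx]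

/-- A function on an element whose pull-back to the reference domain extends continuously to the
closure has limits at the boundary. -/
theorem tendsto_of_pullback {F : Type*} [TopologicalSpace F] {φ ψ : E d → F} (hψ : Continuous ψ)
    (h : ∀ x ∈ M.ref i, φ (M.T i x) = ψ x) {y : E d} (hy : y ∈ closure (M.elem i)) :
    Tendsto φ (𝓝[M.elem i] y) (𝓝 (ψ (M.inv i y))) := by
  have h1 : Tendsto (fun z => ψ (M.inv i z)) (𝓝[M.elem i] y) (𝓝 (ψ (M.inv i y))) :=
    (hψ.tendsto _).comp (((M.continuousOn_inv i) y hy).mono_left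
      (nhdsWithin_mono _ subset_closure))
  refine h1.congr' ?_
  filter_upwards [self_mem_nhdsWithin] with z hz
  rw [← h _ (inv_mem_ref M i hz), T_inv M i (subset_closure hz)]

/-! ### Traces of finite element functions -/

variable {M}

theorem eqOn_of_mem_V {v : E d → ℝ} (hv : v ∈ M.V) :
    ∃ P : MvPolynomial (Fin d) ℝ, ∀ x ∈ M.ref i,
      v (M.T i x) = MvPolynomial.eval (fun k => x k) P := by
  obtain ⟨P, -, hP⟩ := hv.1 i
  exact ⟨P, hP⟩

/-- On the element the function is the polynomial composed with the inverse element map. -/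
theorem hasFDerivAt_of_mem_V {v : E d → ℝ} {P : MvPolynomial (Fin d) ℝ}
    (hP : ∀ x ∈ M.ref i, v (M.T i x) = MvPolynomial.eval (fun k => x k) P)
    {x : E d} (hx : x ∈ M.ref i) :
    HasFDerivAt v ((fderiv ℝ (fun x : E d => MvPolynomial.eval (fun k => x k) P) x).comp
      (fderiv ℝ (M.S i) (M.T i x))) (M.T i x) := by
  have hy : M.T i x ∈ M.elem i := ⟨x, hx, rfl⟩
  have h1 := ((contDiff_eval_mvPolynomial P (n := 1)).differentiable (by norm_num)
    (M.S i (M.T i x))).hasFDerivAt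
  rw [M.S_T i hx] at h1
  rw [← M.S_T i hx] at h1
  have h2 := h1.comp (M.T i x) (M.hasFDerivAt_S i hy)
  rw [M.S_T i hx] at h2
  refine h2.congr_of_eventuallyEq ?_
  filter_upwards [(M.isOpen_elem' i).mem_nhds hy] with z hz
  obtain ⟨w, hw, rfl⟩ := hz
  simp [hP w hw, M.S_T i hw]

theorem differentiableAt_of_mem_V {v : E d → ℝ} (hv : v ∈ M.V) {y : E d} (hy : y ∈ M.elem i) :
    DifferentiableAt ℝ v y := by
  obtain ⟨P, hP⟩ := eqOn_of_mem_V i hv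
  obtain ⟨x, hx, rfl⟩ := hy
  exact (hasFDerivAt_of_mem_V i hP hx).differentiableAt

theorem exists_tendsto_of_mem_V {v : E d → ℝ} (hv : v ∈ M.V) {y : E d}
    (hy : y ∈ closure (M.elem i)) : ∃ c, Tendsto v (𝓝[M.elem i] y) (𝓝 c) := by
  obtain ⟨P, hP⟩ := eqOn_of_mem_V i hv
  exact ⟨_, M.tendsto_of_pullback i (contDiff_eval_mvPolynomial P (n := 0)).continuous hP hy⟩

variable (hM : M.Admissible β₁ β₂ β₃)

include hM in
-- Pulled back to the reference domain, the gradient is built from the derivative of a polynomial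
-- and that of the inverse map, and both extend continuously to the closure. This is what makes the
-- limits in `trGrad` genuine.
theorem exists_tendsto_gradient_of_mem_V (hd : 2 ≤ d) {v : E d → ℝ} (hv : v ∈ M.V) {y : E d}
    (hy : y ∈ closure (M.elem i)) : ∃ c, Tendsto (gradient v) (𝓝[M.elem i] y) (𝓝 c) := by
  obtain ⟨P, hP⟩ := eqOn_of_mem_V i hv
  obtain ⟨D, hD, hSD⟩ := hM.exists_extension_fderiv_S_comp_T i hd
  refine ⟨_, M.tendsto_of_pullback i (ψ := fun x => (InnerProductSpace.toDual ℝ (E d)).symm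
    ((fderiv ℝ (fun x : E d => MvPolynomial.eval (fun k => x k) P) x).comp (D x))) ?_ ?_ hy⟩
  · have := (contDiff_eval_mvPolynomial P (n := 1)).continuous_fderiv (by norm_num)
    fun_prop
  · intro x hx
    rw [gradient, (hasFDerivAt_of_mem_V i hP hx).fderiv, ← hSD hx]

theorem tr_eq_of_mem {v : E d → ℝ} (hv : v ∈ M.V) {y : E d} (hy : y ∈ M.elem i) :
    M.tr i v y = v y :=
  extendFrom_eq (subset_closure hy)
    ((differentiableAt_of_mem_V i hv hy).continuousAt.continuousWithinAt)

theorem tendsto_tr {v : E d → ℝ} (hv : v ∈ M.V) {y : E d} (hy : y ∈ closure (M.elem i)) :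
    Tendsto v (𝓝[M.elem i] y) (𝓝 (M.tr i v y)) :=
  tendsto_extendFrom (exists_tendsto_of_mem_V i hv hy)

theorem continuousOn_tr {v : E d → ℝ} (hv : v ∈ M.V) :
    ContinuousOn (M.tr i v) (closure (M.elem i)) :=
  continuousOn_extendFrom subset_rfl fun _ hy => exists_tendsto_of_mem_V i hv hy

theorem tr_add {v w : E d → ℝ} (hv : v ∈ M.V) (hw : w ∈ M.V) {y : E d}
    (hy : y ∈ closure (M.elem i)) : M.tr i (v + w) y = M.tr i v y + M.tr i w y :=
  extendFrom_eq hy ((tendsto_tr i hv hy).add (tendsto_tr i hw hy))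

theorem tr_smul {v : E d → ℝ} (hv : v ∈ M.V) (c : ℝ) {y : E d}
    (hy : y ∈ closure (M.elem i)) : M.tr i (c • v) y = c * M.tr i v y :=
  extendFrom_eq hy ((tendsto_tr i hv hy).const_smul c)

include hM in
theorem tendsto_trGrad (hd : 2 ≤ d) {v : E d → ℝ} (hv : v ∈ M.V) {y : E d}
    (hy : y ∈ closure (M.elem i)) :
    Tendsto (gradient v) (𝓝[M.elem i] y) (𝓝 (M.trGrad i v y)) :=
  tendsto_extendFrom (exists_tendsto_gradient_of_mem_V i hM hd hv hy)

include hM in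
theorem continuousOn_trGrad (hd : 2 ≤ d) {v : E d → ℝ} (hv : v ∈ M.V) :
    ContinuousOn (M.trGrad i v) (closure (M.elem i)) :=
  continuousOn_extendFrom subset_rfl fun _ hy => exists_tendsto_gradient_of_mem_V i hM hd hv hy

include hM in
theorem trGrad_eq_of_mem (hd : 2 ≤ d) {v : E d → ℝ} (hv : v ∈ M.V) {y : E d}
    (hy : y ∈ M.elem i) : M.trGrad i v y = gradient v y := by
  obtain ⟨P, hP⟩ := eqOn_of_mem_V i hv
  obtain ⟨D, hD, hSD⟩ := hM.exists_extension_fderiv_S_comp_T i hd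
  have hψ : Continuous fun x => (InnerProductSpace.toDual ℝ (E d)).symm
    ((fderiv ℝ (fun x : E d => MvPolynomial.eval (fun k => x k) P) x).comp (D x)) := by
    have := (contDiff_eval_mvPolynomial P (n := 1)).continuous_fderiv (by norm_num)
    fun_prop
  have key : ∀ x ∈ M.ref i, gradient v (M.T i x) = (InnerProductSpace.toDual ℝ (E d)).symm
      ((fderiv ℝ (fun x : E d => MvPolynomial.eval (fun k => x k) P) x).comp (D x)) := by
    intro x hx
    rw [gradient, (hasFDerivAt_of_mem_V i hP hx).fderiv, ← hSD hx]
  refine extendFrom_eq (subset_closure hy) ?_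
  have := M.tendsto_of_pullback i hψ key (subset_closure hy)
  rwa [← key _ (inv_mem_ref M i hy), T_inv M i (subset_closure hy)] at this

theorem gradient_add_of_mem {v w : E d → ℝ} (hv : v ∈ M.V) (hw : w ∈ M.V) {y : E d}
    (hy : y ∈ M.elem i) : gradient (v + w) y = gradient v y + gradient w y := by
  rw [gradient, fderiv_add (differentiableAt_of_mem_V i hv hy) (differentiableAt_of_mem_V i hw hy),
    map_add]
  rfl

theorem gradient_smul_of_mem {v : E d → ℝ} (hv : v ∈ M.V) (c : ℝ) {y : E d}
    (hy : y ∈ M.elem i) : gradient (c • v) y = c • gradient v y := by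
  rw [gradient, fderiv_const_smul (differentiableAt_of_mem_V i hv hy), map_smul]
  rfl

include hM in
theorem trGrad_add (hd : 2 ≤ d) {v w : E d → ℝ} (hv : v ∈ M.V) (hw : w ∈ M.V) {y : E d}
    (hy : y ∈ closure (M.elem i)) :
    M.trGrad i (v + w) y = M.trGrad i v y + M.trGrad i w y := by
  refine extendFrom_eq hy (((tendsto_trGrad i hM hd hv hy).add
    (tendsto_trGrad i hM hd hw hy)).congr' ?_)
  filter_upwards [self_mem_nhdsWithin] with z hz
  rw [gradient_add_of_mem i hv hw hz]

include hM in
theorem trGrad_smul (hd : 2 ≤ d) {v : E d → ℝ} (hv : v ∈ M.V) (c : ℝ) {y : E d}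
    (hy : y ∈ closure (M.elem i)) : M.trGrad i (c • v) y = c • M.trGrad i v y := by
  refine extendFrom_eq hy (((tendsto_trGrad i hM hd hv hy).const_smul c).congr' ?_)
  filter_upwards [self_mem_nhdsWithin] with z hz
  rw [gradient_smul_of_mem i hv c hz]

end HpMesh

end

/-! ### Outward normals: uniqueness, measurability, existence almost everywhere -/

section

variable {d : ℕ}

/-! ### Outward normals -/

/-- A ray pointing strictly inwards stays in a cone whose opening is admissible in the definition of
the normal. Such rays are the only test objects needed for uniqueness and opposite directions. -/
theorem IsOutwardNormal.eventually_mem {K : Set (E d)} {x ν e : E d} (h : IsOutwardNormal K x ν)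
    (he : ⟪e, ν⟫ < 0) : ∀ᶠ t : ℝ in 𝓝[>] 0, x + t • e ∈ K := by
  have he0 : 0 < ‖e‖ := norm_pos_iff.2 fun h => by simp [h] at he
  -- Half of the cosine between -e and ν, so that the strict inequality in the cone condition
  -- survives.
  obtain ⟨r, hr, hK⟩ := h.2 (-⟪e, ν⟫ / (2 * ‖e‖)) (by apply div_pos <;> linarith)
  have hball : ∀ᶠ t : ℝ in 𝓝[>] 0, x + t • e ∈ Metric.ball x r := by
    have : Tendsto (fun t : ℝ => x + t • e) (𝓝[>] 0) (𝓝 (x + (0 : ℝ) • e)) :=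
      (Continuous.tendsto (by fun_prop) _).mono_left nhdsWithin_le_nhds
    simp only [zero_smul, add_zero] at this
    exact this (Metric.ball_mem_nhds x hr)
  filter_upwards [hball, self_mem_nhdsWithin] with t ht ht0
  refine (hK _ ht).1 ?_
  have ht0' : (0 : ℝ) < t := ht0
  rw [add_sub_cancel_left, inner_smul_left, norm_smul, Real.norm_of_nonneg ht0'.le]
  have : -(-⟪e, ν⟫ / (2 * ‖e‖)) * (t * ‖e‖) = t * ⟪e, ν⟫ / 2 := by field_simp
  rw [this]
  simp only [conj_trivial]
  nlinarith

theorem IsOutwardNormal.eventually_notMem {K : Set (E d)} {x ν e : E d}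
    (h : IsOutwardNormal K x ν) (he : 0 < ⟪e, ν⟫) : ∀ᶠ t : ℝ in 𝓝[>] 0, x + t • e ∉ K := by
  -- The complement has the opposite normal, which reduces the claim to rays entering a set.
  have h' : IsOutwardNormal Kᶜ x (-ν) := by
    refine ⟨by rw [norm_neg, h.1], fun ε hε => ?_⟩
    obtain ⟨r, hr, hK⟩ := h.2 ε hε
    refine ⟨r, hr, fun y hy => ⟨fun h1 => (hK y hy).2 ?_, fun h1 => not_not.2 ((hK y hy).1 ?_)⟩⟩
    · rw [inner_neg_right] at h1; linarith
    · rw [inner_neg_right] at h1; linarith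
  exact h'.eventually_mem (by rw [inner_neg_right]; linarith)

theorem inner_lt_one_of_ne {ν ν' : E d} (h : ‖ν‖ = 1) (h' : ‖ν'‖ = 1) (hne : ν ≠ ν') :
    ⟪ν, ν'⟫ < 1 :=
  (inner_lt_one_iff_real_of_norm_eq_one h h').2 hne

theorem IsOutwardNormal.unique {K : Set (E d)} {x ν ν' : E d} (h : IsOutwardNormal K x ν)
    (h' : IsOutwardNormal K x ν') : ν = ν' := by
  by_contra hne
  have hlt := inner_lt_one_of_ne h.1 h'.1 hne
  -- The direction ν' - ν enters K according to ν and leaves it according to ν'.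
  have h1 : ⟪ν' - ν, ν⟫ < 0 := by
    rw [inner_sub_left, real_inner_self_eq_norm_sq, h.1, real_inner_comm]; linarith
  have h2 : 0 < ⟪ν' - ν, ν'⟫ := by
    rw [inner_sub_left, real_inner_self_eq_norm_sq, h'.1]; linarith
  obtain ⟨t, ht, ht'⟩ := ((h.eventually_mem h1).and (h'.eventually_notMem h2)).exists
  exact ht' ht

theorem IsOutwardNormal.eq_neg_of_disjoint {K K' : Set (E d)} (hKK' : Disjoint K K')
    {x ν ν' : E d} (h : IsOutwardNormal K x ν) (h' : IsOutwardNormal K' x ν') : ν' = -ν := by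
  by_contra hne
  have hlt := inner_lt_one_of_ne h'.1 (by rw [norm_neg, h.1]) hne
  rw [inner_neg_right] at hlt
  -- The direction -(ν + ν') would enter both disjoint sets.
  have h1 : ⟪-(ν + ν'), ν⟫ < 0 := by
    rw [inner_neg_left, inner_add_left, real_inner_self_eq_norm_sq, h.1]; linarith
  have h2 : ⟪-(ν + ν'), ν'⟫ < 0 := by
    rw [inner_neg_left, inner_add_left, real_inner_self_eq_norm_sq, h'.1, real_inner_comm]; linarith
  obtain ⟨t, ht, ht'⟩ := ((h.eventually_mem h1).and (h'.eventually_mem h2)).exists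
  exact disjoint_left.1 hKK' ht ht'

theorem normal_eq {K : Set (E d)} {x ν : E d} (h : IsOutwardNormal K x ν) : normal K x = ν := by
  have hex : ∃ ν, IsOutwardNormal K x ν := ⟨ν, h⟩
  rw [normal, dif_pos hex]
  exact hex.choose_spec.unique h

theorem norm_normal_le (K : Set (E d)) (x : E d) : ‖normal K x‖ ≤ 1 := by
  rw [normal]
  split_ifs with h
  · exact h.choose_spec.1.le
  · simp

/-- With ε and r restricted to the values 1/(n+1), the condition becomes a countable intersection of
countable unions of closed sets, whatever K is. -/
theorem measurableSet_isOutwardNormal (K : Set (E d)) :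
    MeasurableSet {q : E d × E d | IsOutwardNormal K q.1 q.2} := by
  let c : ℕ → ℝ := fun n => 1 / (n + 1 : ℝ)
  have hc : ∀ n, 0 < c n := fun n => Nat.one_div_pos_of_nat
  let C : ℕ → ℕ → Set (E d × E d) := fun n m => {q | ∀ y ∈ Metric.ball q.1 (c m),
    (⟪y - q.1, q.2⟫ < -c n * ‖y - q.1‖ → y ∈ K) ∧ (c n * ‖y - q.1‖ < ⟪y - q.1, q.2⟫ → y ∉ K)}
  have hC : ∀ n m, IsClosed (C n m) := by
    intro n m
    -- For a fixed violating point y all conditions on the pair (x, ν) are strict inequalities or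
    -- constant, hence open.
    have : (C n m)ᶜ = ⋃ y : E d, ({q : E d × E d | dist y q.1 < c m} ∩
        (({q : E d × E d | ⟪y - q.1, q.2⟫ < -c n * ‖y - q.1‖} ∩ {_q | y ∉ K}) ∪
        ({q : E d × E d | c n * ‖y - q.1‖ < ⟪y - q.1, q.2⟫} ∩ {_q | y ∈ K}))) := by
      ext q
      simp only [C, mem_compl_iff, mem_ofPred_eq, Metric.mem_ball, mem_iUnion, mem_inter_iff,
        mem_union]
      push Not
      refine exists_congr fun y => and_congr_right fun _ => ?_
      tauto
    rw [← isOpen_compl_iff, this]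
    refine isOpen_iUnion fun y => (isOpen_lt (by fun_prop) continuous_const).inter
      (((isOpen_lt ?_ ?_).inter isOpen_const).union ((isOpen_lt ?_ ?_).inter isOpen_const))
    all_goals fun_prop
  have : {q : E d × E d | IsOutwardNormal K q.1 q.2} = {q | ‖q.2‖ = 1} ∩ ⋂ n, ⋃ m, C n m := by
    ext q
    simp only [IsOutwardNormal, mem_ofPred_eq, mem_inter_iff, mem_iInter, mem_iUnion, C]
    refine and_congr_right fun _ => ⟨fun h n => ?_, fun h ε hε => ?_⟩
    · obtain ⟨r, hr, hK⟩ := h (c n) (hc n)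
      obtain ⟨m, hm⟩ := exists_nat_one_div_lt hr
      exact ⟨m, fun y hy => hK y (Metric.ball_subset_ball hm.le hy)⟩
    · obtain ⟨n, hn⟩ := exists_nat_one_div_lt hε
      obtain ⟨m, hm⟩ := h n
      refine ⟨c m, hc m, fun y hy => ⟨fun h1 => (hm y hy).1 ?_, fun h1 => (hm y hy).2 ?_⟩⟩
      · have : c n * ‖y - q.1‖ ≤ ε * ‖y - q.1‖ := by gcongr
        linarith
      · have : c n * ‖y - q.1‖ ≤ ε * ‖y - q.1‖ := by gcongr
        linarith
  rw [this]
  exact (measurableSet_eq_fun (by fun_prop) measurable_const).inter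
    (MeasurableSet.iInter fun n => MeasurableSet.iUnion fun m => (hC n m).measurableSet)

/-- By uniqueness of the normal the projection of its graph is injective, and injective Borel images
of Borel sets are Borel (Lusin–Souslin). -/
theorem measurable_normal (K : Set (E d)) : Measurable (normal K) := by
  have hG := measurableSet_isOutwardNormal K
  have hproj : ∀ B : Set (E d), MeasurableSet B →
      MeasurableSet (Prod.fst '' ({q : E d × E d | IsOutwardNormal K q.1 q.2} ∩ Prod.snd ⁻¹' B)) := by
    intro B hB
    refine (hG.inter (measurable_snd hB)).image_of_measurable_injOn measurable_fst ?_
    rintro ⟨x, ν⟩ ⟨h, -⟩ ⟨x', ν'⟩ ⟨h', -⟩ (rfl : x = x')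
    exact Prod.ext rfl (h.unique h')
  intro B hB
  -- The second set accounts for the default value 0 where no normal exists.
  have : normal K ⁻¹' B = Prod.fst '' ({q : E d × E d | IsOutwardNormal K q.1 q.2} ∩ Prod.snd ⁻¹' B) ∪
      ((Prod.fst '' ({q : E d × E d | IsOutwardNormal K q.1 q.2} ∩ Prod.snd ⁻¹' univ))ᶜ ∩
        {_x | (0 : E d) ∈ B}) := by
    ext x
    by_cases hx : ∃ ν, IsOutwardNormal K x ν
    · obtain ⟨ν, hν⟩ := hx
      have h1 : ∀ B : Set (E d), (∃ ν, IsOutwardNormal K x ν ∧ ν ∈ B) ↔ ν ∈ B := fun B =>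
        ⟨fun ⟨ν', h, hB⟩ => hν.unique h ▸ hB, fun h => ⟨ν, hν, h⟩⟩
      simp [normal_eq hν, h1]
      intro h; exact absurd hν (h ν)
    · have h0 : normal K x = 0 := by rw [normal, dif_neg hx]
      push Not at hx
      simp [h0, hx]
  rw [this]
  exact (hproj B hB).union ((hproj univ MeasurableSet.univ).compl.inter (MeasurableSet.const _))

/-- If an open set is locally described by a defining function that is differentiable up to the
boundary, then the normalised gradient of this function is the outward normal. -/
theorem isOutwardNormal_of_hasFDerivWithinAt {K : Set (E d)} (hK : IsOpen K) {x m : E d}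
    (hm : m ≠ 0) {ρ : E d → ℝ} (hρ : HasFDerivWithinAt ρ (innerSL ℝ m) (closure K) x)
    (h0 : ρ x = 0) (hneg : ∀ y ∈ K, ρ y < 0) (hfr : ∀ᶠ y in 𝓝[frontier K] x, ρ y = 0)
    {γ : ℝ → E d} (hγ : HasDerivWithinAt γ (-m) (Ioi 0) 0) (hγ0 : γ 0 = x)
    (hγK : ∀ᶠ t in 𝓝[>] 0, γ t ∈ K) : IsOutwardNormal K x (‖m‖⁻¹ • m) := by
  have hm' : 0 < ‖m‖ := norm_pos_iff.2 hm
  refine ⟨by rw [norm_smul, norm_inv, norm_norm, inv_mul_cancel₀ hm'.ne'], fun ε hε => ?_⟩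
  have hlo := (hasFDerivWithinAt_iff_isLittleO.1 hρ).def (mul_pos hε hm')
  rw [eventually_nhdsWithin_iff] at hlo hfr
  obtain ⟨r, hr, hball⟩ := Metric.eventually_nhds_iff_ball.1 (hlo.and hfr)
  have hest : ∀ y ∈ Metric.ball x r, y ∈ closure K →
      |ρ y - ⟪m, y - x⟫| ≤ ε * ‖m‖ * ‖y - x‖ := by
    intro y hy hyK
    have := (hball y hy).1 hyK
    rwa [h0, sub_zero, Real.norm_eq_abs] at this
  have hinner : ∀ y, ⟪y - x, ‖m‖⁻¹ • m⟫ = ‖m‖⁻¹ * ⟪m, y - x⟫ := fun y => by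
    rw [inner_smul_right, real_inner_comm]
  have hlt1 : ∀ y, ⟪y - x, ‖m‖⁻¹ • m⟫ < -ε * ‖y - x‖ ↔ ⟪m, y - x⟫ < -(ε * ‖m‖ * ‖y - x‖) := by
    intro y
    rw [hinner, inv_mul_lt_iff₀ hm']
    ring_nf
  have hlt2 : ∀ y, ε * ‖y - x‖ < ⟪y - x, ‖m‖⁻¹ • m⟫ ↔ ε * ‖m‖ * ‖y - x‖ < ⟪m, y - x⟫ := by
    intro y
    rw [hinner, lt_inv_mul_iff₀ hm']
    ring_nf
  refine ⟨r, hr, fun y hy => ⟨?_, fun h1 hyK => ?_⟩⟩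
  · intro hyC
    -- For ε ≥ 1 the cone is empty by the Cauchy–Schwarz inequality.
    rcases le_or_gt 1 ε with hε1 | hε1
    · rw [hlt1] at hyC
      have := abs_le.1 (abs_real_inner_le_norm m (y - x))
      have : ‖m‖ * ‖y - x‖ ≤ ε * (‖m‖ * ‖y - x‖) := le_mul_of_one_le_left (by positivity) hε1
      nlinarith
    -- The open cone in the ball is convex, hence connected. It meets K along γ and avoids the
    -- boundary of K, where ρ = 0 contradicts the differentiability estimate; so it lies in K.
    · set C : Set (E d) := {y | y ∈ Metric.ball x r ∧ ⟪m, y - x⟫ + ε * ‖m‖ * ‖y - x‖ < 0}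
      have hconv : Convex ℝ C := by
        have hf : ConvexOn ℝ univ fun y : E d => ⟪m, y - x⟫ + ε * ‖m‖ * ‖y - x‖ := by
          have hdist := convexOn_univ_dist x
          simp only [dist_eq_norm] at hdist
          refine ConvexOn.add ?_ (hdist.smul (c := ε * ‖m‖) (by positivity))
          refine ⟨convex_univ, fun a _ b _ s t _ _ hst => le_of_eq ?_⟩
          simp only [inner_sub_right, inner_add_right, inner_smul_right, smul_eq_mul]
          linear_combination ⟪m, x⟫ * hst
        have := hf.convex_lt 0
        simp only [mem_univ, true_and] at this
        exact (convex_ball x r).inter this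
      have hyC' : y ∈ C := ⟨hy, by have := (hlt1 y).1 hyC; linarith⟩
      have hCK : (C ∩ K).Nonempty := by
        have hslope := (hasDerivWithinAt_iff_tendsto_slope' (by simp)).1 hγ
        have h1 : Tendsto (fun t => ⟪m, slope γ 0 t⟫ + ε * ‖m‖ * ‖slope γ 0 t‖) (𝓝[>] 0)
            (𝓝 (⟪m, -m⟫ + ε * ‖m‖ * ‖-m‖)) :=
          (tendsto_const_nhds.inner hslope).add (hslope.norm.const_mul _)
        have h2 : ⟪m, -m⟫ + ε * ‖m‖ * ‖-m‖ < 0 := by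
          rw [inner_neg_right, real_inner_self_eq_norm_sq, norm_neg]
          nlinarith [mul_pos hm' hm']
        have h3 : Tendsto γ (𝓝[>] 0) (𝓝 x) := hγ0 ▸ hγ.continuousWithinAt
        obtain ⟨t, ht1, ht2, ht3, ht4⟩ := ((h1.eventually (gt_mem_nhds h2)).and
          ((h3.eventually_mem (Metric.ball_mem_nhds x hr)).and (hγK.and self_mem_nhdsWithin))).exists
        have ht4' : (0 : ℝ) < t := ht4
        refine ⟨γ t, ⟨ht2, ?_⟩, ht3⟩
        rw [slope_def_module, sub_zero, hγ0, inner_smul_right, norm_smul,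
          Real.norm_of_nonneg (by positivity)] at ht1
        have : t⁻¹ * (⟪m, γ t - x⟫ + ε * ‖m‖ * ‖γ t - x‖) < 0 := by linarith
        exact (pos_iff_neg_of_mul_neg this).1 (by positivity)
      refine hconv.isPreconnected.subset_of_closure_inter_subset hK hCK ?_ hyC'
      rintro z ⟨hzK, hzr, hz⟩
      by_contra hzn
      have hzf : z ∈ frontier K := by rw [hK.frontier_eq]; exact ⟨hzK, hzn⟩
      have h1 := (hball z hzr).2 hzf
      have h2 := hest z hzr hzK
      rw [h1, zero_sub, abs_neg, abs_le] at h2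
      linarith
  · rw [hlt2] at h1
    have h2 := abs_le.1 (hest y hy (subset_closure hyK))
    linarith [hneg y hyK]

namespace HpMesh

variable {Ω : Set (E d)} {M : HpMesh Ω} {β₁ β₂ β₃ : ℝ} (i : Fin M.n)

/-- Near the image of a point on exactly one facet, the element is described by the facet's affine
function composed with the inverse element map, which is differentiable up to the boundary. Its
gradient, normalised, is the normal. -/
theorem exists_isOutwardNormal_of_regular (hM : M.Admissible β₁ β₂ β₃) (hd : 2 ≤ d)
    {ι : Type} [Fintype ι] {a : ι → E d} {b : ι → ℝ}
    (href : M.ref i = {x | ∀ j, ⟪a j, x⟫ < b j}) {x : E d} (hx : x ∈ closure (M.ref i)) {j : ι}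
    (haj : a j ≠ 0) (hj : ⟪a j, x⟫ = b j) (hk : ∀ k ≠ j, ⟪a k, x⟫ < b k) :
    ∃ ν, IsOutwardNormal (M.elem i) (M.T i x) ν := by
  obtain ⟨DT, hDT, hDTeq⟩ := hM.exists_extension_fderiv_T i hd
  obtain ⟨DS, hDS, hDSeq⟩ := hM.exists_extension_fderiv_S_comp_T i hd
  have hcl : closure (M.ref i) ⊆ {x | ∀ j, ⟪a j, x⟫ ≤ b j} := by
    rw [href]; exact closure_polyhedron_subset
  have hST : ∀ z ∈ M.ref i, (DS z).comp (DT z) = ContinuousLinearMap.id ℝ (E d) := by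
    intro z hz
    rw [← hDTeq hz, ← hDSeq hz]
    have h1 := (M.hasFDerivAt_S i (⟨z, hz, rfl⟩ : M.T i z ∈ M.elem i)).comp z
      (M.hasFDerivAt_T i hd hz)
    refine h1.unique ((hasFDerivAt_id z).congr_of_eventuallyEq ?_)
    filter_upwards [(M.isOpen_ref i hd).mem_nhds hz] with w hw
    exact M.S_T i hw
  -- The derivatives of the map and its inverse are inverse to each other inside, and by continuity
  -- also at the boundary point.
  have hSTx : (DS x).comp (DT x) = ContinuousLinearMap.id ℝ (E d) :=
    (show EqOn (fun z => (DS z).comp (DT z)) (fun _ => ContinuousLinearMap.id ℝ (E d)) (M.ref i)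
      from hST).closure (by fun_prop) continuous_const hx
  have hTSx : (DT x).comp (DS x) = ContinuousLinearMap.id ℝ (E d) := by
    have h1 : (DS x).toLinearMap.comp (DT x).toLinearMap = LinearMap.id :=
      congrArg ContinuousLinearMap.toLinearMap hSTx
    have h2 := (LinearMap.comp_eq_id_comm ℝ (E d)).1 h1
    ext1 v
    exact congrArg (fun f : E d →ₗ[ℝ] E d => f v) h2
  let e : E d ≃L[ℝ] E d := ContinuousLinearEquiv.equivOfInverse (DT x) (DS x)
    (fun v => congrArg (fun f : E d →L[ℝ] E d => f v) hSTx)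
    (fun v => congrArg (fun f : E d →L[ℝ] E d => f v) hTSx)
  have hy : M.T i x ∈ closure (M.elem i) := by rw [closure_elem]; exact ⟨x, hx, rfl⟩
  have hT : HasFDerivWithinAt (M.T i) (DT x) (closure (M.ref i)) x := by
    refine hasFDerivWithinAt_closure_of_tendsto_fderiv
      (fun z hz => (M.hasFDerivAt_T i hd hz).differentiableAt.differentiableWithinAt)
      (M.convex_ref i hd) (M.isOpen_ref i hd)
      (fun z hz => (M.continuousOn_T i z hz).mono subset_closure) ?_
    refine (hDT.continuousWithinAt (s := M.ref i)).tendsto.congr' ?_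
    filter_upwards [self_mem_nhdsWithin] with z hz using (hDTeq hz).symm
  have hinv : HasFDerivWithinAt (M.inv i) (DS x) (closure (M.elem i)) (M.T i x) := by
    refine HasFDerivWithinAt.of_local_left_inverse (f := M.T i) (f' := e)
      (t := closure (M.ref i)) ?_ ?_ hy ?_
    · exact tendsto_nhdsWithin_iff.2 ⟨M.continuousOn_inv i _ hy,
        by filter_upwards [self_mem_nhdsWithin] with z hz using M.inv_mem i hz⟩
    · rw [M.inv_T i hx]; exact hT
    · filter_upwards [self_mem_nhdsWithin] with z hz using M.T_inv i hz
  -- The gradient of the defining function y ↦ ⟪a_j, T⁻¹y⟫ - b_j.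
  set m : E d := (DS x).adjoint (a j)
  have hm : m ≠ 0 := by
    intro h
    have h1 : ⟪m, DT x (a j)⟫ = ⟪a j, a j⟫ := by
      rw [ContinuousLinearMap.adjoint_inner_left]
      exact congrArg (fun f : E d →L[ℝ] E d => ⟪a j, f (a j)⟫) hSTx
    rw [h, inner_zero_left] at h1
    exact haj (inner_self_eq_zero.1 h1.symm)
  have hnear : ∀ᶠ z in 𝓝 x, ∀ k ≠ j, ⟪a k, z⟫ < b k := by
    rw [eventually_all]
    intro k
    by_cases hkj : k = j
    · simp [hkj]
    · have : Tendsto (fun z => ⟪a k, z⟫) (𝓝 x) (𝓝 ⟪a k, x⟫) := Continuous.tendsto (by fun_prop) _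
      filter_upwards [this.eventually (gt_mem_nhds (hk k hkj))] with z hz _ using hz
  -- Chosen so that the derivative of `T` maps it to -m. It points into the reference domain, hence
  -- its straight path is carried to a curve entering the element with velocity -m.
  set u : E d := -(DS x m)
  have hu : ⟪a j, u⟫ < 0 := by
    rw [inner_neg_right, ← ContinuousLinearMap.adjoint_inner_left]
    exact neg_neg_of_pos (real_inner_self_pos.2 hm)
  have hpath : ∀ᶠ t : ℝ in 𝓝[>] 0, x + t • u ∈ M.ref i := by
    have h1 : Tendsto (fun t : ℝ => x + t • u) (𝓝[>] 0) (𝓝 (x + (0 : ℝ) • u)) :=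
      (Continuous.tendsto (by fun_prop) _).mono_left nhdsWithin_le_nhds
    rw [zero_smul, add_zero] at h1
    filter_upwards [h1.eventually hnear, self_mem_nhdsWithin] with t ht ht0
    have ht0' : (0 : ℝ) < t := ht0
    rw [href]
    intro k
    by_cases hkj : k = j
    · subst hkj
      rw [inner_add_right, hj, inner_smul_right]
      nlinarith
    · exact ht k hkj
  refine ⟨_, isOutwardNormal_of_hasFDerivWithinAt (M.isOpen_elem' i) hm
    (ρ := fun y => ⟪a j, M.inv i y⟫ - b j) (γ := fun t => M.T i (x + t • u)) ?_ ?_ ?_ ?_ ?_ ?_ ?_⟩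
  · have h1 := ((innerSL ℝ (a j)).hasFDerivAt.comp_hasFDerivWithinAt _ hinv).sub_const (b j)
    have h2 : (innerSL ℝ (a j)).comp (DS x) = innerSL ℝ m := by
      ext1 v
      simp [m, ContinuousLinearMap.adjoint_inner_left]
    rwa [h2] at h1
  · simp only [M.inv_T i hx, hj, sub_self]
  · intro y hy
    have := M.inv_mem_ref i hy
    rw [href] at this
    exact sub_neg.2 (this j)
  · have h1 : Tendsto (M.inv i) (𝓝[frontier (M.elem i)] (M.T i x)) (𝓝 x) := by
      have := (M.continuousOn_inv i _ hy).mono_left (nhdsWithin_mono _ frontier_subset_closure)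
      rwa [M.inv_T i hx] at this
    filter_upwards [h1.eventually hnear, self_mem_nhdsWithin] with y hy1 hy2
    have hycl := frontier_subset_closure hy2
    refine sub_eq_zero.2 (le_antisymm (hcl (M.inv_mem i hycl) j) (not_lt.1 fun hlt => ?_))
    rw [(M.isOpen_elem' i).frontier_eq] at hy2
    refine hy2.2 ⟨M.inv i y, ?_, M.T_inv i hycl⟩
    rw [href]
    intro k
    by_cases hkj : k = j
    · rwa [hkj]
    · exact hy1 k hkj
  · have h1 : HasDerivWithinAt (fun t : ℝ => x + t • u) u {t | x + t • u ∈ M.ref i} 0 := by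
      simpa using! ((hasDerivAt_id (0 : ℝ)).smul_const u).const_add x |>.hasDerivWithinAt
    have hT' : HasFDerivWithinAt (M.T i) (DT x) (closure (M.ref i)) (x + (0 : ℝ) • u) := by
      rwa [zero_smul, add_zero]
    have h2 := hT'.comp_hasDerivWithinAt (0 : ℝ) h1 (fun t ht => subset_closure ht)
    have h3 : DT x u = -m := by
      rw [map_neg]
      exact congrArg Neg.neg (congrArg (fun f : E d →L[ℝ] E d => f m) hTSx)
    rw [h3] at h2
    exact h2.mono_of_mem_nhdsWithin hpath
  · simp
  · filter_upwards [hpath] with t ht using ⟨_, ht, rfl⟩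

/-- The outward normal of an element exists almost everywhere on its boundary. -/
theorem surf_not_exists_isOutwardNormal (hM : M.Admissible β₁ β₂ β₃) (hd : 2 ≤ d) :
    surf d {y | y ∈ frontier (M.elem i) ∧ ¬ ∃ ν, IsOutwardNormal (M.elem i) y ν} = 0 := by
  obtain ⟨ι, _, a, b, href, ha, hnull⟩ := (M.shape i).exists_halfspaces hd
  obtain ⟨K, hK⟩ := hM.exists_lipschitzOnWith_T i hd
  -- The points lying on at least two facet hyperplanes are null, and so is their Lipschitz image.
  have hN : surf d (closure (M.ref i) ∩ ⋃ (j : ι) (k : ι) (_ : j ≠ k),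
      {x | ⟪a j, x⟫ = b j ∧ ⟪a k, x⟫ = b k}) = 0 := by
    refine measure_mono_null inter_subset_right ?_
    exact measure_iUnion_null fun j => measure_iUnion_null fun k => measure_iUnion_null (hnull j k)
  refine measure_mono_null ?_ (surf_image_eq_zero hK inter_subset_left hN)
  rintro y ⟨hy, hyn⟩
  obtain ⟨x, hx, rfl⟩ := M.frontier_elem_subset i hd hy
  have hxcl := frontier_subset_closure hx
  refine ⟨x, ⟨hxcl, ?_⟩, rfl⟩
  by_contra hcon
  simp only [mem_iUnion, not_exists] at hcon
  have hx' := hx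
  rw [show M.ref i = _ from href] at hx'
  obtain ⟨j, hj⟩ := exists_active_of_mem_frontier hx'
  refine hyn (exists_isOutwardNormal_of_regular i hM hd href hxcl (ha j) hj fun k hkj => ?_)
  refine lt_of_le_of_ne (closure_polyhedron_subset (frontier_subset_closure hx') k) fun h => ?_
  exact hcon j k hkj.symm ⟨hj, h⟩

end HpMesh

end

/-! ### Connectedness of the adjacency graph -/

section

variable {d : ℕ}

/-- A closed set of vanishing surface measure does not separate a convex set. -/
theorem not_separated_of_surf_eq_zero {B U U' : Set (E d)} (hB : Convex ℝ B) (hBo : IsOpen B)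
    (hU : IsClosed U) (hU' : IsClosed U') (hcover : B ⊆ U ∪ U') (hnull : surf d (U ∩ U') = 0)
    {a b : E d} (ha : a ∈ B) (hb : b ∈ B) (haU : a ∉ U') (hbU : b ∉ U) : False := by
  have hne : b - a ≠ 0 := by
    intro h
    rw [sub_eq_zero.1 h] at hbU
    exact (hcover ha).elim hbU haU
  set H := (ℝ ∙ (b - a))ᗮ
  set π := H.orthogonalProjectionOnto
  have hπ : LipschitzWith 1 π := by
    refine ContinuousLinearMap.lipschitzWith_of_opNorm_le ?_
    exact_mod_cast H.orthogonalProjectionOnto_norm_le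
  have hS : μH[(Module.finrank ℝ H : ℝ)] (π '' (U ∩ U')) = 0 := by
    rw [finrank_orthogonal_singleton hne]
    have h := hπ.hausdorffMeasure_image_le (d := ((d - 1 : ℕ) : ℝ)) (by positivity) (U ∩ U')
    rw [surf_eq_zero_iff.1 hnull, mul_zero] at h
    exact le_antisymm h bot_le
  have hnear : ∀ᶠ δ : E d in 𝓝 0, (a + δ ∈ B ∧ a + δ ∉ U') ∧ b + δ ∈ B ∧ b + δ ∉ U := by
    have h1 : Tendsto (fun δ : E d => a + δ) (𝓝 0) (𝓝 a) := by
      simpa using (tendsto_const_nhds (x := a)).add (tendsto_id (x := 𝓝 (0 : E d)))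
    have h2 : Tendsto (fun δ : E d => b + δ) (𝓝 0) (𝓝 b) := by
      simpa using (tendsto_const_nhds (x := b)).add (tendsto_id (x := 𝓝 (0 : E d)))
    exact ((h1.eventually_mem (hBo.mem_nhds ha)).and
      (h1.eventually_mem (hU'.isOpen_compl.mem_nhds haU))).and
      ((h2.eventually_mem (hBo.mem_nhds hb)).and
      (h2.eventually_mem (hU.isOpen_compl.mem_nhds hbU)))
  obtain ⟨r, hr, hball⟩ := Metric.eventually_nhds_iff_ball.1 hnear
  -- The projection along b - a maps the separating set to a null set of the hyperplane, so an
  -- arbitrarily small shift δ within H moves the segment from a to b to one whose single projected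
  -- point h avoids that image.
  obtain ⟨h, hh, hhS⟩ : ∃ h ∈ Metric.ball (π a) r, h ∉ π '' (U ∩ U') := by
    by_contra! hcon
    have hpos : 0 < μH[(Module.finrank ℝ H : ℝ)] (Metric.ball (π a) r) :=
      Metric.measure_ball_pos _ _ hr
    exact hpos.ne' (measure_mono_null hcon hS)
  set δ : E d := ((h - π a : H) : E d)
  obtain ⟨⟨ha1, ha2⟩, hb1, hb2⟩ := hball δ (by
    rw [mem_ball_zero_iff]
    rw [mem_ball_iff_norm] at hh
    exact hh)
  have hseg : segment ℝ (a + δ) (b + δ) ⊆ B := hB.segment_subset ha1 hb1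
  -- The shifted segment is connected and starts in one closed set and ends in the other, so it must
  -- meet both at once; but then h lies in the projected set.
  obtain ⟨z, hz, hzU⟩ := isPreconnected_closed_iff.1 (convex_segment (a + δ) (b + δ)).isPreconnected
    U U' hU hU' (hseg.trans hcover)
    ⟨_, left_mem_segment _ _ _, (hcover ha1).resolve_right ha2⟩
    ⟨_, right_mem_segment _ _ _, (hcover hb1).resolve_left hb2⟩
  refine hhS ⟨z, hzU, ?_⟩
  rw [segment_eq_image'] at hz
  obtain ⟨t, -, rfl⟩ := hz
  have h1 : π δ = h - π a := H.orthogonalProjectionOnto_mem_subspace_eq_self _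
  have h2 : π (b - a) = 0 :=
    Submodule.orthogonalProjectionOnto_apply_of_mem_orthogonal
      (Submodule.le_orthogonal_orthogonal _ (Submodule.mem_span_singleton_self _))
  have h3 : b + δ - (a + δ) = b - a := by abel
  simp [h1, h3, h2]

/-- The adjacency graph of the elements of a subdivision of a domain is connected. -/
theorem exists_adjacent {n : ℕ} {Ω : Set (E d)} (hΩ : IsOpen Ω) (hconn : IsPreconnected Ω)
    {K : Fin n → Set (E d)} (hK : ∀ i, IsOpen (K i)) (hne : ∀ i, (K i).Nonempty)
    (hKΩ : ∀ i, K i ⊆ Ω) (hdisj : ∀ i j, i ≠ j → Disjoint (K i) (K j))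
    (hcl : closure Ω = ⋃ i, closure (K i)) {I : Set (Fin n)} {i₀ j₀ : Fin n} (hi₀ : i₀ ∈ I)
    (hj₀ : j₀ ∉ I) :
    ∃ i ∈ I, ∃ j ∉ I, 0 < surf d (frontier (K i) ∩ frontier (K j)) := by
  by_contra! hcon
  set U : Set (E d) := ⋃ i ∈ I, closure (K i)
  set U' : Set (E d) := ⋃ j ∈ Iᶜ, closure (K j)
  have hU : IsClosed U := (toFinite I).isClosed_biUnion fun _ _ => isClosed_closure
  have hU' : IsClosed U' := (toFinite Iᶜ).isClosed_biUnion fun _ _ => isClosed_closure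
  have hcover : Ω ⊆ U ∪ U' := by
    intro x hx
    have hx' := subset_closure hx
    rw [hcl] at hx'
    obtain ⟨i, hi⟩ := mem_iUnion.1 hx'
    by_cases hiI : i ∈ I
    · exact Or.inl (mem_biUnion hiI hi)
    · exact Or.inr (mem_biUnion (show i ∈ Iᶜ from hiI) hi)
  have hdc : ∀ i j, i ≠ j → Disjoint (K i) (closure (K j)) := fun i j hij =>
    (hdisj i j hij).closure_right (hK i)
  have hKU' : ∀ i ∈ I, ∀ x ∈ K i, x ∉ U' := by
    intro i hi x hx hxU
    obtain ⟨j, hj, hxj⟩ := mem_iUnion₂.1 hxU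
    exact disjoint_left.1 (hdc i j fun h => hj (h ▸ hi)) hx hxj
  have hKU : ∀ j ∉ I, ∀ x ∈ K j, x ∉ U := by
    intro j hj x hx hxU
    obtain ⟨i, hi, hxi⟩ := mem_iUnion₂.1 hxU
    exact disjoint_left.1 (hdc j i fun h => hj (h ▸ hi)) hx hxi
  have hnull : surf d (U ∩ U') = 0 := by
    -- A common point of closures of disjoint open elements lies on both boundaries.
    have hsub : U ∩ U' ⊆ ⋃ i ∈ I, ⋃ j ∈ Iᶜ, frontier (K i) ∩ frontier (K j) := by
      rintro x ⟨hx, hx'⟩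
      obtain ⟨i, hi, hxi⟩ := mem_iUnion₂.1 hx
      obtain ⟨j, hj, hxj⟩ := mem_iUnion₂.1 hx'
      refine mem_biUnion hi (mem_biUnion hj ?_)
      have hij : i ≠ j := fun h => hj (h ▸ hi)
      rw [(hK i).frontier_eq, (hK j).frontier_eq]
      exact ⟨⟨hxi, fun h => disjoint_left.1 (hdc i j hij) h hxj⟩,
        ⟨hxj, fun h => disjoint_left.1 (hdc j i hij.symm) h hxi⟩⟩
    refine measure_mono_null hsub ?_
    rw [measure_biUnion_null_iff (toFinite I).countable]
    intro i hi
    rw [measure_biUnion_null_iff (toFinite Iᶜ).countable]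
    exact fun j hj => le_antisymm (hcon i hi j hj) bot_le
  obtain ⟨xi, hxi⟩ := hne i₀
  obtain ⟨xj, hxj⟩ := hne j₀
  -- Connectedness of Ω yields a point in both unions, and a ball around it contains points of
  -- elements from either class.
  obtain ⟨x, hxΩ, hxU, hxU'⟩ := isPreconnected_closed_iff.1 hconn U U' hU hU' hcover
    ⟨xi, hKΩ _ hxi, mem_biUnion hi₀ (subset_closure hxi)⟩
    ⟨xj, hKΩ _ hxj, mem_biUnion (show j₀ ∈ Iᶜ from hj₀) (subset_closure hxj)⟩
  obtain ⟨r, hr, hball⟩ := Metric.isOpen_iff.1 hΩ x hxΩ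
  obtain ⟨i, hi, hxi⟩ := mem_iUnion₂.1 hxU
  obtain ⟨j, hj, hxj⟩ := mem_iUnion₂.1 hxU'
  obtain ⟨a, ha, haK⟩ := mem_closure_iff.1 hxi _ Metric.isOpen_ball (Metric.mem_ball_self hr)
  obtain ⟨b, hb, hbK⟩ := mem_closure_iff.1 hxj _ Metric.isOpen_ball (Metric.mem_ball_self hr)
  exact not_separated_of_surf_eq_zero (convex_ball x r) Metric.isOpen_ball hU hU'
    (hball.trans hcover) hnull ha hb (hKU' i hi a haK) (hKU j hj b hbK)

end

/-! ### Abstract tools: strongly monotone forms, quadratic functionals, parametrised fields -/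

section

/-! ### Strongly monotone problems in finite dimensions -/

section Abstract

variable {X : Type*} [NormedAddCommGroup X] [InnerProductSpace ℝ X] [FiniteDimensional ℝ X]

/-- A strongly monotone Lipschitz map is bijective (Zarantonello). -/
theorem existsUnique_of_stronglyMonotone {F : X → X} {L c : ℝ} (hc : 0 < c)
    (hL : ∀ x y, ‖F x - F y‖ ≤ L * ‖x - y‖)
    (hmono : ∀ x y, c * ‖x - y‖ ^ 2 ≤ ⟪F x - F y, x - y⟫) (b : X) : ∃! u, F u = b := by
  have : CompleteSpace X := FiniteDimensional.complete ℝ X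
  obtain ⟨R, hR, hcR, hLR⟩ : ∃ R : ℝ, 0 < R ∧ c ≤ R ∧ L ≤ R :=
    ⟨max L c, hc.trans_le (le_max_right _ _), le_max_right _ _, le_max_left _ _⟩
  -- This step length minimises 1 - 2tc + t²R², with minimum 1 - c²/R². Taking R ≥ c keeps that
  -- value nonnegative.
  set t : ℝ := c / R ^ 2
  have ht : 0 < t := by positivity
  let Ψ : X → X := fun x => x - t • (F x - b)
  have hfix : ∀ u, Ψ u = u ↔ F u = b := by
    intro u
    simp only [Ψ, sub_eq_self, smul_eq_zero, ht.ne', false_or, sub_eq_zero]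
  have hk : 0 ≤ 1 - c ^ 2 / R ^ 2 := by
    rw [sub_nonneg, div_le_one (by positivity)]
    exact pow_le_pow_left₀ hc.le hcR 2
  have hk1 : Real.sqrt (1 - c ^ 2 / R ^ 2) < 1 := by
    rw [Real.sqrt_lt' one_pos, one_pow, sub_lt_self_iff]
    positivity
  have hΨ : ContractingWith (Real.toNNReal (Real.sqrt (1 - c ^ 2 / R ^ 2))) Ψ := by
    refine ⟨by rw [← NNReal.coe_lt_coe, Real.coe_toNNReal _ (Real.sqrt_nonneg _)]; exact hk1,
      LipschitzWith.of_dist_le_mul fun x y => ?_⟩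
    rw [Real.coe_toNNReal _ (Real.sqrt_nonneg _), dist_eq_norm, dist_eq_norm]
    have h1 : Ψ x - Ψ y = (x - y) - t • (F x - F y) := by
      simp only [Ψ, smul_sub]; abel
    have h2 : ‖Ψ x - Ψ y‖ ^ 2 ≤ (1 - c ^ 2 / R ^ 2) * ‖x - y‖ ^ 2 := by
      rw [h1, norm_sub_sq_real, inner_smul_right, norm_smul, Real.norm_of_nonneg ht.le,
        real_inner_comm]
      have h3 : ‖F x - F y‖ ^ 2 ≤ R ^ 2 * ‖x - y‖ ^ 2 := by
        rw [← mul_pow]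
        exact pow_le_pow_left₀ (norm_nonneg _) ((hL x y).trans (by gcongr)) 2
      have h4 : t ^ 2 * ‖F x - F y‖ ^ 2 ≤ t ^ 2 * (R ^ 2 * ‖x - y‖ ^ 2) := by gcongr
      have h5 : t * (c * ‖x - y‖ ^ 2) ≤ t * ⟪F x - F y, x - y⟫ := by gcongr; exact hmono x y
      have h6 : t ^ 2 * R ^ 2 = c ^ 2 / R ^ 2 := by simp only [t]; field_simp
      have h7 : t * c = c ^ 2 / R ^ 2 := by simp only [t]; ring
      rw [mul_pow]
      have h8 : t ^ 2 * (R ^ 2 * ‖x - y‖ ^ 2) = c ^ 2 / R ^ 2 * ‖x - y‖ ^ 2 := by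
        rw [← mul_assoc, h6]
      have h9 : t * (c * ‖x - y‖ ^ 2) = c ^ 2 / R ^ 2 * ‖x - y‖ ^ 2 := by
        rw [← mul_assoc, h7]
      linarith
    rw [← Real.sqrt_sq (norm_nonneg (Ψ x - Ψ y)), ← Real.sqrt_sq (norm_nonneg (x - y)),
      ← Real.sqrt_mul hk]
    exact Real.sqrt_le_sqrt h2
  refine ⟨hΨ.fixedPoint Ψ, (hfix _).1 hΨ.fixedPoint_isFixedPt, fun u hu => ?_⟩
  exact hΨ.fixedPoint_unique ((hfix u).2 hu)

/-- A form that is linear in its second and Lipschitz in its first argument. -/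
structure IsLipForm (n : X → X → ℝ) : Prop where
  add : ∀ w v v', n w (v + v') = n w v + n w v'
  smul : ∀ w (c : ℝ) v, n w (c • v) = c * n w v
  lip : ∃ L, ∀ w w' v, |n w v - n w' v| ≤ L * ‖w - w'‖ * ‖v‖

namespace IsLipForm

omit [FiniteDimensional ℝ X] in
theorem zero : IsLipForm (fun _ _ : X => (0 : ℝ)) :=
  ⟨by simp, by simp, 0, by simp⟩

omit [FiniteDimensional ℝ X] in
theorem add_form {n m : X → X → ℝ} (hn : IsLipForm n) (hm : IsLipForm m) :
    IsLipForm fun w v => n w v + m w v := by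
  obtain ⟨L, hL⟩ := hn.lip
  obtain ⟨L', hL'⟩ := hm.lip
  refine ⟨fun w v v' => by rw [hn.add, hm.add]; ring, fun w c v => by rw [hn.smul, hm.smul]; ring,
    L + L', fun w w' v => ?_⟩
  have := (abs_add_le (n w v - n w' v) (m w v - m w' v)).trans (add_le_add (hL w w' v) (hL' w w' v))
  calc _ = |n w v - n w' v + (m w v - m w' v)| := by ring_nf
    _ ≤ _ := this
    _ = _ := by ring

omit [FiniteDimensional ℝ X] in
theorem const_mul {n : X → X → ℝ} (hn : IsLipForm n) (a : ℝ) :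
    IsLipForm fun w v => a * n w v := by
  obtain ⟨L, hL⟩ := hn.lip
  refine ⟨fun w v v' => by rw [hn.add]; ring, fun w c v => by rw [hn.smul]; ring,
    |a| * L, fun w w' v => ?_⟩
  rw [← mul_sub, abs_mul]
  calc _ ≤ |a| * (L * ‖w - w'‖ * ‖v‖) := by gcongr; exact hL w w' v
    _ = _ := by ring

omit [FiniteDimensional ℝ X] in
theorem sum {κ : Type*} (s : Finset κ) {n : κ → X → X → ℝ} (hn : ∀ k ∈ s, IsLipForm (n k)) :
    IsLipForm fun w v => ∑ k ∈ s, n k w v := by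
  classical
  induction s using Finset.induction_on with
  | empty => simpa using zero
  | insert k s hk ih =>
    simp only [Finset.sum_insert hk]
    exact (hn k (Finset.mem_insert_self _ _)).add_form
      (ih fun j hj => hn j (Finset.mem_insert_of_mem hj))

/-- The Riesz representation turns the form and the functional into a map and a vector, to which
`existsUnique_of_stronglyMonotone` applies. -/
theorem existsUnique {n : X → X → ℝ} (hn : IsLipForm n) {c : ℝ} (hc : 0 < c)
    (hmono : ∀ w w', c * ‖w - w'‖ ^ 2 ≤ n w (w - w') - n w' (w - w')) (ℓ : X →ₗ[ℝ] ℝ) :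
    ∃! u, ∀ v, n u v = ℓ v := by
  have : CompleteSpace X := FiniteDimensional.complete ℝ X
  obtain ⟨L, hL⟩ := hn.lip
  let r : X → X := fun w => (InnerProductSpace.toDual ℝ X).symm
    (LinearMap.toContinuousLinearMap
      { toFun := n w, map_add' := hn.add w, map_smul' := hn.smul w } : X →L[ℝ] ℝ)
  have hr : ∀ w v, ⟪r w, v⟫ = n w v := fun w v => by
    simp [r, InnerProductSpace.toDual_symm_apply]
  let b : X := (InnerProductSpace.toDual ℝ X).symm (LinearMap.toContinuousLinearMap ℓ)
  have hb : ∀ v, ⟪b, v⟫ = ℓ v := fun v => by simp [b, InnerProductSpace.toDual_symm_apply]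
  have key : ∀ u, r u = b ↔ ∀ v, n u v = ℓ v := by
    exact fun u => ⟨fun h v => by rw [← hr, h, hb],
      fun h => ext_inner_right ℝ fun v => by rw [hr, hb, h]⟩
  have := existsUnique_of_stronglyMonotone (F := r) (L := L) hc (fun x y => ?_) (fun x y => ?_) b
  · simpa only [key] using this
  · rcases (norm_nonneg (r x - r y)).eq_or_lt with h0 | h0
    · rw [← h0]
      rcases (norm_nonneg (x - y)).eq_or_lt with h1 | h1
      · simp [← h1]
      · have := (abs_nonneg _).trans (hL x y (x - y))
        have h2 : 0 ≤ L * ‖x - y‖ := nonneg_of_mul_nonneg_left this h1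
        exact h2
    · have h1 : ⟪r x - r y, r x - r y⟫ ≤ L * ‖x - y‖ * ‖r x - r y‖ := by
        rw [inner_sub_left, hr, hr]
        exact (le_abs_self _).trans (hL x y _)
      rw [real_inner_self_eq_norm_sq, sq] at h1
      exact le_of_mul_le_mul_right h1 h0
  · rw [inner_sub_left, hr, hr]
    exact hmono x y

end IsLipForm

/-- The minimum over the compact unit sphere is positive, and homogeneity carries it to all vectors.
-/
theorem exists_pos_mul_norm_sq_le {Q : X → ℝ} (hQ : Continuous Q)
    (hsmul : ∀ (t : ℝ) w, Q (t • w) = t ^ 2 * Q w) (hpos : ∀ w, w ≠ 0 → 0 < Q w) :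
    ∃ c > 0, ∀ w, c * ‖w‖ ^ 2 ≤ Q w := by
  have hQ0 : Q 0 = 0 := by simpa using hsmul 0 0
  rcases (Metric.sphere (0 : X) 1).eq_empty_or_nonempty with he | hne
  · refine ⟨1, one_pos, fun w => ?_⟩
    rcases eq_or_ne w 0 with rfl | hw
    · simp [hQ0]
    · have : ‖w‖⁻¹ • w ∈ Metric.sphere (0 : X) 1 := by
        simp [norm_smul, inv_mul_cancel₀ (norm_ne_zero_iff.2 hw)]
      rw [he] at this
      exact this.elim
  · have : ProperSpace X := FiniteDimensional.proper_real X
    obtain ⟨u, hu, hmin⟩ := (isCompact_sphere (0 : X) 1).exists_isMinOn hne hQ.continuousOn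
    have hu1 : ‖u‖ = 1 := mem_sphere_zero_iff_norm.1 hu
    refine ⟨Q u, hpos u fun h => by simp [h] at hu1, fun w => ?_⟩
    rcases eq_or_ne w 0 with rfl | hw
    · simp [hQ0]
    · have hw' : ‖w‖ ≠ 0 := norm_ne_zero_iff.2 hw
      have h1 : Q u ≤ Q (‖w‖⁻¹ • w) :=
        hmin (by simp [norm_smul, inv_mul_cancel₀ hw'])
      rw [hsmul, inv_pow, le_inv_mul_iff₀ (by positivity)] at h1
      linarith

/-- If a quadratic functional vanishes only where another one does, then it controls the other. -/
theorem exists_le_mul_of_ker_le {Q₁ Q₂ : X → ℝ} (Z : Submodule ℝ X) (hQ : Continuous Q₂)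
    (hsmul : ∀ (t : ℝ) w, Q₂ (t • w) = t ^ 2 * Q₂ w) (hnn : ∀ w, 0 ≤ Q₂ w)
    (hker : ∀ w, Q₂ w = 0 → w ∈ Z) (h₁ : ∀ z ∈ Z, ∀ w, Q₁ (z + w) = Q₁ w)
    (h₂ : ∀ z ∈ Z, ∀ w, Q₂ (z + w) = Q₂ w) {K : ℝ} (hK : ∀ w, Q₁ w ≤ K * ‖w‖ ^ 2) :
    ∃ C, ∀ w, Q₁ w ≤ C * Q₂ w := by
  -- On the orthogonal complement of Z the functional Q₂ is definite, since its zeros lie in Z.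
  obtain ⟨c, hc, hcQ⟩ := exists_pos_mul_norm_sq_le (X := Zᗮ) (Q := fun w => Q₂ w)
    (hQ.comp continuous_subtype_val) (fun t w => hsmul t w) (fun w hw =>
      lt_of_le_of_ne (hnn _) fun h => hw (by
        have h1 := hker _ h.symm
        have h2 := Z.mem_orthogonal (w : X) |>.1 w.2 w h1
        exact Subtype.ext (inner_self_eq_zero.1 h2)))
  refine ⟨|K| / c, fun w => ?_⟩
  obtain ⟨z, hz, y, hy, rfl⟩ := Z.exists_add_mem_mem_orthogonal w
  rw [h₁ z hz, h₂ z hz, div_mul_eq_mul_div, le_div_iff₀ hc]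
  have h3 : c * ‖y‖ ^ 2 ≤ Q₂ y := hcQ ⟨y, hy⟩
  calc Q₁ y * c ≤ (|K| * ‖y‖ ^ 2) * c := by
        gcongr
        exact (hK y).trans (by gcongr; exact le_abs_self K)
    _ = |K| * (c * ‖y‖ ^ 2) := by ring
    _ ≤ |K| * Q₂ y := by gcongr

end Abstract

/-! ### Bounded fields depending linearly on a parameter -/

variable {d : ℕ}

/-- A family of bounded measurable fields on `s` that depends linearly on the parameter. -/
structure IsBddField {X F : Type*} [NormedAddCommGroup X] [InnerProductSpace ℝ X]
    [NormedAddCommGroup F] [InnerProductSpace ℝ F] (ν : Measure (E d)) (s : Set (E d))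
    (g : X → E d → F) : Prop where
  meas : MeasurableSet s
  lt_top : ν s < ⊤
  aesm : ∀ w, AEStronglyMeasurable (g w) (ν.restrict s)
  add : ∀ w v, ∀ x ∈ s, g (w + v) x = g w x + g v x
  smul : ∀ (c : ℝ) w, ∀ x ∈ s, g (c • w) x = c • g w x
  bdd : ∀ w, ∃ C, ∀ x ∈ s, ‖g w x‖ ≤ C

namespace IsBddField

variable {X F : Type*} [NormedAddCommGroup X] [InnerProductSpace ℝ X] [FiniteDimensional ℝ X]
  [NormedAddCommGroup F] [InnerProductSpace ℝ F] {ν : Measure (E d)} {s : Set (E d)}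
  {g h : X → E d → F}

omit [FiniteDimensional ℝ X] in
theorem isFiniteMeasure (hg : IsBddField ν s g) : IsFiniteMeasure (ν.restrict s) :=
  ⟨by simpa using hg.lt_top⟩

omit [FiniteDimensional ℝ X] in
theorem sub (hg : IsBddField ν s g) (w v : X) {x : E d} (hx : x ∈ s) :
    g (w - v) x = g w x - g v x := by
  have := hg.add (w - v) v x hx
  rw [sub_add_cancel] at this
  rw [this, add_sub_cancel_right]

/-- The fields with `x` fixed, as a linear map of the parameter. -/
def linearMapAt (hg : IsBddField ν s g) {x : E d} (hx : x ∈ s) : X →ₗ[ℝ] F where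
  toFun w := g w x
  map_add' w v := hg.add w v x hx
  map_smul' c w := hg.smul c w x hx

/-- The evaluations at the points of `s` are linear maps that are pointwise bounded in the
parameter; Banach–Steinhaus makes the bound uniform. -/
theorem exists_bound (hg : IsBddField ν s g) :
    ∃ K, 0 ≤ K ∧ ∀ w, ∀ x ∈ s, ‖g w x‖ ≤ K * ‖w‖ := by
  have : CompleteSpace X := FiniteDimensional.complete ℝ X
  obtain ⟨K, hK⟩ := banach_steinhaus (ι := s)
    (g := fun x => LinearMap.toContinuousLinearMap (hg.linearMapAt x.2)) (fun w => by
      obtain ⟨C, hC⟩ := hg.bdd w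
      exact ⟨C, fun x => hC x x.2⟩)
  refine ⟨|K|, abs_nonneg K, fun w x hx => ?_⟩
  have h1 := (LinearMap.toContinuousLinearMap (hg.linearMapAt hx)).le_of_opNorm_le
    ((hK ⟨x, hx⟩).trans (le_abs_self K)) w
  exact h1

omit [FiniteDimensional ℝ X] in
theorem add_field (hg : IsBddField ν s g) (hh : IsBddField ν s h) :
    IsBddField ν s fun w x => g w x + h w x where
  meas := hg.meas
  lt_top := hg.lt_top
  aesm w := (hg.aesm w).add (hh.aesm w)
  add w v x hx := by rw [hg.add w v x hx, hh.add w v x hx]; abel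
  smul c w x hx := by rw [hg.smul c w x hx, hh.smul c w x hx, smul_add]
  bdd w := by
    obtain ⟨C, hC⟩ := hg.bdd w
    obtain ⟨C', hC'⟩ := hh.bdd w
    exact ⟨C + C', fun x hx => (norm_add_le _ _).trans (add_le_add (hC x hx) (hC' x hx))⟩

omit [FiniteDimensional ℝ X] in
theorem const_smul (hg : IsBddField ν s g) (a : ℝ) : IsBddField ν s fun w x => a • g w x where
  meas := hg.meas
  lt_top := hg.lt_top
  aesm w := (hg.aesm w).const_smul a
  add w v x hx := by rw [hg.add w v x hx, smul_add]
  smul c w x hx := by rw [hg.smul c w x hx, smul_comm]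
  bdd w := by
    obtain ⟨C, hC⟩ := hg.bdd w
    exact ⟨‖a‖ * C, fun x hx => by rw [norm_smul]; gcongr; exact hC x hx⟩

omit [FiniteDimensional ℝ X] in
theorem sub_smul_field (hg : IsBddField ν s g) (hh : IsBddField ν s h) (σ : ℝ) :
    IsBddField ν s fun w x => g w x - σ • h w x := by
  have := hg.add_field (hh.const_smul (-σ))
  simpa only [neg_smul, ← sub_eq_add_neg] using this

omit [FiniteDimensional ℝ X] in
/-- The product of a scalar field with a fixed bounded vector field. -/
theorem smul_vector {g : X → E d → ℝ} (hg : IsBddField ν s g) {n : E d → F}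
    (hn : AEStronglyMeasurable n (ν.restrict s)) (hn1 : ∀ x, ‖n x‖ ≤ 1) :
    IsBddField ν s fun w x => g w x • n x where
  meas := hg.meas
  lt_top := hg.lt_top
  aesm w := (hg.aesm w).smul hn
  add w v x hx := by rw [hg.add w v x hx, add_smul]
  smul c w x hx := by rw [hg.smul c w x hx, smul_assoc]
  bdd w := by
    obtain ⟨C, hC⟩ := hg.bdd w
    refine ⟨C, fun x hx => ?_⟩
    rw [norm_smul]
    exact (mul_le_of_le_one_right (norm_nonneg _) (hn1 x)).trans (hC x hx)

omit [FiniteDimensional ℝ X] in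
theorem ae_mem (hg : IsBddField ν s g) : ∀ᵐ x ∂ν.restrict s, x ∈ s := ae_restrict_mem hg.meas

omit [FiniteDimensional ℝ X] in
theorem integrable (hg : IsBddField ν s g) (w : X) : Integrable (g w) (ν.restrict s) := by
  obtain ⟨C, hC⟩ := hg.bdd w
  have := hg.isFiniteMeasure
  refine Integrable.of_bound (hg.aesm w) C ?_
  filter_upwards [hg.ae_mem] with x hx using hC x hx

omit [FiniteDimensional ℝ X] in
theorem integrable_norm_sq (hg : IsBddField ν s g) (w : X) :
    Integrable (fun x => ‖g w x‖ ^ 2) (ν.restrict s) := by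
  obtain ⟨C, hC⟩ := hg.bdd w
  have := hg.isFiniteMeasure
  refine Integrable.of_bound ((hg.aesm w).norm.pow 2) (C ^ 2) ?_
  filter_upwards [hg.ae_mem] with x hx
  rw [Real.norm_of_nonneg (by positivity)]
  exact pow_le_pow_left₀ (norm_nonneg _) (hC x hx) 2

omit [FiniteDimensional ℝ X] in
theorem integral_norm_sq_smul (hg : IsBddField ν s g) (c : ℝ) (w : X) :
    ∫ x in s, ‖g (c • w) x‖ ^ 2 ∂ν = c ^ 2 * ∫ x in s, ‖g w x‖ ^ 2 ∂ν := by
  rw [← integral_const_mul]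
  refine setIntegral_congr_fun hg.meas fun x hx => ?_
  simp only [hg.smul c w x hx, norm_smul, mul_pow, Real.norm_eq_abs, sq_abs]

theorem continuous_integral_norm_sq (hg : IsBddField ν s g) :
    Continuous fun w => ∫ x in s, ‖g w x‖ ^ 2 ∂ν := by
  obtain ⟨K, hK0, hK⟩ := hg.exists_bound
  have := hg.isFiniteMeasure
  rw [continuous_iff_continuousAt]
  intro w₀
  refine continuousAt_of_dominated (bound := fun _ => (K * (‖w₀‖ + 1)) ^ 2) ?_ ?_ ?_ ?_
  · exact Eventually.of_forall fun w => (hg.aesm w).norm.pow 2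
  · have : ∀ᶠ w : X in 𝓝 w₀, ‖w‖ < ‖w₀‖ + 1 :=
      continuous_norm.continuousAt.eventually (gt_mem_nhds (lt_add_one _))
    filter_upwards [this] with w hw
    filter_upwards [hg.ae_mem] with x hx
    rw [Real.norm_of_nonneg (by positivity)]
    refine pow_le_pow_left₀ (norm_nonneg _) ((hK w x hx).trans ?_) 2
    gcongr
  · exact integrable_const _
  · filter_upwards [hg.ae_mem] with x hx
    have : Continuous fun w => g w x := (hg.linearMapAt hx).continuous_of_finiteDimensional
    fun_prop

theorem exists_integral_norm_sq_le (hg : IsBddField ν s g) :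
    ∃ K, 0 ≤ K ∧ ∀ w, ∫ x in s, ‖g w x‖ ^ 2 ∂ν ≤ K * ‖w‖ ^ 2 := by
  obtain ⟨K, hK0, hK⟩ := hg.exists_bound
  have := hg.isFiniteMeasure
  refine ⟨ν.real s * K ^ 2, by positivity, fun w => ?_⟩
  calc _ ≤ ∫ _ in s, (K * ‖w‖) ^ 2 ∂ν := by
        refine integral_mono_ae (hg.integrable_norm_sq w) (integrable_const _) ?_
        filter_upwards [hg.ae_mem] with x hx
        exact pow_le_pow_left₀ (norm_nonneg _) (hK w x hx) 2
    _ = _ := by simp; ring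

omit [FiniteDimensional ℝ X] in
theorem ae_eq_zero_of_integral_norm_sq (hg : IsBddField ν s g) {w : X}
    (h : ∫ x in s, ‖g w x‖ ^ 2 ∂ν = 0) : ∀ᵐ x ∂ν.restrict s, g w x = 0 := by
  rw [integral_eq_zero_iff_of_nonneg (fun x => by positivity) (hg.integrable_norm_sq w)] at h
  filter_upwards [h] with x hx
  simpa using hx

end IsBddField

end

/-! ### Monotone coefficients and the one-sided face forms -/

section

variable {d : ℕ}

/-! ### The nonlinear forms on single elements and faces -/

/-- A bounded measurable coefficient on `s` whose flux `A(x, v) v` is Lipschitz and strongly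
monotone in `v`. -/
structure IsMonotoneCoeff (A : E d → E d → (E d →L[ℝ] E d)) (s : Set (E d)) (B CA MA : ℝ) :
    Prop where
  meas : Measurable (Function.uncurry A)
  bdd : ∀ x ∈ s, ∀ v, ‖A x v‖ ≤ B
  lip : ∀ x ∈ s, ∀ v₁ v₂, ‖A x v₁ v₁ - A x v₂ v₂‖ ≤ CA * ‖v₁ - v₂‖
  mono : ∀ x ∈ s, ∀ v₁ v₂, MA * ‖v₁ - v₂‖ ^ 2 ≤ ⟪A x v₁ v₁ - A x v₂ v₂, v₁ - v₂⟫
  pos : 0 < MA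
  le : MA ≤ CA

namespace IsMonotoneCoeff

variable {A : E d → E d → (E d →L[ℝ] E d)} {s t : Set (E d)} {B CA MA : ℝ}

theorem subset (hA : IsMonotoneCoeff A s B CA MA) (h : t ⊆ s) : IsMonotoneCoeff A t B CA MA :=
  ⟨hA.meas, fun x hx => hA.bdd x (h hx), fun x hx => hA.lip x (h hx),
    fun x hx => hA.mono x (h hx), hA.pos, hA.le⟩

theorem aestronglyMeasurable_apply (hA : IsMonotoneCoeff A s B CA MA) {μ : Measure (E d)}
    {y z : E d → E d} (hy : AEStronglyMeasurable y μ) (hz : AEStronglyMeasurable z μ) :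
    AEStronglyMeasurable (fun x => A x (y x) (z x)) μ := by
  have h1 : AEMeasurable (fun x => A x (y x)) μ :=
    hA.meas.comp_aemeasurable (aemeasurable_id.prodMk hy.aemeasurable)
  have h2 : AEStronglyMeasurable (fun x => A x (y x)) μ := h1.aestronglyMeasurable
  exact isBoundedBilinearMap_apply.continuous.comp_aestronglyMeasurable (h2.prodMk hz)

/-- Only boundedness of A is used for the coefficient, so z may be merely integrable. This admits
the Dirichlet data, which are only square integrable. -/
theorem integrable_inner (hA : IsMonotoneCoeff A s B CA MA) {ν : Measure (E d)}
    (hs : MeasurableSet s) {y z φ : E d → E d} (hy : AEStronglyMeasurable y (ν.restrict s))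
    (hz : Integrable z (ν.restrict s)) (hφ : AEStronglyMeasurable φ (ν.restrict s))
    {C : ℝ} (hC : ∀ x ∈ s, ‖φ x‖ ≤ C) :
    Integrable (fun x => ⟪A x (y x) (z x), φ x⟫) (ν.restrict s) := by
  refine Integrable.mono' (g := fun x => |B| * |C| * ‖z x‖) (hz.norm.const_mul _)
    ((hA.aestronglyMeasurable_apply hy hz.1).inner hφ) ?_
  filter_upwards [ae_restrict_mem hs] with x hx
  calc ‖⟪A x (y x) (z x), φ x⟫‖ ≤ ‖A x (y x) (z x)‖ * ‖φ x‖ := norm_inner_le_norm _ _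
    _ ≤ (|B| * ‖z x‖) * |C| := by
        gcongr
        · exact (A x (y x)).le_of_opNorm_le ((hA.bdd x hx _).trans (le_abs_self B)) _
        · exact (hC x hx).trans (le_abs_self C)
    _ = _ := by ring

end IsMonotoneCoeff

section Forms

variable {X : Type*} [NormedAddCommGroup X] [InnerProductSpace ℝ X] [FiniteDimensional ℝ X]
  {A : E d → E d → (E d →L[ℝ] E d)} {s : Set (E d)} {B CA MA : ℝ} {ν : Measure (E d)}

omit [FiniteDimensional ℝ X] in
/-- Integrals whose integrands are linear in one and Lipschitz in another argument. -/
theorem isLipForm_integral {ψ : X → X → E d → ℝ} (hs : MeasurableSet s) (hν : ν s < ⊤)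
    (hint : ∀ w v, Integrable (ψ w v) (ν.restrict s))
    (hadd : ∀ w v v', ∀ x ∈ s, ψ w (v + v') x = ψ w v x + ψ w v' x)
    (hsmul : ∀ w (c : ℝ) v, ∀ x ∈ s, ψ w (c • v) x = c * ψ w v x) {L : ℝ}
    (hlip : ∀ w w' v, ∀ x ∈ s, |ψ w v x - ψ w' v x| ≤ L * ‖w - w'‖ * ‖v‖) :
    IsLipForm fun w v => ∫ x in s, ψ w v x ∂ν where
  add w v v' := by
    rw [← integral_add (hint w v) (hint w v')]
    exact setIntegral_congr_fun hs (hadd w v v')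
  smul w c v := by
    rw [← integral_const_mul]
    exact setIntegral_congr_fun hs (hsmul w c v)
  lip := by
    refine ⟨L * ν.real s, fun w w' v => ?_⟩
    rw [← integral_sub (hint w v) (hint w' v), ← Real.norm_eq_abs]
    refine (norm_setIntegral_le_of_norm_le_const hν (hlip w w' v)).trans (le_of_eq ?_)
    ring

/-- The form `∫ A(∇w)∇w · ∇v`. -/
theorem isLipForm_flux (hA : IsMonotoneCoeff A s B CA MA) {g : X → E d → E d}
    (hg : IsBddField ν s g) :
    IsLipForm fun w v => ∫ x in s, ⟪A x (g w x) (g w x), g v x⟫ ∂ν := by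
  obtain ⟨K, hK0, hK⟩ := hg.exists_bound
  have hCA : 0 ≤ CA := hA.pos.le.trans hA.le
  refine isLipForm_integral hg.meas hg.lt_top (fun w v => ?_) (fun w v v' x hx => ?_)
    (fun w c v x hx => ?_) (L := CA * K * K) (fun w w' v x hx => ?_)
  · obtain ⟨C, hC⟩ := hg.bdd v
    exact hA.integrable_inner hg.meas (hg.aesm w) (hg.integrable w) (hg.aesm v) hC
  · rw [hg.add v v' x hx, inner_add_right]
  · rw [hg.smul c v x hx, inner_smul_right]
  · rw [← inner_sub_left]
    calc _ ≤ ‖A x (g w x) (g w x) - A x (g w' x) (g w' x)‖ * ‖g v x‖ := abs_real_inner_le_norm _ _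
      _ ≤ (CA * (K * ‖w - w'‖)) * (K * ‖v‖) := by
          gcongr
          · refine (hA.lip x hx _ _).trans ?_
            rw [← hg.sub w w' hx]
            gcongr
            exact hK _ x hx
          · exact hK v x hx
      _ = _ := by ring

omit [FiniteDimensional ℝ X] in
theorem le_flux_sub (hA : IsMonotoneCoeff A s B CA MA) {g : X → E d → E d}
    (hg : IsBddField ν s g) (w w' : X) :
    MA * ∫ x in s, ‖g (w - w') x‖ ^ 2 ∂ν ≤
      (∫ x in s, ⟪A x (g w x) (g w x), g (w - w') x⟫ ∂ν) -
        ∫ x in s, ⟪A x (g w' x) (g w' x), g (w - w') x⟫ ∂ν := by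
  obtain ⟨C, hC⟩ := hg.bdd (w - w')
  have h1 := hA.integrable_inner hg.meas (hg.aesm w) (hg.integrable w) (hg.aesm (w - w')) hC
  have h2 := hA.integrable_inner hg.meas (hg.aesm w') (hg.integrable w') (hg.aesm (w - w')) hC
  rw [← integral_const_mul, ← integral_sub h1 h2]
  refine integral_mono_ae ((hg.integrable_norm_sq _).const_mul _) (h1.sub h2) ?_
  filter_upwards [hg.ae_mem] with x hx
  rw [← inner_sub_left, hg.sub w w' hx]
  exact hA.mono x hx _ _

/-- The integrand on one side of a face, written in terms of the flux: `γ` and `j` are the gradient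
and the jump of the first argument, `γ'` and `j'` those of the second one. -/
def sideIntegrand (A : E d → E d → (E d →L[ℝ] E d)) (θ σ : ℝ) (γ j γ' j' : E d → E d) (x : E d) :
    ℝ :=
  -⟪A x (γ x - σ • j x) (γ x - σ • j x), j' x⟫ +
    θ * σ⁻¹ * ⟪A x (γ x) (γ x) - A x (γ x - σ • j x) (γ x - σ • j x), γ' x⟫

/-- The fluxes on one side of a face combine. -/
theorem sideIntegrand_eq (A : E d → E d → (E d →L[ℝ] E d)) (θ : ℝ) {σ : ℝ} (hσ : σ ≠ 0)
    (γ j γ' j' : E d → E d) (x : E d) :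
    sideIntegrand A θ σ γ j γ' j' x =
      -⟪A x (γ x - σ • j x) (γ x), j' x⟫ + θ * ⟪A x (γ x - σ • j x) (j x), γ' x⟫ +
        σ * ⟪A x (γ x - σ • j x) (j x), j' x⟫ +
        θ * (σ⁻¹ * ⟪(A x (γ x) - A x (γ x - σ • j x)) (γ x), γ' x⟫) := by
  simp only [sideIntegrand, map_sub, map_smul, inner_sub_left, inner_smul_left,
    sub_apply, conj_trivial]
  field_simp
  ring

theorem integrable_sideIntegrand (hA : IsMonotoneCoeff A s B CA MA) (hs : MeasurableSet s)
    (θ σ : ℝ) {γ j γ' j' : E d → E d} (hγ : Integrable γ (ν.restrict s))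
    (hj : Integrable j (ν.restrict s)) (hγ' : AEStronglyMeasurable γ' (ν.restrict s))
    (hj' : AEStronglyMeasurable j' (ν.restrict s)) {C C' : ℝ} (hC : ∀ x ∈ s, ‖γ' x‖ ≤ C)
    (hC' : ∀ x ∈ s, ‖j' x‖ ≤ C') :
    Integrable (sideIntegrand A θ σ γ j γ' j') (ν.restrict s) := by
  have hz : Integrable (fun x => γ x - σ • j x) (ν.restrict s) := hγ.sub (hj.smul σ)
  have h1 := hA.integrable_inner hs hz.1 hz hj' hC'
  have h2 := hA.integrable_inner hs hz.1 hz hγ' hC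
  have h3 := hA.integrable_inner hs hγ.1 hγ hγ' hC
  have h4 := h1.neg.add ((h3.sub h2).const_mul (θ * σ⁻¹))
  refine h4.congr (Eventually.of_forall fun x => ?_)
  simp [sideIntegrand, inner_sub_left]

/-- The form on one side of a face; the jump of the first argument is reduced by the data `j₀`. -/
def sideForm (A : E d → E d → (E d →L[ℝ] E d)) (θ σ : ℝ) (ν : Measure (E d)) (s : Set (E d))
    (j₀ : E d → E d) (g J : X → E d → E d) (w v : X) : ℝ :=
  ∫ x in s, sideIntegrand A θ σ (g w) (fun x => J w x - j₀ x) (g v) (J v) x ∂ν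

omit [FiniteDimensional ℝ X] in
theorem integrable_side (hA : IsMonotoneCoeff A s B CA MA) (θ σ : ℝ) {j₀ : E d → E d}
    (hj₀ : Integrable j₀ (ν.restrict s)) {g J : X → E d → E d} (hg : IsBddField ν s g)
    (hJ : IsBddField ν s J) (w v : X) :
    Integrable (sideIntegrand A θ σ (g w) (fun x => J w x - j₀ x) (g v) (J v))
      (ν.restrict s) := by
  obtain ⟨C, hC⟩ := hg.bdd v
  obtain ⟨C', hC'⟩ := hJ.bdd v
  exact integrable_sideIntegrand hA hg.meas θ σ (hg.integrable w) ((hJ.integrable w).sub hj₀)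
    (hg.aesm v) (hJ.aesm v) hC hC'

theorem isLipForm_sideForm (hA : IsMonotoneCoeff A s B CA MA) (θ σ : ℝ) {j₀ : E d → E d}
    (hj₀ : Integrable j₀ (ν.restrict s)) {g J : X → E d → E d} (hg : IsBddField ν s g)
    (hJ : IsBddField ν s J) : IsLipForm (sideForm A θ σ ν s j₀ g J) := by
  obtain ⟨K, hK0, hK⟩ := hg.exists_bound
  obtain ⟨K', hK0', hK'⟩ := hJ.exists_bound
  obtain ⟨K'', hK0'', hK''⟩ := (hg.sub_smul_field hJ σ).exists_bound
  have hCA : 0 ≤ CA := hA.pos.le.trans hA.le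
  -- The constant collects the bounds `K`, `K'` and `K''` for the gradient, the jump and the
  -- combination z.
  refine isLipForm_integral hg.meas hg.lt_top (integrable_side hA θ σ hj₀ hg hJ)
    (fun w v v' x hx => ?_) (fun w c v x hx => ?_)
    (L := CA * K'' * K' + |θ * σ⁻¹| * ((CA * K + CA * K'') * K)) (fun w w' v x hx => ?_)
  · simp only [sideIntegrand]
    rw [hg.add v v' x hx, hJ.add v v' x hx, inner_add_right, inner_add_right]
    ring
  · simp only [sideIntegrand]
    rw [hg.smul c v x hx, hJ.smul c v x hx, inner_smul_right, inner_smul_right]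
    ring
  · simp only [sideIntegrand]
    set z := g w x - σ • (J w x - j₀ x)
    set z' := g w' x - σ • (J w' x - j₀ x)
    -- The data j₀ cancel in the difference, which is therefore bounded by the parameter difference.
    have hz : z - z' = g (w - w') x - σ • J (w - w') x := by
      rw [hg.sub w w' hx, hJ.sub w w' hx]
      simp only [z, z', smul_sub]
      abel
    have hD : ‖A x z z - A x z' z'‖ ≤ CA * K'' * ‖w - w'‖ := by
      refine (hA.lip x hx _ _).trans ?_
      rw [hz, mul_assoc]
      gcongr
      exact hK'' _ x hx
    have hG : ‖A x (g w x) (g w x) - A x (g w' x) (g w' x)‖ ≤ CA * K * ‖w - w'‖ := by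
      refine (hA.lip x hx _ _).trans ?_
      rw [← hg.sub w w' hx, mul_assoc]
      gcongr
      exact hK _ x hx
    set D := A x z z - A x z' z'
    set G := A x (g w x) (g w x) - A x (g w' x) (g w' x)
    have heq : -⟪A x z z, J v x⟫ + θ * σ⁻¹ * ⟪A x (g w x) (g w x) - A x z z, g v x⟫ -
        (-⟪A x z' z', J v x⟫ + θ * σ⁻¹ * ⟪A x (g w' x) (g w' x) - A x z' z', g v x⟫) =
        -⟪D, J v x⟫ + θ * σ⁻¹ * ⟪G - D, g v x⟫ := by
      simp only [D, G, inner_sub_left]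
      ring
    rw [heq]
    have h1 : |⟪D, J v x⟫| ≤ (CA * K'' * ‖w - w'‖) * (K' * ‖v‖) :=
      (abs_real_inner_le_norm _ _).trans (by gcongr; exact hK' v x hx)
    have h2 : |⟪G - D, g v x⟫| ≤ (CA * K * ‖w - w'‖ + CA * K'' * ‖w - w'‖) * (K * ‖v‖) :=
      (abs_real_inner_le_norm _ _).trans (by
        gcongr
        · exact (norm_sub_le _ _).trans (add_le_add hG hD)
        · exact hK v x hx)
    calc _ ≤ |⟪D, J v x⟫| + |θ * σ⁻¹| * |⟪G - D, g v x⟫| := by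
          refine (abs_add_le _ _).trans ?_
          rw [abs_neg, abs_mul]
      _ ≤ (CA * K'' * ‖w - w'‖) * (K' * ‖v‖) +
          |θ * σ⁻¹| * ((CA * K * ‖w - w'‖ + CA * K'' * ‖w - w'‖) * (K * ‖v‖)) := by gcongr
      _ = _ := by ring

/-- The pointwise estimate behind the monotonicity of the form on a face. -/
theorem le_side_of_flux {θ σ CA MA : ℝ} (hθ : -1 ≤ θ) (hσ : 0 < σ) (hMA : 0 < MA)
    {D G g J z : E d} (hz : z = g - σ • J) (hD : ‖D‖ ≤ CA * ‖z‖) (hDz : MA * ‖z‖ ^ 2 ≤ ⟪D, z⟫)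
    (hG : ‖G‖ ≤ CA * ‖g‖) (hGg : MA * ‖g‖ ^ 2 ≤ ⟪G, g⟫) :
    σ⁻¹ * (MA / 2 * ‖z‖ ^ 2 - (|1 + θ| ^ 2 * CA ^ 2 / (2 * MA) + CA) * ‖g‖ ^ 2) ≤
      -⟪D, J⟫ + θ * σ⁻¹ * ⟪G - D, g⟫ := by
  have hJ : J = σ⁻¹ • (g - z) := by
    rw [hz, sub_sub_cancel, smul_smul, inv_mul_cancel₀ hσ.ne', one_smul]
  -- Eliminating the jump leaves a form in g and z only, in which D is paired with its own argument
  -- z.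
  have heq : -⟪D, J⟫ + θ * σ⁻¹ * ⟪G - D, g⟫ =
      σ⁻¹ * (⟪D, z⟫ - (1 + θ) * ⟪D, g⟫ + θ * ⟪G, g⟫) := by
    rw [hJ, inner_smul_right, inner_sub_right, inner_sub_left]
    ring
  rw [heq]
  have h1 : (1 + θ) * ⟪D, g⟫ ≤ |1 + θ| * (CA * ‖z‖ * ‖g‖) := by
    refine (le_abs_self _).trans ?_
    rw [abs_mul]
    gcongr
    exact (abs_real_inner_le_norm _ _).trans (by gcongr)
  have h2 : |1 + θ| * (CA * ‖z‖ * ‖g‖) ≤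
      MA / 2 * ‖z‖ ^ 2 + |1 + θ| ^ 2 * CA ^ 2 / (2 * MA) * ‖g‖ ^ 2 := by
    -- Young's inequality as a completed square, weighted so that exactly half of the coercive term
    -- is spent.
    have h3 : MA / 2 * ‖z‖ ^ 2 + |1 + θ| ^ 2 * CA ^ 2 / (2 * MA) * ‖g‖ ^ 2 -
        |1 + θ| * (CA * ‖z‖ * ‖g‖) =
        (MA * ‖z‖ - |1 + θ| * CA * ‖g‖) ^ 2 / (2 * MA) := by
      field_simp
      ring
    have : 0 ≤ (MA * ‖z‖ - |1 + θ| * CA * ‖g‖) ^ 2 / (2 * MA) := by positivity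
    linarith
  -- Since 0 ≤ G·g ≤ C_A|g|², the worst admissible case is θ = -1.
  have h4 : -(CA * ‖g‖ ^ 2) ≤ θ * ⟪G, g⟫ := by
    have h5 : ⟪G, g⟫ ≤ CA * ‖g‖ ^ 2 :=
      (real_inner_le_norm _ _).trans (by rw [sq, ← mul_assoc]; gcongr)
    have h6 : 0 ≤ ⟪G, g⟫ := le_trans (by positivity) hGg
    nlinarith
  refine mul_le_mul_of_nonneg_left ?_ (by positivity)
  linarith

omit [FiniteDimensional ℝ X] in
-- The pointwise estimate `le_side_of_flux` is integrated. The data j₀ do not enter it because they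
-- cancel in the difference of the z-values.
theorem le_sideForm_sub (hA : IsMonotoneCoeff A s B CA MA) {θ σ : ℝ} (hθ : -1 ≤ θ) (hσ : 0 < σ)
    {j₀ : E d → E d} (hj₀ : Integrable j₀ (ν.restrict s)) {g J : X → E d → E d}
    (hg : IsBddField ν s g) (hJ : IsBddField ν s J) (w w' : X) :
    σ⁻¹ * (MA / 2 * (∫ x in s, ‖g (w - w') x - σ • J (w - w') x‖ ^ 2 ∂ν) -
      (|1 + θ| ^ 2 * CA ^ 2 / (2 * MA) + CA) * ∫ x in s, ‖g (w - w') x‖ ^ 2 ∂ν) ≤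
      sideForm A θ σ ν s j₀ g J w (w - w') - sideForm A θ σ ν s j₀ g J w' (w - w') := by
  have h1 := integrable_side hA θ σ hj₀ hg hJ w (w - w')
  have h2 := integrable_side hA θ σ hj₀ hg hJ w' (w - w')
  have h3 := ((hg.sub_smul_field hJ σ).integrable_norm_sq (w - w')).const_mul (MA / 2)
  have h4 := (hg.integrable_norm_sq (w - w')).const_mul (|1 + θ| ^ 2 * CA ^ 2 / (2 * MA) + CA)
  rw [sideForm, sideForm, ← integral_sub h1 h2, ← integral_const_mul, ← integral_const_mul,
    ← integral_sub h3 h4, ← integral_const_mul]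
  refine integral_mono_ae ((h3.sub h4).const_mul _) (h1.sub h2) ?_
  filter_upwards [hg.ae_mem] with x hx
  simp only [sideIntegrand]
  set z := g w x - σ • (J w x - j₀ x)
  set z' := g w' x - σ • (J w' x - j₀ x)
  have hz : z - z' = g (w - w') x - σ • J (w - w') x := by
    rw [hg.sub w w' hx, hJ.sub w w' hx]
    simp only [z, z', smul_sub]
    abel
  have := le_side_of_flux hθ hσ hA.pos hz (hA.lip x hx z z') (hA.mono x hx z z')
    (g := g (w - w') x) (J := J (w - w') x) (G := A x (g w x) (g w x) - A x (g w' x) (g w' x))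
    (by rw [hg.sub w w' hx]; exact hA.lip x hx _ _)
    (by rw [hg.sub w w' hx]; exact hA.mono x hx _ _)
  rw [← hz]
  refine this.trans (le_of_eq ?_)
  simp only [inner_sub_left]
  ring

end Forms

end

/-! ### Finite element fields, and the face terms as sums of one-sided forms -/

section

variable {d : ℕ}

theorem integral_four_terms {μ : Measure (E d)} {f₁ f₂ f₃ f₄ : E d → ℝ} (h₁ : Integrable f₁ μ)
    (h₂ : Integrable f₂ μ) (h₃ : Integrable f₃ μ) (h₄ : Integrable f₄ μ) (θ : ℝ) :
    -(∫ x, f₁ x ∂μ) + θ * (∫ x, f₂ x ∂μ) + (∫ x, f₃ x ∂μ) + θ * (∫ x, f₄ x ∂μ) =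
      ∫ x, (-f₁ x + θ * f₂ x + f₃ x + θ * f₄ x) ∂μ := by
  have e₁ : Integrable (fun x => -f₁ x) μ := h₁.neg
  have e₂ : Integrable (fun x => -f₁ x + θ * f₂ x) μ := e₁.add (h₂.const_mul θ)
  have e₃ : Integrable (fun x => -f₁ x + θ * f₂ x + f₃ x) μ := e₂.add h₃
  rw [integral_add e₃ (h₄.const_mul θ), integral_add e₂ h₃, integral_add e₁ (h₂.const_mul θ),
    integral_neg, integral_const_mul, integral_const_mul]

theorem adjoint_inner (T : E d →L[ℝ] E d) (x y : E d) : ⟪T.adjoint y, x⟫ = ⟪T x, y⟫ := by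
  rw [ContinuousLinearMap.adjoint_inner_left, real_inner_comm]

theorem integrable_side_terms {A : E d → E d → (E d →L[ℝ] E d)} {s : Set (E d)} {B CA MA : ℝ}
    {ν : Measure (E d)} (hA : IsMonotoneCoeff A s B CA MA) (hs : MeasurableSet s) (σ : ℝ)
    {γ j γ' j' : E d → E d} (hγ : Integrable γ (ν.restrict s))
    (hj : Integrable j (ν.restrict s)) (hγ' : AEStronglyMeasurable γ' (ν.restrict s))
    (hj' : AEStronglyMeasurable j' (ν.restrict s)) {C C' : ℝ} (hC : ∀ x ∈ s, ‖γ' x‖ ≤ C)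
    (hC' : ∀ x ∈ s, ‖j' x‖ ≤ C') :
    Integrable (fun x => ⟪A x (γ x - σ • j x) (γ x), j' x⟫) (ν.restrict s) ∧
    Integrable (fun x => ⟪A x (γ x - σ • j x) (j x), γ' x⟫) (ν.restrict s) ∧
    Integrable (fun x => ⟪A x (γ x - σ • j x) (j x), j' x⟫) (ν.restrict s) ∧
    Integrable (fun x => ⟪(A x (γ x) - A x (γ x - σ • j x)) (γ x), γ' x⟫) (ν.restrict s) := by
  have hz : AEStronglyMeasurable (fun x => γ x - σ • j x) (ν.restrict s) :=
    (hγ.sub (hj.smul σ)).1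
  refine ⟨hA.integrable_inner hs hz hγ hj' hC', hA.integrable_inner hs hz hj hγ' hC,
    hA.integrable_inner hs hz hj hj' hC', ?_⟩
  refine ((hA.integrable_inner hs hγ.1 hγ hγ' hC).sub
    (hA.integrable_inner hs hz hγ hγ' hC)).congr (Eventually.of_forall fun x => ?_)
  simp [inner_sub_left]

namespace HpMesh

variable {Ω : Set (E d)} {M : HpMesh Ω} {β₁ β₂ β₃ : ℝ} {X : Type*} [NormedAddCommGroup X]
  [InnerProductSpace ℝ X] {Φ : X →ₗ[ℝ] (E d → ℝ)}

theorem volume_elem_lt_top (i : Fin M.n) : volume (M.elem i) < ⊤ :=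
  (measure_mono subset_closure).trans_lt (M.isCompact_closure_elem i).measure_lt_top

theorem volume_real_elem_pos (hd : 2 ≤ d) (i : Fin M.n) : 0 < volume.real (M.elem i) :=
  ENNReal.toReal_pos ((M.isOpen_elem' i).measure_pos volume (M.elem_nonempty i hd)).ne'
    (volume_elem_lt_top i).ne

section Fields

variable (hΦ : ∀ w, Φ w ∈ M.V) (i : Fin M.n)

include hΦ

theorem isBddField_tr {ν : Measure (E d)} {s : Set (E d)} (hs : MeasurableSet s) (hν : ν s < ⊤)
    (hsub : s ⊆ closure (M.elem i)) : IsBddField ν s fun w => M.tr i (Φ w) where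
  meas := hs
  lt_top := hν
  aesm w := ((continuousOn_tr i (hΦ w)).mono hsub).aestronglyMeasurable hs
  add w v x hx := by rw [map_add, tr_add i (hΦ w) (hΦ v) (hsub hx)]
  smul c w x hx := by rw [map_smul, tr_smul i (hΦ w) c (hsub hx), smul_eq_mul]
  bdd w := by
    obtain ⟨C, hC⟩ := (M.isCompact_closure_elem i).exists_bound_of_continuousOn
      (continuousOn_tr i (hΦ w))
    exact ⟨C, fun x hx => hC x (hsub hx)⟩

theorem isBddField_trGrad (hM : M.Admissible β₁ β₂ β₃) (hd : 2 ≤ d) {ν : Measure (E d)}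
    {s : Set (E d)} (hs : MeasurableSet s) (hν : ν s < ⊤) (hsub : s ⊆ closure (M.elem i)) :
    IsBddField ν s fun w => M.trGrad i (Φ w) where
  meas := hs
  lt_top := hν
  aesm w := ((continuousOn_trGrad i hM hd (hΦ w)).mono hsub).aestronglyMeasurable hs
  add w v x hx := by rw [map_add, trGrad_add i hM hd (hΦ w) (hΦ v) (hsub hx)]
  smul c w x hx := by rw [map_smul, trGrad_smul i hM hd (hΦ w) c (hsub hx)]
  bdd w := by
    obtain ⟨C, hC⟩ := (M.isCompact_closure_elem i).exists_bound_of_continuousOn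
      (continuousOn_trGrad i hM hd (hΦ w))
    exact ⟨C, fun x hx => hC x (hsub hx)⟩

/-- In the open element the gradient coincides with its continuous extension to the compact closure,
which supplies boundedness. -/
theorem isBddField_gradient (hM : M.Admissible β₁ β₂ β₃) (hd : 2 ≤ d) :
    IsBddField volume (M.elem i) fun w => gradient (Φ w) := by
  have h := isBddField_trGrad hΦ i hM hd (M.isOpen_elem' i).measurableSet (volume_elem_lt_top i)
    subset_closure
  have heq : ∀ w, ∀ x ∈ M.elem i, M.trGrad i (Φ w) x = gradient (Φ w) x := fun w x hx =>
    trGrad_eq_of_mem i hM hd (hΦ w) hx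
  refine ⟨h.meas, h.lt_top, fun w => (h.aesm w).congr ?_, fun w v x hx => ?_, fun c w x hx => ?_,
    fun w => ?_⟩
  · filter_upwards [h.ae_mem] with x hx using heq w x hx
  · rw [← heq _ x hx, ← heq _ x hx, ← heq _ x hx, h.add w v x hx]
  · rw [← heq _ x hx, ← heq _ x hx, h.smul c w x hx]
  · obtain ⟨C, hC⟩ := h.bdd w
    exact ⟨C, fun x hx => heq w x hx ▸ hC x hx⟩

theorem isBddField_value : IsBddField volume (M.elem i) fun w => Φ w := by
  have h := isBddField_tr hΦ i (M.isOpen_elem' i).measurableSet (volume_elem_lt_top i)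
    subset_closure
  have heq : ∀ w, ∀ x ∈ M.elem i, M.tr i (Φ w) x = Φ w x := fun w x hx =>
    tr_eq_of_mem i (hΦ w) hx
  refine ⟨h.meas, h.lt_top, fun w => (h.aesm w).congr ?_, fun w v x hx => ?_, fun c w x hx => ?_,
    fun w => ?_⟩
  · filter_upwards [h.ae_mem] with x hx using heq w x hx
  · rw [map_add, Pi.add_apply]
  · rw [map_smul, Pi.smul_apply]
  · obtain ⟨C, hC⟩ := h.bdd w
    exact ⟨C, fun x hx => heq w x hx ▸ hC x hx⟩

theorem isBddField_tr_smul_nrm (k : Fin M.n) {ν : Measure (E d)} {s : Set (E d)}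
    (hs : MeasurableSet s) (hν : ν s < ⊤) (hsub : s ⊆ closure (M.elem i)) :
    IsBddField ν s fun w x => M.tr i (Φ w) x • M.nrm k x :=
  (isBddField_tr hΦ i hs hν hsub).smul_vector (measurable_normal _).aestronglyMeasurable
    (norm_normal_le _)

end Fields

/-! ### Faces -/

theorem measurableSet_iface (i j : Fin M.n) : MeasurableSet (M.iface i j) :=
  (isClosed_frontier.inter isClosed_frontier).measurableSet

theorem measurableSet_bface {Γ : Set (E d)} (hΓ : MeasurableSet Γ) (i : Fin M.n) :
    MeasurableSet (M.bface Γ i) :=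
  isClosed_frontier.measurableSet.inter hΓ

theorem surf_iface_lt_top (hM : M.Admissible β₁ β₂ β₃) (hd : 2 ≤ d) (i j : Fin M.n) :
    surf d (M.iface i j) < ⊤ :=
  (measure_mono inter_subset_left).trans_lt (hM.surf_frontier_elem_lt_top i hd)

theorem surf_bface_lt_top (hM : M.Admissible β₁ β₂ β₃) (hd : 2 ≤ d) (Γ : Set (E d))
    (i : Fin M.n) : surf d (M.bface Γ i) < ⊤ :=
  (measure_mono inter_subset_left).trans_lt (hM.surf_frontier_elem_lt_top i hd)

theorem iface_subset_left (i j : Fin M.n) : M.iface i j ⊆ closure (M.elem i) :=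
  inter_subset_left.trans frontier_subset_closure

theorem iface_subset_right (i j : Fin M.n) : M.iface i j ⊆ closure (M.elem j) :=
  inter_subset_right.trans frontier_subset_closure

theorem bface_subset (Γ : Set (E d)) (i : Fin M.n) : M.bface Γ i ⊆ closure (M.elem i) :=
  inter_subset_left.trans frontier_subset_closure

theorem closure_elem_subset (i : Fin M.n) : closure (M.elem i) ⊆ closure Ω :=
  closure_mono (M.elem_subset i)

theorem isBddField_jump (hΦ : ∀ w, Φ w ∈ M.V) (hM : M.Admissible β₁ β₂ β₃) (hd : 2 ≤ d)
    (q : Fin M.n × Fin M.n) :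
    IsBddField (surf d) (M.iface q.1 q.2) fun w => M.jump q (Φ w) :=
  (isBddField_tr_smul_nrm hΦ q.1 q.1 (measurableSet_iface _ _) (surf_iface_lt_top hM hd _ _)
    (iface_subset_left _ _)).add_field (isBddField_tr_smul_nrm hΦ q.2 q.2 (measurableSet_iface _ _)
    (surf_iface_lt_top hM hd _ _) (iface_subset_right _ _))

theorem isBddField_trGrad_left (hΦ : ∀ w, Φ w ∈ M.V) (hM : M.Admissible β₁ β₂ β₃) (hd : 2 ≤ d)
    (q : Fin M.n × Fin M.n) :
    IsBddField (surf d) (M.iface q.1 q.2) fun w => M.trGrad q.1 (Φ w) :=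
  isBddField_trGrad hΦ q.1 hM hd (measurableSet_iface _ _) (surf_iface_lt_top hM hd _ _)
    (iface_subset_left _ _)

theorem isBddField_trGrad_right (hΦ : ∀ w, Φ w ∈ M.V) (hM : M.Admissible β₁ β₂ β₃) (hd : 2 ≤ d)
    (q : Fin M.n × Fin M.n) :
    IsBddField (surf d) (M.iface q.1 q.2) fun w => M.trGrad q.2 (Φ w) :=
  isBddField_trGrad hΦ q.2 hM hd (measurableSet_iface _ _) (surf_iface_lt_top hM hd _ _)
    (iface_subset_right _ _)

theorem isBddField_trGrad_bface (hΦ : ∀ w, Φ w ∈ M.V) (hM : M.Admissible β₁ β₂ β₃) (hd : 2 ≤ d)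
    {Γ : Set (E d)} (hΓ : MeasurableSet Γ) (i : Fin M.n) :
    IsBddField (surf d) (M.bface Γ i) fun w => M.trGrad i (Φ w) :=
  isBddField_trGrad hΦ i hM hd (measurableSet_bface hΓ _) (surf_bface_lt_top hM hd _ _)
    (bface_subset _ _)

theorem isBddField_tr_bface (hΦ : ∀ w, Φ w ∈ M.V) (hM : M.Admissible β₁ β₂ β₃) (hd : 2 ≤ d)
    {Γ : Set (E d)} (hΓ : MeasurableSet Γ) (i : Fin M.n) :
    IsBddField (surf d) (M.bface Γ i) fun w => M.tr i (Φ w) :=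
  isBddField_tr hΦ i (measurableSet_bface hΓ _) (surf_bface_lt_top hM hd _ _) (bface_subset _ _)

theorem isBddField_tr_smul_nrm_bface (hΦ : ∀ w, Φ w ∈ M.V) (hM : M.Admissible β₁ β₂ β₃)
    (hd : 2 ≤ d) {Γ : Set (E d)} (hΓ : MeasurableSet Γ) (i : Fin M.n) :
    IsBddField (surf d) (M.bface Γ i) fun w x => M.tr i (Φ w) x • M.nrm i x :=
  isBddField_tr_smul_nrm hΦ i i (measurableSet_bface hΓ _) (surf_bface_lt_top hM hd _ _)
    (bface_subset _ _)

theorem integrable_of_memLp_bface (hM : M.Admissible β₁ β₂ β₃) (hd : 2 ≤ d) {Γ : Set (E d)}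
    {g : E d → ℝ} (hg : MemLp g 2 ((surf d).restrict Γ)) (i : Fin M.n) :
    Integrable g ((surf d).restrict (M.bface Γ i)) := by
  have : IsFiniteMeasure ((surf d).restrict (M.bface Γ i)) :=
    ⟨by simpa using surf_bface_lt_top hM hd Γ i⟩
  have h : MemLp g 2 ((surf d).restrict (M.bface Γ i)) :=
    hg.mono_measure (Measure.restrict_mono inter_subset_right le_rfl)
  exact h.integrable (by norm_num)

theorem integrable_smul_nrm {s : Set (E d)} {g : E d → ℝ}
    (hg : Integrable g ((surf d).restrict s)) (i : Fin M.n) :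
    Integrable (fun x => g x • M.nrm i x) ((surf d).restrict s) := by
  refine hg.norm.mono' (hg.1.smul (measurable_normal _).aestronglyMeasurable)
    (Eventually.of_forall fun x => ?_)
  rw [norm_smul]
  exact mul_le_of_le_one_right (norm_nonneg _) (norm_normal_le _ _)

variable {A : E d → E d → (E d →L[ℝ] E d)} {B CA MA : ℝ}

/-- The interior face terms in terms of the one-sided forms. -/
theorem B0_eq (hΦ : ∀ w, Φ w ∈ M.V) (hM : M.Admissible β₁ β₂ β₃) (hd : 2 ≤ d)
    (hA : IsMonotoneCoeff A (closure Ω) B CA MA) (θ α : ℝ)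
    (hσ : ∀ q ∈ M.intFaces, M.sigmaI α q ≠ 0) (w v : X) :
    M.B0 A θ α (Φ w) (Φ v) = ∑ q ∈ M.intFaces, (1 / 2 : ℝ) *
      (sideForm A θ (M.sigmaI α q) (surf d) (M.iface q.1 q.2) 0 (fun w => M.trGrad q.1 (Φ w))
          (fun w => M.jump q (Φ w)) w v +
        sideForm A θ (M.sigmaI α q) (surf d) (M.iface q.1 q.2) 0 (fun w => M.trGrad q.2 (Φ w))
          (fun w => M.jump q (Φ w)) w v) := by
  refine Finset.sum_congr rfl fun q hq => ?_
  have hσq := hσ q hq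
  have hA' := hA.subset ((iface_subset_left q.1 q.2).trans (closure_elem_subset q.1))
  have hms := measurableSet_iface (M := M) q.1 q.2
  have hg1 := isBddField_trGrad_left hΦ hM hd q
  have hg2 := isBddField_trGrad_right hΦ hM hd q
  have hJ := isBddField_jump hΦ hM hd q
  obtain ⟨C1, hC1⟩ := hg1.bdd v
  obtain ⟨C2, hC2⟩ := hg2.bdd v
  obtain ⟨C3, hC3⟩ := hJ.bdd v
  obtain ⟨a1, a2, a3, a4⟩ := integrable_side_terms hA' hms (M.sigmaI α q) (hg1.integrable w)
    (hJ.integrable w) (hg1.aesm v) (hJ.aesm v) hC1 hC3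
  obtain ⟨b1, b2, b3, b4⟩ := integrable_side_terms hA' hms (M.sigmaI α q) (hg2.integrable w)
    (hJ.integrable w) (hg2.aesm v) (hJ.aesm v) hC2 hC3
  have i1 := integrable_side hA' θ (M.sigmaI α q) (integrable_zero _ _ _) hg1 hJ w v
  have i2 := integrable_side hA' θ (M.sigmaI α q) (integrable_zero _ _ _) hg2 hJ w v
  -- Combining all terms under one integral reduces the claim to the pointwise identity
  -- `sideIntegrand_eq` on both sides.
  rw [sideForm, sideForm, ← integral_add i1 i2, ← integral_const_mul, integral_four_terms]
  · refine integral_congr_ae (Eventually.of_forall fun x => ?_)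
    simp only [Pi.zero_apply, sub_zero, sideIntegrand_eq A θ hσq, avg, smul_eq_mul,
      inner_smul_left, inner_add_left, conj_trivial, adjoint_inner,
      smul_apply, add_apply]
    ring
  · refine ((a1.add b1).const_mul (1 / 2)).congr (Eventually.of_forall fun x => ?_)
    simp [avg, inner_smul_left, inner_add_left]
    ring
  · refine ((a2.add b2).const_mul (1 / 2)).congr (Eventually.of_forall fun x => ?_)
    simp [avg, inner_smul_left, inner_add_left, adjoint_inner]
    ring
  · refine ((a3.add b3).const_mul (M.sigmaI α q * (1 / 2))).congr
      (Eventually.of_forall fun x => ?_)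
    simp [avg, inner_smul_left, inner_add_left]
    ring
  · refine ((a4.add b4).const_mul ((M.sigmaI α q)⁻¹ * (1 / 2))).congr
      (Eventually.of_forall fun x => ?_)
    simp [avg]
    ring

/-- The Dirichlet face terms in terms of the one-sided forms. -/
theorem BD_eq (hΦ : ∀ w, Φ w ∈ M.V) (hM : M.Admissible β₁ β₂ β₃) (hd : 2 ≤ d)
    (hA : IsMonotoneCoeff A (closure Ω) B CA MA) (θ α : ℝ) {ΓD : Set (E d)}
    (hΓD : MeasurableSet ΓD) {gD : E d → ℝ} (hgD : MemLp gD 2 ((surf d).restrict ΓD))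
    (hσ : ∀ i ∈ M.bdryFaces ΓD, M.sigmaB α ΓD i ≠ 0) (w v : X) :
    M.BD A θ α ΓD gD (Φ w) (Φ v) = ∑ i ∈ M.bdryFaces ΓD,
      sideForm A θ (M.sigmaB α ΓD i) (surf d) (M.bface ΓD i) (fun x => gD x • M.nrm i x)
        (fun w => M.trGrad i (Φ w)) (fun w x => M.tr i (Φ w) x • M.nrm i x) w v := by
  refine Finset.sum_congr rfl fun i hi => ?_
  have hσi := hσ i hi
  have hA' := hA.subset ((bface_subset ΓD i).trans (closure_elem_subset i))
  have hms := measurableSet_bface (M := M) hΓD i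
  have hg := isBddField_trGrad_bface hΦ hM hd hΓD i
  have hJ := isBddField_tr_smul_nrm_bface hΦ hM hd hΓD i
  have hj₀ := integrable_smul_nrm (integrable_of_memLp_bface hM hd hgD i) i
  obtain ⟨C1, hC1⟩ := hg.bdd v
  obtain ⟨C3, hC3⟩ := hJ.bdd v
  obtain ⟨a1, a2, a3, a4⟩ := integrable_side_terms hA' hms (M.sigmaB α ΓD i) (hg.integrable w)
    ((hJ.integrable w).sub hj₀) (hg.aesm v) (hJ.aesm v) hC1 hC3
  simp only [Pi.sub_apply, ← sub_smul] at a1 a2 a3 a4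
  rw [sideForm, integral_four_terms]
  · refine integral_congr_ae (Eventually.of_forall fun x => ?_)
    simp only [← sub_smul]
    rw [sideIntegrand_eq A θ hσi]
    simp only [adjoint_inner, map_smul, inner_smul_left,
      inner_smul_right, conj_trivial]
    ring
  · refine a1.congr (Eventually.of_forall fun x => ?_)
    simp only [inner_smul_right]
    ring
  · refine a2.congr (Eventually.of_forall fun x => ?_)
    simp only [adjoint_inner, map_smul, inner_smul_left, conj_trivial]
    ring
  · refine (a3.const_mul (M.sigmaB α ΓD i)).congr (Eventually.of_forall fun x => ?_)
    simp only [map_smul, inner_smul_left, inner_smul_right, conj_trivial]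
    ring
  · exact a4.const_mul _

end HpMesh

end

/-! ### Finite dimension of the space and functions with vanishing gradients and jumps -/

section

variable {d : ℕ}

namespace HpMesh

variable {Ω : Set (E d)} {M : HpMesh Ω} {β₁ β₂ β₃ : ℝ}

theorem disjoint_elem' {i j : Fin M.n} (h : i ≠ j) : Disjoint (M.elem i) (M.elem j) :=
  M.disjoint_elem i j h

/-- The finite element function with given local polynomials. -/
def ofLocal (M : HpMesh Ω) :
    (∀ i, (M.shape i).polys d (M.p i)) →ₗ[ℝ] (E d → ℝ) where
  toFun P x := ∑ i, (M.elem i).indicator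
    (fun y => MvPolynomial.eval (fun k => M.S i y k) (P i : MvPolynomial (Fin d) ℝ)) x
  map_add' P Q := by
    ext x
    simp only [Pi.add_apply, Submodule.coe_add, map_add, ← Finset.sum_add_distrib]
    refine Finset.sum_congr rfl fun i _ => ?_
    by_cases hx : x ∈ M.elem i <;> simp [hx]
  map_smul' c P := by
    ext x
    simp only [Pi.smul_apply, Submodule.coe_smul, MvPolynomial.smul_eval, smul_eq_mul,
      RingHom.id_apply, Finset.mul_sum]
    refine Finset.sum_congr rfl fun i _ => ?_
    by_cases hx : x ∈ M.elem i <;> simp [hx]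

theorem ofLocal_apply (P : ∀ i, (M.shape i).polys d (M.p i)) (x : E d) :
    M.ofLocal P x = ∑ i, (M.elem i).indicator
      (fun y => MvPolynomial.eval (fun k => M.S i y k) (P i : MvPolynomial (Fin d) ℝ)) x :=
  rfl

theorem ofLocal_T (P : ∀ i, (M.shape i).polys d (M.p i)) (i : Fin M.n) {x : E d}
    (hx : x ∈ M.ref i) :
    M.ofLocal P (M.T i x) =
      MvPolynomial.eval (fun k => x k) (P i : MvPolynomial (Fin d) ℝ) := by
  have hi : M.T i x ∈ M.elem i := ⟨x, hx, rfl⟩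
  rw [ofLocal_apply, Finset.sum_eq_single i]
  · simp [hi, M.S_T i hx]
  · intro j _ hj
    exact indicator_of_notMem (fun h => disjoint_left.1 (disjoint_elem' hj) h hi) _
  · simp

theorem range_ofLocal : (LinearMap.range M.ofLocal : Set (E d → ℝ)) = M.V := by
  ext v
  constructor
  · rintro ⟨P, rfl⟩
    refine ⟨fun i => ⟨P i, (P i).2, fun x hx => ofLocal_T P i hx⟩, fun x hx => ?_⟩
    rw [ofLocal_apply]
    exact Finset.sum_eq_zero fun i _ =>
      indicator_of_notMem (fun h => hx (mem_iUnion.2 ⟨i, h⟩)) _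
  · rintro ⟨h, h0⟩
    choose P hP hPv using h
    refine ⟨fun i => ⟨P i, hP i⟩, ?_⟩
    ext x
    by_cases hx : x ∈ ⋃ i, M.elem i
    · obtain ⟨i, y, hy, rfl⟩ := mem_iUnion.1 hx
      rw [ofLocal_T _ i hy, hPv i y hy]
    · rw [h0 x hx, ofLocal_apply]
      exact Finset.sum_eq_zero fun i _ =>
        indicator_of_notMem (fun h => hx (mem_iUnion.2 ⟨i, h⟩)) _

instance (σ : RefShape) (k : ℕ) : Module.Finite ℝ (σ.polys d k) := by
  cases σ with
  | simplex => exact inferInstanceAs (Module.Finite ℝ (MvPolynomial.restrictTotalDegree (Fin d) ℝ k))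
  | cube => exact inferInstanceAs (Module.Finite ℝ (MvPolynomial.restrictDegree (Fin d) ℝ k))

/-- The finite element space is finite-dimensional. -/
theorem exists_parametrization (M : HpMesh Ω) :
    ∃ (m : ℕ) (Φ : EuclideanSpace ℝ (Fin m) →ₗ[ℝ] (E d → ℝ)),
      Function.Injective Φ ∧ range Φ = M.V := by
  let W := LinearMap.range M.ofLocal
  have : FiniteDimensional ℝ W := inferInstance
  let e : EuclideanSpace ℝ (Fin (Module.finrank ℝ W)) ≃ₗ[ℝ] W :=
    LinearEquiv.ofFinrankEq _ _ (by simp)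
  refine ⟨Module.finrank ℝ W, W.subtype.comp e.toLinearMap,
    W.injective_subtype.comp e.injective, ?_⟩
  rw [← range_ofLocal]
  ext v
  constructor
  · rintro ⟨w, rfl⟩
    exact (e w).2
  · intro hv
    exact ⟨e.symm ⟨v, hv⟩, by simp⟩

/-! ### Definiteness -/

theorem exists_const_of_gradient_eq_zero (hd : 2 ≤ d) {v : E d → ℝ} (hv : v ∈ M.V) (i : Fin M.n)
    (h : ∀ x ∈ M.elem i, gradient v x = 0) : ∃ c, ∀ x ∈ M.elem i, v x = c := by
  refine (M.isOpen_elem' i).exists_is_const_of_fderiv_eq_zero (M.isPreconnected_elem i hd)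
    (fun x hx => (differentiableAt_of_mem_V i hv hx).differentiableWithinAt) fun x hx => ?_
  have := congrArg (InnerProductSpace.toDual ℝ (E d)) (h x hx)
  rwa [toDual_gradient, map_zero] at this

/-- The gradient is continuous in the open element, so vanishing almost everywhere means vanishing
everywhere. -/
theorem gradient_eq_zero_of_ae (hM : M.Admissible β₁ β₂ β₃) (hd : 2 ≤ d) {v : E d → ℝ}
    (hv : v ∈ M.V) (i : Fin M.n)
    (h : ∀ᵐ x ∂volume.restrict (M.elem i), gradient v x = 0) :
    ∀ x ∈ M.elem i, gradient v x = 0 := by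
  refine Measure.eqOn_open_of_ae_eq (g := fun _ => 0) h (M.isOpen_elem' i) ?_ continuousOn_const
  exact ((continuousOn_trGrad i hM hd hv).mono subset_closure).congr fun x hx =>
    (trGrad_eq_of_mem i hM hd hv hx).symm

theorem trGrad_eq_zero (i : Fin M.n) {v : E d → ℝ} (h : ∀ x ∈ M.elem i, gradient v x = 0)
    {x : E d} (hx : x ∈ closure (M.elem i)) : M.trGrad i v x = 0 := by
  refine extendFrom_eq hx (tendsto_const_nhds.congr' ?_)
  filter_upwards [self_mem_nhdsWithin] with y hy using (h y hy).symm

theorem tr_eq_const (i : Fin M.n) {v : E d → ℝ} {c : ℝ} (h : ∀ x ∈ M.elem i, v x = c)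
    {x : E d} (hx : x ∈ closure (M.elem i)) : M.tr i v x = c := by
  refine extendFrom_eq hx (tendsto_const_nhds.congr' ?_)
  filter_upwards [self_mem_nhdsWithin] with y hy using (h y hy).symm

/-- Almost everywhere statements on a set of positive measure hold together at some actual point,
where jumps can be evaluated with genuine normals instead of the default 0. -/
theorem exists_isOutwardNormal_of_ae (hM : M.Admissible β₁ β₂ β₃) (hd : 2 ≤ d) {s : Set (E d)}
    (hs : MeasurableSet s) (hpos : 0 < surf d s) {P : E d → Prop}
    (hP : ∀ᵐ x ∂(surf d).restrict s, P x) {I : Set (Fin M.n)}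
    (hI : ∀ i ∈ I, s ⊆ frontier (M.elem i)) :
    ∃ x ∈ s, P x ∧ ∀ i ∈ I, ∃ ν, IsOutwardNormal (M.elem i) x ν := by
  have h1 : ∀ᵐ x ∂(surf d).restrict s, ∀ i ∈ I, ∃ ν, IsOutwardNormal (M.elem i) x ν := by
    rw [ae_all_iff]
    intro i
    by_cases hi : i ∈ I
    · rw [ae_restrict_iff' hs]
      have := surf_not_exists_isOutwardNormal i hM hd
      rw [← compl_mem_ae_iff] at this
      filter_upwards [this] with x hx hxs _
      by_contra hcon
      exact hx ⟨hI i hi hxs, hcon⟩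
    · exact Eventually.of_forall fun x h => absurd h hi
  have : NeBot (ae ((surf d).restrict s)) := by
    rw [ae_neBot, Ne, Measure.restrict_eq_zero]
    exact hpos.ne'
  obtain ⟨x, ⟨hxP, hxI⟩, hxs⟩ := ((hP.and h1).and (ae_restrict_mem hs)).exists
  exact ⟨x, hxs, hxP, hxI⟩

/-- A finite element function with vanishing gradients and jumps vanishes. -/
theorem eq_zero_of_gradient_of_jump (hM : M.Admissible β₁ β₂ β₃) (hd : 2 ≤ d) (hΩ : IsOpen Ω)
    (hconn : IsPreconnected Ω) {ΓD : Set (E d)} (hΓD : ΓD ⊆ frontier Ω)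
    (hΓDm : MeasurableSet ΓD) (hpos : 0 < surf d ΓD) {v : E d → ℝ} (hv : v ∈ M.V)
    (hgrad : ∀ i, ∀ x ∈ M.elem i, gradient v x = 0)
    (hjump : ∀ q ∈ M.intFaces, ∀ᵐ x ∂(surf d).restrict (M.iface q.1 q.2), M.jump q v x = 0)
    (htr : ∀ i ∈ M.bdryFaces ΓD, ∀ᵐ x ∂(surf d).restrict (M.bface ΓD i),
      M.tr i v x • M.nrm i x = 0) : v = 0 := by
  choose c hc using fun i => exists_const_of_gradient_eq_zero hd hv i (hgrad i)
  have hadj : ∀ i j, i < j → 0 < surf d (M.iface i j) → c i = c j := by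
    intro i j hij hpos
    have hq : (i, j) ∈ M.intFaces := by simp [intFaces, hij, hpos]
    have hj : ∀ᵐ x ∂(surf d).restrict (M.iface i j), M.jump (i, j) v x = 0 := hjump (i, j) hq
    obtain ⟨x, hx, hx0, hν⟩ := exists_isOutwardNormal_of_ae hM hd (measurableSet_iface i j) hpos
      hj (I := {i, j}) (by
        intro k hk
        rcases mem_insert_iff.1 hk with hk | hk
        · rw [hk]; exact inter_subset_left
        · rw [mem_singleton_iff.1 hk]; exact inter_subset_right)
    obtain ⟨ν, hν1⟩ := hν i (mem_insert _ _)
    obtain ⟨ν', hν2⟩ := hν j (mem_insert_of_mem _ rfl)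
    -- With opposite normals the jump is the difference of the two constants times ν.
    have hneg := hν1.eq_neg_of_disjoint (disjoint_elem' hij.ne) hν2
    simp only [jump, nrm, normal_eq hν1, normal_eq hν2, hneg, smul_neg, ← sub_eq_add_neg,
      ← sub_smul, tr_eq_const i (hc i) (iface_subset_left i j hx),
      tr_eq_const j (hc j) (iface_subset_right i j hx)] at hx0
    have hν0 : ν ≠ 0 := fun h => by simpa [h] using hν1.1
    exact sub_eq_zero.1 ((smul_eq_zero.1 hx0).resolve_right hν0)
  -- A point of ∂Ω lies in the closure of some element but not in the element, so finitely many
  -- boundary pieces cover Γ_D and one of them has positive measure.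
  obtain ⟨i₀, hi₀⟩ : ∃ i, 0 < surf d (M.bface ΓD i) := by
    by_contra! hcon
    refine hpos.ne' (measure_mono_null (t := ⋃ i, M.bface ΓD i) ?_
      (measure_iUnion_null fun i => le_antisymm (hcon i) bot_le))
    intro x hx
    have hxΩ := hΓD hx
    rw [hΩ.frontier_eq, M.closure_eq] at hxΩ
    obtain ⟨i, hi⟩ := mem_iUnion.1 hxΩ.1
    refine mem_iUnion.2 ⟨i, ?_, hx⟩
    rw [(M.isOpen_elem' i).frontier_eq]
    exact ⟨hi, fun h => hxΩ.2 (M.elem_subset i h)⟩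
  have hci₀ : c i₀ = 0 := by
    have hmem : i₀ ∈ M.bdryFaces ΓD := by simp [bdryFaces, hi₀]
    have htr₀ := htr i₀ hmem
    obtain ⟨x, hx, hx0, hν⟩ := exists_isOutwardNormal_of_ae hM hd (measurableSet_bface hΓDm i₀) hi₀
      htr₀ (I := {i₀}) (by
        intro k hk
        rw [mem_singleton_iff.1 hk]; exact inter_subset_left)
    obtain ⟨ν, hν1⟩ := hν i₀ rfl
    simp only [nrm, normal_eq hν1, tr_eq_const i₀ (hc i₀) (bface_subset ΓD i₀ hx)] at hx0
    have hν0 : ν ≠ 0 := fun h => by simpa [h] using hν1.1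
    exact (smul_eq_zero.1 hx0).resolve_right hν0
  have hall : ∀ j, c j = 0 := by
    by_contra! hcon
    obtain ⟨j₀, hj₀⟩ := hcon
    -- Otherwise the elements with constant 0 and the remaining ones would have no common face.
    obtain ⟨i, hi, j, hj, hij⟩ := exists_adjacent hΩ hconn M.isOpen_elem' 
      (fun i => M.elem_nonempty i hd) M.elem_subset (fun i j h => disjoint_elem' h) M.closure_eq
      (I := {i | c i = 0}) hci₀ hj₀
    have hne : i ≠ j := fun h => hj (h ▸ hi)
    have hcij : c i = c j := by
      rcases lt_or_gt_of_ne hne with h | h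
      · exact hadj i j h hij
      · exact (hadj j i h (by rw [iface, inter_comm]; exact hij)).symm
    exact hj (hcij.symm.trans hi)
  ext x
  by_cases hx : x ∈ ⋃ i, M.elem i
  · obtain ⟨i, hi⟩ := mem_iUnion.1 hx
    rw [hc i x hi, hall i]; rfl
  · exact hv.2 x hx

/-- The finite element space contains functions that are not piecewise constant. -/
theorem exists_gradient_ne_zero (hd : 2 ≤ d) (i : Fin M.n) :
    ∃ v ∈ M.V, ∃ x ∈ M.elem i, gradient v x ≠ 0 := by
  let k₀ : Fin d := ⟨0, by omega⟩
  have hX : (MvPolynomial.X k₀ : MvPolynomial (Fin d) ℝ) ∈ (M.shape i).polys d (M.p i) := by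
    have h1 : (MvPolynomial.X k₀ : MvPolynomial (Fin d) ℝ) ∈
        MvPolynomial.restrictTotalDegree (Fin d) ℝ (M.p i) := by
      rw [MvPolynomial.mem_restrictTotalDegree, MvPolynomial.totalDegree_X]
      exact M.one_le_p i
    cases M.shape i with
    | simplex => exact h1
    | cube => exact MvPolynomial.restrictTotalDegree_le_restrictDegree _ _ _ h1
  -- A reference coordinate on one element and zero on all others; it has degree one, which p_K ≥ 1
  -- allows.
  let P : ∀ j, (M.shape j).polys d (M.p j) := Pi.single i ⟨_, hX⟩
  have hv : M.ofLocal P ∈ M.V := by rw [← range_ofLocal]; exact ⟨P, rfl⟩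
  have hval : ∀ x ∈ M.ref i, M.ofLocal P (M.T i x) = x k₀ := by
    intro x hx
    rw [ofLocal_T P i hx]
    simp [P]
  refine ⟨_, hv, ?_⟩
  by_contra! hcon
  obtain ⟨c, hc⟩ := exists_const_of_gradient_eq_zero hd hv i hcon
  obtain ⟨x, hx⟩ := M.ref_nonempty i hd
  have hconst : ∀ y ∈ M.ref i, y k₀ = c := fun y hy => by
    rw [← hval y hy]; exact hc _ ⟨y, hy, rfl⟩
  have h1 : Tendsto (fun t : ℝ => x + t • EuclideanSpace.single k₀ (1 : ℝ)) (𝓝[≠] 0)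
      (𝓝 (x + (0 : ℝ) • EuclideanSpace.single k₀ (1 : ℝ))) :=
    (Continuous.tendsto (by fun_prop) _).mono_left nhdsWithin_le_nhds
  rw [zero_smul, add_zero] at h1
  obtain ⟨t, ht, ht0⟩ := ((h1.eventually_mem ((M.isOpen_ref i hd).mem_nhds hx)).and
    self_mem_nhdsWithin).exists
  have h2 := hconst _ ht
  have h3 := hconst _ hx
  simp [h3] at h2
  exact ht0 h2

end HpMesh

end

/-! ### Quadratic functionals and inverse-trace constants -/

section

variable {d : ℕ}

/-- Continuous nonnegative functionals that are homogeneous of degree two. -/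
structure IsQuad {X : Type*} [NormedAddCommGroup X] [InnerProductSpace ℝ X] (Q : X → ℝ) :
    Prop where
  cont : Continuous Q
  smul : ∀ (t : ℝ) w, Q (t • w) = t ^ 2 * Q w
  nonneg : ∀ w, 0 ≤ Q w
  bound : ∃ K, ∀ w, Q w ≤ K * ‖w‖ ^ 2

namespace IsQuad

variable {X : Type*} [NormedAddCommGroup X] [InnerProductSpace ℝ X] {Q R : X → ℝ}

theorem add (hQ : IsQuad Q) (hR : IsQuad R) : IsQuad fun w => Q w + R w where
  cont := hQ.cont.add hR.cont
  smul t w := by rw [hQ.smul, hR.smul, mul_add]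
  nonneg w := add_nonneg (hQ.nonneg w) (hR.nonneg w)
  bound := by
    obtain ⟨K, hK⟩ := hQ.bound
    obtain ⟨K', hK'⟩ := hR.bound
    exact ⟨K + K', fun w => by rw [add_mul]; exact add_le_add (hK w) (hK' w)⟩

theorem const_mul (hQ : IsQuad Q) {c : ℝ} (hc : 0 ≤ c) : IsQuad fun w => c * Q w where
  cont := hQ.cont.const_mul c
  smul t w := by rw [hQ.smul]; ring
  nonneg w := mul_nonneg hc (hQ.nonneg w)
  bound := by
    obtain ⟨K, hK⟩ := hQ.bound
    exact ⟨c * K, fun w => by rw [mul_assoc]; exact mul_le_mul_of_nonneg_left (hK w) hc⟩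

theorem sum {κ : Type*} (s : Finset κ) {Q : κ → X → ℝ} (hQ : ∀ k ∈ s, IsQuad (Q k)) :
    IsQuad fun w => ∑ k ∈ s, Q k w := by
  classical
  induction s using Finset.induction_on with
  | empty => exact ⟨by simpa using continuous_const, by simp, by simp, 0, by simp⟩
  | insert k s hk ih =>
    simp only [Finset.sum_insert hk]
    exact (hQ k (Finset.mem_insert_self _ _)).add
      (ih fun j hj => hQ j (Finset.mem_insert_of_mem hj))

end IsQuad

theorem IsBddField.isQuad {X F : Type*} [NormedAddCommGroup X] [InnerProductSpace ℝ X]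
    [FiniteDimensional ℝ X] [NormedAddCommGroup F] [InnerProductSpace ℝ F] {ν : Measure (E d)}
    {s : Set (E d)} {g : X → E d → F} (hg : IsBddField ν s g) :
    IsQuad fun w => ∫ x in s, ‖g w x‖ ^ 2 ∂ν where
  cont := hg.continuous_integral_norm_sq
  smul := hg.integral_norm_sq_smul
  nonneg w := integral_nonneg fun x => by positivity
  bound := by
    obtain ⟨K, -, hK⟩ := hg.exists_integral_norm_sq_le
    exact ⟨K, hK⟩

namespace HpMesh

variable {Ω : Set (E d)} {M : HpMesh Ω} {β₁ β₂ β₃ : ℝ}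

/-! ### Positivity of the face parameters -/

theorem muI_pos (hM : M.Admissible β₁ β₂ β₃) (hd : 2 ≤ d) {q : Fin M.n × Fin M.n}
    (hq : q ∈ M.intFaces) : 0 < M.muI q := by
  have h1 := volume_real_elem_pos (M := M) hd q.1
  have h2 := volume_real_elem_pos (M := M) hd q.2
  have h3 : 0 < (surf d).real (M.iface q.1 q.2) := by
    simp only [intFaces, Finset.mem_filter] at hq
    exact ENNReal.toReal_pos hq.2.2.ne' (surf_iface_lt_top hM hd _ _).ne
  rw [muI]
  positivity

theorem muB_pos (hM : M.Admissible β₁ β₂ β₃) (hd : 2 ≤ d) {Γ : Set (E d)} {i : Fin M.n}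
    (hi : i ∈ M.bdryFaces Γ) : 0 < M.muB Γ i := by
  have h1 := volume_real_elem_pos (M := M) hd i
  have h3 : 0 < (surf d).real (M.bface Γ i) := by
    simp only [bdryFaces, Finset.mem_filter] at hi
    exact ENNReal.toReal_pos hi.2.ne' (surf_bface_lt_top hM hd _ _).ne
  rw [muB]
  positivity

theorem p_pos (i : Fin M.n) : 0 < (M.p i : ℝ) := by exact_mod_cast M.one_le_p i

theorem pI_pos (q : Fin M.n × Fin M.n) : 0 < M.pI q := by
  have h1 := p_pos (M := M) q.1
  have h2 := p_pos (M := M) q.2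
  rw [pI]
  positivity

theorem sigmaI_inv (α : ℝ) (q : Fin M.n × Fin M.n) :
    (M.sigmaI α q)⁻¹ = α⁻¹ * (M.muI q / M.pI q ^ 2) := by
  rw [sigmaI, inv_div, div_mul_eq_div_div_swap, div_eq_inv_mul]

theorem sigmaB_inv (α : ℝ) (Γ : Set (E d)) (i : Fin M.n) :
    (M.sigmaB α Γ i)⁻¹ = α⁻¹ * (M.muB Γ i / (M.p i : ℝ) ^ 2) := by
  rw [sigmaB, inv_div, div_mul_eq_div_div_swap, div_eq_inv_mul]

theorem sigmaI_pos (hM : M.Admissible β₁ β₂ β₃) (hd : 2 ≤ d) {α : ℝ} (hα : 0 < α)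
    {q : Fin M.n × Fin M.n} (hq : q ∈ M.intFaces) : 0 < M.sigmaI α q := by
  have h1 := muI_pos hM hd hq
  have h2 := pI_pos q
  rw [sigmaI]
  positivity

theorem sigmaB_pos (hM : M.Admissible β₁ β₂ β₃) (hd : 2 ≤ d) {α : ℝ} (hα : 0 < α)
    {Γ : Set (E d)} {i : Fin M.n} (hi : i ∈ M.bdryFaces Γ) : 0 < M.sigmaB α Γ i := by
  have h1 := muB_pos hM hd hi
  have h2 := p_pos i
  rw [sigmaB]
  positivity

/-! ### Inverse-trace constants -/

/-- The weighted sum of the squared traces of the gradient on all faces. -/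
def traceSum (M : HpMesh Ω) (ΓD ΓN : Set (E d)) (v : E d → ℝ) : ℝ :=
  (∑ q ∈ M.intFaces, M.muI q / M.pI q ^ 2 *
        ∫ x in M.iface q.1 q.2, M.avg q (fun i => ‖M.trGrad i v x‖) ^ 2 ∂(surf d)) +
    (∑ i ∈ M.bdryFaces ΓD, M.muB ΓD i / (M.p i : ℝ) ^ 2 *
        ∫ x in M.bface ΓD i, ‖M.trGrad i v x‖ ^ 2 ∂(surf d)) +
    (∑ i ∈ M.bdryFaces ΓN, M.muB ΓN i / (M.p i : ℝ) ^ 2 *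
        ∫ x in M.bface ΓN i, ‖M.trGrad i v x‖ ^ 2 ∂(surf d))

section Param

variable {X : Type*} [NormedAddCommGroup X] [InnerProductSpace ℝ X] {Φ : X →ₗ[ℝ] (E d → ℝ)}

theorem integrable_avg_sq (hΦ : ∀ w, Φ w ∈ M.V) (hM : M.Admissible β₁ β₂ β₃) (hd : 2 ≤ d)
    (q : Fin M.n × Fin M.n) (w : X) :
    Integrable (fun x => M.avg q (fun i => ‖M.trGrad i (Φ w) x‖) ^ 2)
      ((surf d).restrict (M.iface q.1 q.2)) := by
  have hg1 := isBddField_trGrad_left hΦ hM hd q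
  have hg2 := isBddField_trGrad_right hΦ hM hd q
  obtain ⟨C1, hC1⟩ := hg1.bdd w
  obtain ⟨C2, hC2⟩ := hg2.bdd w
  have := hg1.isFiniteMeasure
  refine Integrable.of_bound
    ((((hg1.aesm w).norm.add (hg2.aesm w).norm).const_smul (1 / 2 : ℝ)).pow 2)
    ((1 / 2 * (C1 + C2)) ^ 2) ?_
  filter_upwards [hg1.ae_mem] with x hx
  simp only [avg, smul_eq_mul]
  rw [Real.norm_of_nonneg (by positivity)]
  have := hC1 x hx
  have := hC2 x hx
  gcongr

/-- For nonnegative numbers (a² + b²)/2 ≤ 2((a + b)/2)². The two-sided estimates produce means of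
squares, while the inverse-trace inequality controls squares of means; this is the source of the
factor 2 in α₀. -/
theorem half_le_two_mul_integral_avg_sq (hΦ : ∀ w, Φ w ∈ M.V) (hM : M.Admissible β₁ β₂ β₃)
    (hd : 2 ≤ d) (q : Fin M.n × Fin M.n) (w : X) :
    1 / 2 * ((∫ x in M.iface q.1 q.2, ‖M.trGrad q.1 (Φ w) x‖ ^ 2 ∂(surf d)) +
      ∫ x in M.iface q.1 q.2, ‖M.trGrad q.2 (Φ w) x‖ ^ 2 ∂(surf d)) ≤
    2 * ∫ x in M.iface q.1 q.2, M.avg q (fun i => ‖M.trGrad i (Φ w) x‖) ^ 2 ∂(surf d) := by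
  have h1 := (isBddField_trGrad_left hΦ hM hd q).integrable_norm_sq w
  have h2 := (isBddField_trGrad_right hΦ hM hd q).integrable_norm_sq w
  rw [← integral_add h1 h2, ← integral_const_mul, ← integral_const_mul]
  refine integral_mono ((h1.add h2).const_mul _) ((integrable_avg_sq hΦ hM hd q w).const_mul _)
    fun x => ?_
  simp only [avg, smul_eq_mul]
  nlinarith [mul_nonneg (norm_nonneg (M.trGrad q.1 (Φ w) x)) (norm_nonneg (M.trGrad q.2 (Φ w) x))]

theorem integral_avg_sq_le_half (hΦ : ∀ w, Φ w ∈ M.V) (hM : M.Admissible β₁ β₂ β₃)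
    (hd : 2 ≤ d) (q : Fin M.n × Fin M.n) (w : X) :
    ∫ x in M.iface q.1 q.2, M.avg q (fun i => ‖M.trGrad i (Φ w) x‖) ^ 2 ∂(surf d) ≤
    1 / 2 * ((∫ x in M.iface q.1 q.2, ‖M.trGrad q.1 (Φ w) x‖ ^ 2 ∂(surf d)) +
      ∫ x in M.iface q.1 q.2, ‖M.trGrad q.2 (Φ w) x‖ ^ 2 ∂(surf d)) := by
  have h1 := (isBddField_trGrad_left hΦ hM hd q).integrable_norm_sq w
  have h2 := (isBddField_trGrad_right hΦ hM hd q).integrable_norm_sq w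
  rw [← integral_add h1 h2, ← integral_const_mul]
  refine integral_mono (integrable_avg_sq hΦ hM hd q w) ((h1.add h2).const_mul _) fun x => ?_
  simp only [avg, smul_eq_mul]
  nlinarith [sq_nonneg (‖M.trGrad q.1 (Φ w) x‖ - ‖M.trGrad q.2 (Φ w) x‖)]

variable [FiniteDimensional ℝ X]

theorem isQuad_gradient (hΦ : ∀ w, Φ w ∈ M.V) (hM : M.Admissible β₁ β₂ β₃) (hd : 2 ≤ d) :
    IsQuad fun w => ∑ i, ∫ x in M.elem i, ‖gradient (Φ w) x‖ ^ 2 :=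
  IsQuad.sum _ fun i _ => (isBddField_gradient hΦ i hM hd).isQuad

theorem gradient_eq_zero_of_sum_eq_zero (hΦ : ∀ w, Φ w ∈ M.V) (hM : M.Admissible β₁ β₂ β₃)
    (hd : 2 ≤ d) {w : X} (h : ∑ i, ∫ x in M.elem i, ‖gradient (Φ w) x‖ ^ 2 = 0) (i : Fin M.n) :
    ∀ x ∈ M.elem i, gradient (Φ w) x = 0 := by
  have h1 := (Finset.sum_eq_zero_iff_of_nonneg fun i _ =>
    (isBddField_gradient hΦ i hM hd).isQuad.nonneg w).1 h i (Finset.mem_univ i)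
  exact gradient_eq_zero_of_ae hM hd (hΦ w) i
    ((isBddField_gradient hΦ i hM hd).ae_eq_zero_of_integral_norm_sq h1)

/-- The element energy vanishes only for piecewise constant functions, which contribute nothing to
gradient traces, so `exists_le_mul_of_ker_le` applies. -/
theorem exists_traceSum_le (hΦ : ∀ w, Φ w ∈ M.V) (hM : M.Admissible β₁ β₂ β₃) (hd : 2 ≤ d)
    {ΓD ΓN : Set (E d)} (hΓD : MeasurableSet ΓD) (hΓN : MeasurableSet ΓN) :
    ∃ C, ∀ w, M.traceSum ΓD ΓN (Φ w) ≤ C * ∑ i, ∫ x in M.elem i, ‖gradient (Φ w) x‖ ^ 2 := by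
  have hQ := isQuad_gradient hΦ hM hd
  let Z : Submodule ℝ X :=
    { carrier := {w | ∀ i, ∀ x ∈ M.elem i, gradient (Φ w) x = 0}
      add_mem' := fun {a b} ha hb i x hx => by
        rw [(isBddField_gradient hΦ i hM hd).add a b x hx, ha i x hx, hb i x hx, add_zero]
      zero_mem' := fun i x hx => by
        have := (isBddField_gradient hΦ i hM hd).smul 0 0 x hx
        rwa [zero_smul, zero_smul] at this
      smul_mem' := fun c a ha i x hx => by
        rw [(isBddField_gradient hΦ i hM hd).smul c a x hx, ha i x hx, smul_zero] }
  have htr : ∀ z ∈ Z, ∀ w i, ∀ x ∈ closure (M.elem i),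
      M.trGrad i (Φ (z + w)) x = M.trGrad i (Φ w) x := by
    intro z hz w i x hx
    rw [map_add, trGrad_add i hM hd (hΦ z) (hΦ w) hx, trGrad_eq_zero i (hz i) hx, zero_add]
  have hbdry : ∀ {Γ : Set (E d)}, MeasurableSet Γ → IsQuad fun w => ∑ i ∈ M.bdryFaces Γ,
      M.muB Γ i / (M.p i : ℝ) ^ 2 * ∫ x in M.bface Γ i, ‖M.trGrad i (Φ w) x‖ ^ 2 ∂(surf d) := by
    intro Γ hΓ
    refine IsQuad.sum _ fun i hi =>
      (isBddField_trGrad_bface hΦ hM hd hΓ i).isQuad.const_mul ?_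
    have := muB_pos hM hd hi
    positivity
  -- Squares of means are dominated by means of squares, which supplies the quadratic upper bound.
  have hint : IsQuad fun w => ∑ q ∈ M.intFaces, M.muI q / M.pI q ^ 2 *
      (1 / 2 * ((∫ x in M.iface q.1 q.2, ‖M.trGrad q.1 (Φ w) x‖ ^ 2 ∂(surf d)) +
        ∫ x in M.iface q.1 q.2, ‖M.trGrad q.2 (Φ w) x‖ ^ 2 ∂(surf d))) := by
    refine IsQuad.sum _ fun q hq => (((isBddField_trGrad_left hΦ hM hd q).isQuad.add
      (isBddField_trGrad_right hΦ hM hd q).isQuad).const_mul (by norm_num)).const_mul ?_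
    have := muI_pos hM hd hq
    positivity
  obtain ⟨K, hK⟩ := ((hint.add (hbdry hΓD)).add (hbdry hΓN)).bound
  refine exists_le_mul_of_ker_le (Q₁ := fun w => M.traceSum ΓD ΓN (Φ w)) Z hQ.cont hQ.smul
    hQ.nonneg (fun w hw i => gradient_eq_zero_of_sum_eq_zero hΦ hM hd hw i) (fun z hz w => ?_)
    (fun z hz w => ?_) (K := K) (fun w => ?_)
  · have hb : ∀ {Γ : Set (E d)}, MeasurableSet Γ → ∀ i,
        ∫ x in M.bface Γ i, ‖M.trGrad i (Φ (z + w)) x‖ ^ 2 ∂(surf d) =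
        ∫ x in M.bface Γ i, ‖M.trGrad i (Φ w) x‖ ^ 2 ∂(surf d) := fun hΓ i =>
      setIntegral_congr_fun (measurableSet_bface hΓ i) fun x hx => by
        simp only [htr z hz w i x (bface_subset _ i hx)]
    have hi : ∀ q : Fin M.n × Fin M.n,
        ∫ x in M.iface q.1 q.2, M.avg q (fun i => ‖M.trGrad i (Φ (z + w)) x‖) ^ 2 ∂(surf d) =
        ∫ x in M.iface q.1 q.2, M.avg q (fun i => ‖M.trGrad i (Φ w) x‖) ^ 2 ∂(surf d) := fun q =>
      setIntegral_congr_fun (measurableSet_iface _ _) fun x hx => by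
        simp only [avg, htr z hz w q.1 x (iface_subset_left _ _ hx),
          htr z hz w q.2 x (iface_subset_right _ _ hx)]
    simp only [traceSum, hb hΓD, hb hΓN, hi]
  · refine Finset.sum_congr rfl fun i _ => ?_
    refine setIntegral_congr_fun (M.isOpen_elem' i).measurableSet fun x hx => ?_
    simp only [(isBddField_gradient hΦ i hM hd).add z w x hx, hz i x hx, zero_add]
  · refine le_trans ?_ (hK w)
    simp only [traceSum]
    gcongr with q hq
    · have := muI_pos hM hd hq
      positivity
    · exact integral_avg_sq_le_half hΦ hM hd q w

omit [FiniteDimensional ℝ X] in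
theorem weighted_le_traceSum (hM : M.Admissible β₁ β₂ β₃) (hd : 2 ≤ d) (ΓD ΓN : Set (E d))
    (v : E d → ℝ) :
    (∑ q ∈ M.intFaces, M.muI q / M.pI q ^ 2 *
        ∫ x in M.iface q.1 q.2, M.avg q (fun i => ‖M.trGrad i v x‖) ^ 2 ∂(surf d)) +
    (∑ i ∈ M.bdryFaces ΓD, M.muB ΓD i / (M.p i : ℝ) ^ 2 *
        ∫ x in M.bface ΓD i, ‖M.trGrad i v x‖ ^ 2 ∂(surf d)) ≤ M.traceSum ΓD ΓN v := by
  rw [traceSum]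
  refine le_add_of_nonneg_right (Finset.sum_nonneg fun i hi => mul_nonneg ?_
    (integral_nonneg fun x => by positivity))
  have := muB_pos hM hd hi
  positivity

/-- Some function has positive element energy while its trace sum is nonnegative. This sign makes
the penalty threshold nonnegative, so α > 0. -/
theorem invTraceConst_nonneg (hΦ : range Φ = M.V) (hM : M.Admissible β₁ β₂ β₃) (hd : 2 ≤ d)
    (hne : Nonempty (Fin M.n)) {ΓD ΓN : Set (E d)} {C : ℝ} (hC : M.IsInvTraceConst ΓD ΓN C) :
    0 ≤ C := by
  obtain ⟨i⟩ := hne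
  have hΦ' : ∀ w, Φ w ∈ M.V := fun w => hΦ ▸ mem_range_self w
  obtain ⟨v, hv, x, hx, hne⟩ := exists_gradient_ne_zero (M := M) hd i
  have hv' := hv
  rw [← hΦ] at hv'
  obtain ⟨w, rfl⟩ := hv'
  have hpos : 0 < ∑ i, ∫ x in M.elem i, ‖gradient (Φ w) x‖ ^ 2 :=
    lt_of_le_of_ne ((isQuad_gradient hΦ' hM hd).nonneg w) fun h =>
      hne (gradient_eq_zero_of_sum_eq_zero hΦ' hM hd h.symm i x hx)
  have h1 := hC _ hv
  have h2 : 0 ≤ M.traceSum ΓD ΓN (Φ w) := by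
    refine le_trans ?_ (weighted_le_traceSum hM hd ΓD ΓN (Φ w))
    refine add_nonneg (Finset.sum_nonneg fun q hq => mul_nonneg ?_
      (integral_nonneg fun x => by positivity)) (Finset.sum_nonneg fun i hi => mul_nonneg ?_
      (integral_nonneg fun x => by positivity))
    · have := muI_pos hM hd hq
      positivity
    · have := muB_pos hM hd hi
      positivity
  exact nonneg_of_mul_nonneg_left (h2.trans h1) hpos

end Param

end HpMesh

end

/-! ### Lipschitz continuity, strong monotonicity and definite energy of the discrete form -/

section

variable {d : ℕ}

namespace HpMesh

variable {Ω : Set (E d)} {M : HpMesh Ω} {β₁ β₂ β₃ : ℝ} {X : Type*} [NormedAddCommGroup X]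
  [InnerProductSpace ℝ X] {Φ : X →ₗ[ℝ] (E d → ℝ)}

/-! ### The energy of the discrete problem -/

/-- The squares of `∇v - σ⟦v⟧` on all interior and Dirichlet faces, weighted by `σ⁻¹`. -/
def faceEnergy (M : HpMesh Ω) (α : ℝ) (ΓD : Set (E d)) (v : E d → ℝ) : ℝ :=
  (∑ q ∈ M.intFaces, (M.sigmaI α q)⁻¹ * (1 / 2 *
    ((∫ x in M.iface q.1 q.2, ‖M.trGrad q.1 v x - M.sigmaI α q • M.jump q v x‖ ^ 2 ∂(surf d)) +
      ∫ x in M.iface q.1 q.2, ‖M.trGrad q.2 v x - M.sigmaI α q • M.jump q v x‖ ^ 2 ∂(surf d)))) +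
  ∑ i ∈ M.bdryFaces ΓD, (M.sigmaB α ΓD i)⁻¹ *
    ∫ x in M.bface ΓD i, ‖M.trGrad i v x - M.sigmaB α ΓD i • (M.tr i v x • M.nrm i x)‖ ^ 2 ∂(surf d)

section Fields

variable (hΦ : ∀ w, Φ w ∈ M.V) (hM : M.Admissible β₁ β₂ β₃) (hd : 2 ≤ d)

include hΦ hM hd

theorem isBddField_left (α : ℝ) (q : Fin M.n × Fin M.n) :
    IsBddField (surf d) (M.iface q.1 q.2) fun w x =>
      M.trGrad q.1 (Φ w) x - M.sigmaI α q • M.jump q (Φ w) x :=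
  (isBddField_trGrad_left hΦ hM hd q).sub_smul_field (isBddField_jump hΦ hM hd q) _

theorem isBddField_right (α : ℝ) (q : Fin M.n × Fin M.n) :
    IsBddField (surf d) (M.iface q.1 q.2) fun w x =>
      M.trGrad q.2 (Φ w) x - M.sigmaI α q • M.jump q (Φ w) x :=
  (isBddField_trGrad_right hΦ hM hd q).sub_smul_field (isBddField_jump hΦ hM hd q) _

theorem isBddField_bdry (α : ℝ) {ΓD : Set (E d)} (hΓD : MeasurableSet ΓD) (i : Fin M.n) :
    IsBddField (surf d) (M.bface ΓD i) fun w x =>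
      M.trGrad i (Φ w) x - M.sigmaB α ΓD i • (M.tr i (Φ w) x • M.nrm i x) :=
  (isBddField_trGrad_bface hΦ hM hd hΓD i).sub_smul_field
    (isBddField_tr_smul_nrm_bface hΦ hM hd hΓD i) _

variable [FiniteDimensional ℝ X]

theorem isQuad_faceEnergy {α : ℝ} (hα : 0 < α) {ΓD : Set (E d)} (hΓD : MeasurableSet ΓD) :
    IsQuad fun w => M.faceEnergy α ΓD (Φ w) := by
  refine (IsQuad.sum _ fun q hq => (((isBddField_left hΦ hM hd α q).isQuad.add
    (isBddField_right hΦ hM hd α q).isQuad).const_mul (by norm_num)).const_mul ?_).add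
    (IsQuad.sum _ fun i hi => (isBddField_bdry hΦ hM hd α hΓD i).isQuad.const_mul ?_)
  · exact (inv_pos.2 (sigmaI_pos hM hd hα hq)).le
  · exact (inv_pos.2 (sigmaB_pos hM hd hα hi)).le

/-- The energy is definite on the finite element space. -/
theorem eq_zero_of_energy (hΩ : IsOpen Ω) (hconn : IsPreconnected Ω) {α : ℝ} (hα : 0 < α)
    {ΓD : Set (E d)} (hΓD : ΓD ⊆ frontier Ω) (hΓDm : MeasurableSet ΓD) (hpos : 0 < surf d ΓD)
    {w : X} (hgrad : ∑ i, ∫ x in M.elem i, ‖gradient (Φ w) x‖ ^ 2 = 0)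
    (hface : M.faceEnergy α ΓD (Φ w) = 0) : Φ w = 0 := by
  have hg := gradient_eq_zero_of_sum_eq_zero hΦ hM hd hgrad
  have hI : ∀ q ∈ M.intFaces, 0 ≤ (M.sigmaI α q)⁻¹ * (1 / 2 *
      ((∫ x in M.iface q.1 q.2,
          ‖M.trGrad q.1 (Φ w) x - M.sigmaI α q • M.jump q (Φ w) x‖ ^ 2 ∂(surf d)) +
        ∫ x in M.iface q.1 q.2,
          ‖M.trGrad q.2 (Φ w) x - M.sigmaI α q • M.jump q (Φ w) x‖ ^ 2 ∂(surf d))) := fun q hq =>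
    mul_nonneg (inv_pos.2 (sigmaI_pos hM hd hα hq)).le (mul_nonneg (by norm_num)
      (add_nonneg ((isBddField_left hΦ hM hd α q).isQuad.nonneg w)
        ((isBddField_right hΦ hM hd α q).isQuad.nonneg w)))
  have hB : ∀ i ∈ M.bdryFaces ΓD, 0 ≤ (M.sigmaB α ΓD i)⁻¹ * ∫ x in M.bface ΓD i,
      ‖M.trGrad i (Φ w) x - M.sigmaB α ΓD i • (M.tr i (Φ w) x • M.nrm i x)‖ ^ 2 ∂(surf d) :=
    fun i hi => mul_nonneg (inv_pos.2 (sigmaB_pos hM hd hα hi)).le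
      ((isBddField_bdry hΦ hM hd α hΓDm i).isQuad.nonneg w)
  rw [faceEnergy, add_eq_zero_iff_of_nonneg (Finset.sum_nonneg hI) (Finset.sum_nonneg hB),
    Finset.sum_eq_zero_iff_of_nonneg hI, Finset.sum_eq_zero_iff_of_nonneg hB] at hface
  refine eq_zero_of_gradient_of_jump hM hd hΩ hconn hΓD hΓDm hpos (hΦ w) hg (fun q hq => ?_)
    fun i hi => ?_
  · have hσ := sigmaI_pos hM hd hα hq
    have h1 := (mul_eq_zero.1 ((mul_eq_zero.1 (hface.1 q hq)).resolve_left
      (inv_pos.2 hσ).ne')).resolve_left (by norm_num)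
    rw [add_eq_zero_iff_of_nonneg ((isBddField_left hΦ hM hd α q).isQuad.nonneg w)
      ((isBddField_right hΦ hM hd α q).isQuad.nonneg w)] at h1
    -- One side suffices: its gradient trace vanishes, so z = 0 there says that σ times the jump is
    -- zero.
    filter_upwards [(isBddField_left hΦ hM hd α q).ae_eq_zero_of_integral_norm_sq h1.1,
      (isBddField_left hΦ hM hd α q).ae_mem] with x hx hxs
    rw [trGrad_eq_zero q.1 (hg q.1) (iface_subset_left _ _ hxs), zero_sub, neg_eq_zero] at hx
    exact (smul_eq_zero.1 hx).resolve_left hσ.ne'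
  · have hσ := sigmaB_pos hM hd hα hi
    have h1 := (mul_eq_zero.1 (hface.2 i hi)).resolve_left (inv_pos.2 hσ).ne'
    filter_upwards [(isBddField_bdry hΦ hM hd α hΓDm i).ae_eq_zero_of_integral_norm_sq h1,
      (isBddField_bdry hΦ hM hd α hΓDm i).ae_mem] with x hx hxs
    rw [trGrad_eq_zero i (hg i) (bface_subset _ _ hxs), zero_sub, neg_eq_zero] at hx
    exact (smul_eq_zero.1 hx).resolve_left hσ.ne'

end Fields

variable {A : E d → E d → (E d →L[ℝ] E d)} {B CA MA θ α : ℝ} {ΓD ΓN : Set (E d)}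
  {f gD gN : E d → ℝ}

/-- Every piece is a flux integral or a one-sided form, and Lipschitz forms are stable under sums
and multiples. -/
theorem isLipForm_N [FiniteDimensional ℝ X] (hΦ : ∀ w, Φ w ∈ M.V) (hM : M.Admissible β₁ β₂ β₃)
    (hd : 2 ≤ d) (hA : IsMonotoneCoeff A (closure Ω) B CA MA) (hα : 0 < α)
    (hΓD : MeasurableSet ΓD) (hgD : MemLp gD 2 ((surf d).restrict ΓD)) :
    IsLipForm fun w v => M.N A θ α ΓD gD (Φ w) (Φ v) := by
  simp only [N, B0_eq hΦ hM hd hA θ α (fun q hq => (sigmaI_pos hM hd hα hq).ne'),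
    BD_eq hΦ hM hd hA θ α hΓD hgD (fun i hi => (sigmaB_pos hM hd hα hi).ne')]
  refine ((IsLipForm.sum _ fun i _ => ?_).add_form (IsLipForm.sum _ fun q _ =>
    (IsLipForm.add_form ?_ ?_).const_mul _)).add_form (IsLipForm.sum _ fun i _ => ?_)
  · exact isLipForm_flux (hA.subset (subset_closure.trans (closure_elem_subset i)))
      (isBddField_gradient hΦ i hM hd)
  · exact isLipForm_sideForm (hA.subset ((iface_subset_left _ _).trans (closure_elem_subset _))) _ _
      (integrable_zero _ _ _) (isBddField_trGrad_left hΦ hM hd q) (isBddField_jump hΦ hM hd q)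
  · exact isLipForm_sideForm (hA.subset ((iface_subset_left _ _).trans (closure_elem_subset _))) _ _
      (integrable_zero _ _ _) (isBddField_trGrad_right hΦ hM hd q) (isBddField_jump hΦ hM hd q)
  · exact isLipForm_sideForm (hA.subset ((bface_subset _ _).trans (closure_elem_subset _))) _ _
      (integrable_smul_nrm (integrable_of_memLp_bface hM hd hgD i) i)
      (isBddField_trGrad_bface hΦ hM hd hΓD i) (isBddField_tr_smul_nrm_bface hΦ hM hd hΓD i)

/-- The strong monotonicity of the semilinear form with respect to the energy. -/
theorem le_N_sub (hΦ : ∀ w, Φ w ∈ M.V) (hM : M.Admissible β₁ β₂ β₃)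
    (hd : 2 ≤ d) (hA : IsMonotoneCoeff A (closure Ω) B CA MA) (hα : 0 < α) (hθ : -1 ≤ θ)
    (hΓD : MeasurableSet ΓD) (hgD : MemLp gD 2 ((surf d).restrict ΓD)) {C : ℝ}
    (hC : M.IsInvTraceConst ΓD ΓN C) (w w' : X) :
    (MA - (|1 + θ| ^ 2 * CA ^ 2 / (2 * MA) + CA) * (2 * α⁻¹ * C)) *
        (∑ i, ∫ x in M.elem i, ‖gradient (Φ (w - w')) x‖ ^ 2) +
      MA / 2 * M.faceEnergy α ΓD (Φ (w - w')) ≤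
    M.N A θ α ΓD gD (Φ w) (Φ (w - w')) - M.N A θ α ΓD gD (Φ w') (Φ (w - w')) := by
  simp only [N, B0_eq hΦ hM hd hA θ α (fun q hq => (sigmaI_pos hM hd hα hq).ne'),
    BD_eq hΦ hM hd hA θ α hΓD hgD (fun i hi => (sigmaB_pos hM hd hα hi).ne')]
  have hCA : 0 < CA := hA.pos.trans_le hA.le
  have hMA := hA.pos
  set κ := |1 + θ| ^ 2 * CA ^ 2 / (2 * MA) + CA
  have hκ : 0 ≤ κ := by positivity
  have hE : MA * (∑ i, ∫ x in M.elem i, ‖gradient (Φ (w - w')) x‖ ^ 2) ≤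
      (∑ i, ∫ x in M.elem i, ⟪A x (gradient (Φ w) x) (gradient (Φ w) x),
        gradient (Φ (w - w')) x⟫) -
      ∑ i, ∫ x in M.elem i, ⟪A x (gradient (Φ w') x) (gradient (Φ w') x),
        gradient (Φ (w - w')) x⟫ := by
    rw [← Finset.sum_sub_distrib, Finset.mul_sum]
    exact Finset.sum_le_sum fun i _ =>
      le_flux_sub (hA.subset (subset_closure.trans (closure_elem_subset i)))
        (isBddField_gradient hΦ i hM hd) w w'
  have hI := Finset.sum_le_sum fun q (hq : q ∈ M.intFaces) => show
      MA / 2 * ((M.sigmaI α q)⁻¹ * (1 / 2 *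
        ((∫ x in M.iface q.1 q.2,
          ‖M.trGrad q.1 (Φ (w - w')) x - M.sigmaI α q • M.jump q (Φ (w - w')) x‖ ^ 2 ∂(surf d)) +
        ∫ x in M.iface q.1 q.2,
          ‖M.trGrad q.2 (Φ (w - w')) x - M.sigmaI α q • M.jump q (Φ (w - w')) x‖ ^ 2 ∂(surf d)))) -
      κ * (2 * α⁻¹) * (M.muI q / M.pI q ^ 2 * ∫ x in M.iface q.1 q.2,
        M.avg q (fun i => ‖M.trGrad i (Φ (w - w')) x‖) ^ 2 ∂(surf d)) ≤ 
      (1 / 2 : ℝ) * (sideForm A θ (M.sigmaI α q) (surf d) (M.iface q.1 q.2) 0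
          (fun w => M.trGrad q.1 (Φ w)) (fun w => M.jump q (Φ w)) w (w - w') +
        sideForm A θ (M.sigmaI α q) (surf d) (M.iface q.1 q.2) 0
          (fun w => M.trGrad q.2 (Φ w)) (fun w => M.jump q (Φ w)) w (w - w')) -
      (1 / 2 : ℝ) * (sideForm A θ (M.sigmaI α q) (surf d) (M.iface q.1 q.2) 0
          (fun w => M.trGrad q.1 (Φ w)) (fun w => M.jump q (Φ w)) w' (w - w') +
        sideForm A θ (M.sigmaI α q) (surf d) (M.iface q.1 q.2) 0
          (fun w => M.trGrad q.2 (Φ w)) (fun w => M.jump q (Φ w)) w' (w - w')) by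
    have hσ := sigmaI_pos hM hd hα hq
    have hA' := hA.subset ((iface_subset_left q.1 q.2).trans (closure_elem_subset _))
    have h1 := le_sideForm_sub hA' hθ hσ (integrable_zero _ _ _)
      (isBddField_trGrad_left hΦ hM hd q) (isBddField_jump hΦ hM hd q) w w'
    have h2 := le_sideForm_sub hA' hθ hσ (integrable_zero _ _ _)
      (isBddField_trGrad_right hΦ hM hd q) (isBddField_jump hΦ hM hd q) w w'
    have h3 := mul_le_mul_of_nonneg_left (half_le_two_mul_integral_avg_sq hΦ hM hd q (w - w'))
      (mul_nonneg hκ (inv_pos.2 hσ).le)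
    have h4 : κ * (2 * α⁻¹) * (M.muI q / M.pI q ^ 2 * ∫ x in M.iface q.1 q.2,
        M.avg q (fun i => ‖M.trGrad i (Φ (w - w')) x‖) ^ 2 ∂(surf d)) =
        κ * (M.sigmaI α q)⁻¹ * (2 * ∫ x in M.iface q.1 q.2,
        M.avg q (fun i => ‖M.trGrad i (Φ (w - w')) x‖) ^ 2 ∂(surf d)) := by
      rw [sigmaI_inv]; ring
    rw [h4]
    linarith
  have hB := Finset.sum_le_sum fun i (hi : i ∈ M.bdryFaces ΓD) => show
      MA / 2 * ((M.sigmaB α ΓD i)⁻¹ * ∫ x in M.bface ΓD i, ‖M.trGrad i (Φ (w - w')) x -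
          M.sigmaB α ΓD i • (M.tr i (Φ (w - w')) x • M.nrm i x)‖ ^ 2 ∂(surf d)) -
      κ * (2 * α⁻¹) * (M.muB ΓD i / (M.p i : ℝ) ^ 2 *
        ∫ x in M.bface ΓD i, ‖M.trGrad i (Φ (w - w')) x‖ ^ 2 ∂(surf d)) ≤
      sideForm A θ (M.sigmaB α ΓD i) (surf d) (M.bface ΓD i) (fun x => gD x • M.nrm i x)
        (fun w => M.trGrad i (Φ w)) (fun w x => M.tr i (Φ w) x • M.nrm i x) w (w - w') -
      sideForm A θ (M.sigmaB α ΓD i) (surf d) (M.bface ΓD i) (fun x => gD x • M.nrm i x)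
        (fun w => M.trGrad i (Φ w)) (fun w x => M.tr i (Φ w) x • M.nrm i x) w' (w - w') by
    have hσ := sigmaB_pos hM hd hα hi
    have hA' := hA.subset ((bface_subset ΓD i).trans (closure_elem_subset _))
    have h1 := le_sideForm_sub hA' hθ hσ
      (integrable_smul_nrm (integrable_of_memLp_bface hM hd hgD i) i)
      (isBddField_trGrad_bface hΦ hM hd hΓD i) (isBddField_tr_smul_nrm_bface hΦ hM hd hΓD i) w w'
    -- On a boundary face the mean is the value itself. The factor 2 is not needed there, and
    -- nonnegativity permits it for a uniform constant.
    have h3 : 0 ≤ κ * (M.sigmaB α ΓD i)⁻¹ *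
        ∫ x in M.bface ΓD i, ‖M.trGrad i (Φ (w - w')) x‖ ^ 2 ∂(surf d) :=
      mul_nonneg (mul_nonneg hκ (inv_pos.2 hσ).le) (integral_nonneg fun x => by positivity)
    have h4 : κ * (2 * α⁻¹) * (M.muB ΓD i / (M.p i : ℝ) ^ 2 *
        ∫ x in M.bface ΓD i, ‖M.trGrad i (Φ (w - w')) x‖ ^ 2 ∂(surf d)) =
        2 * (κ * (M.sigmaB α ΓD i)⁻¹ *
        ∫ x in M.bface ΓD i, ‖M.trGrad i (Φ (w - w')) x‖ ^ 2 ∂(surf d)) := by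
      rw [sigmaB_inv]; ring
    rw [h4]
    linarith
  -- The inverse-trace inequality, with the Neumann faces dropped, absorbs the losses of all faces
  -- into the element energy.
  have hT := mul_le_mul_of_nonneg_left
    ((weighted_le_traceSum hM hd ΓD ΓN (Φ (w - w'))).trans (hC _ (hΦ (w - w'))))
    (mul_nonneg hκ (show 0 ≤ 2 * α⁻¹ by positivity))
  rw [Finset.sum_sub_distrib, Finset.sum_sub_distrib, ← Finset.mul_sum, ← Finset.mul_sum] at hI hB
  rw [faceEnergy]
  linarith

/-- The load as a linear form. -/
theorem exists_linear_load (hΦ : ∀ w, Φ w ∈ M.V) (hM : M.Admissible β₁ β₂ β₃) (hd : 2 ≤ d)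
    (hΓN : MeasurableSet ΓN) (hf : MemLp f 2 (volume.restrict Ω))
    (hgN : MemLp gN 2 ((surf d).restrict ΓN)) :
    ∃ ℓ : X →ₗ[ℝ] ℝ, ∀ v, ℓ v = M.load ΓN f gN (Φ v) := by
  have key : ∀ {ν : Measure (E d)} {s : Set (E d)} {g : X → E d → ℝ} (_ : IsBddField ν s g)
      {h : E d → ℝ} (_ : Integrable h (ν.restrict s)),
      ∃ ℓ : X →ₗ[ℝ] ℝ, ∀ v, ℓ v = ∫ x in s, h x * g v x ∂ν := by
    intro ν s g hg h hh
    have hint : ∀ v, Integrable (fun x => h x * g v x) (ν.restrict s) := by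
      intro v
      obtain ⟨C, hC⟩ := hg.bdd v
      refine hh.mul_bdd (c := C) (hg.aesm v) ?_
      filter_upwards [hg.ae_mem] with x hx using hC x hx
    refine ⟨{ toFun := fun v => ∫ x in s, h x * g v x ∂ν, map_add' := fun v v' => ?_,
              map_smul' := fun c v => ?_ }, fun v => rfl⟩
    · rw [← integral_add (hint v) (hint v')]
      exact setIntegral_congr_fun hg.meas fun x hx => by simp only [hg.add v v' x hx, mul_add]
    · rw [RingHom.id_apply, smul_eq_mul, ← integral_const_mul]
      exact setIntegral_congr_fun hg.meas fun x hx => by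
        simp only [hg.smul c v x hx, smul_eq_mul]; ring
  have hfi : ∀ i, Integrable f (volume.restrict (M.elem i)) := by
    intro i
    have : IsFiniteMeasure (volume.restrict (M.elem i)) :=
      ⟨by simpa using volume_elem_lt_top (M := M) i⟩
    have h : MemLp f 2 (volume.restrict (M.elem i)) :=
      hf.mono_measure (Measure.restrict_mono (M.elem_subset i) le_rfl)
    exact h.integrable (by norm_num)
  choose ℓ₁ hℓ₁ using fun i => key (isBddField_value hΦ i) (hfi i)
  choose ℓ₂ hℓ₂ using fun i => key (isBddField_tr_bface hΦ hM hd hΓN i)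
    (integrable_of_memLp_bface hM hd hgN i)
  exact ⟨∑ i, ℓ₁ i + ∑ i ∈ M.bdryFaces ΓN, ℓ₂ i, fun v => by
    simp [load, hℓ₁, hℓ₂]⟩

end HpMesh

end

end DG

end

/-- Beyond the threshold for the penalty parameter, the element energy has a positive weight. -/
theorem DG.energy_weight_pos {CA MA C s α : ℝ} (hMA : 0 < MA) (hCA : MA ≤ CA) (hC : 0 ≤ C)
    (hs : 0 ≤ s) (hα : 2 * C * (1 + (1 + s) * CA / MA) ^ 2 < α) :
    0 < MA - (s ^ 2 * CA ^ 2 / (2 * MA) + CA) * (2 * α⁻¹ * C) := by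
  have hα0 : 0 < α := lt_of_le_of_lt (by positivity) hα
  -- With q = C_A/M_A all terms scale with M_A, and the claim becomes 2C(s²q²/2 + q) < α.
  obtain ⟨q, rfl⟩ : ∃ q, CA = q * MA := ⟨CA / MA, by field_simp⟩
  have hq : 0 ≤ q := nonneg_of_mul_nonneg_left (hMA.le.trans hCA) hMA
  have h1 : s ^ 2 * (q * MA) ^ 2 / (2 * MA) + q * MA = MA * (s ^ 2 * q ^ 2 / 2 + q) := by
    field_simp
  have h2 : (1 + s) * (q * MA) / MA = (1 + s) * q := by field_simp
  have h3 : s ^ 2 * q ^ 2 / 2 + q ≤ (1 + (1 + s) * q) ^ 2 := by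
    nlinarith [mul_nonneg hs hq, mul_nonneg hs (sq_nonneg q), sq_nonneg (s * q), sq_nonneg q]
  rw [h2] at hα
  rw [h1, show MA - MA * (s ^ 2 * q ^ 2 / 2 + q) * (2 * α⁻¹ * C) =
    MA * α⁻¹ * (α - 2 * C * (s ^ 2 * q ^ 2 / 2 + q)) by field_simp]
  have h4 := mul_le_mul_of_nonneg_left h3 (mul_nonneg zero_le_two hC)
  exact mul_pos (mul_pos hMA (inv_pos.2 hα0)) (by linarith)

/-! ### Existence and uniqueness of the discrete solution -/

theorem mainTheorem1 {d : ℕ} (hd : 2 ≤ d)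
    (Ω : Set (DG.E d)) (hΩ_open : IsOpen Ω) (hΩ_bdd : Bornology.IsBounded Ω)
    (hΩ_conn : IsConnected Ω) (hΩ_lip : DG.HasLipschitzBoundary Ω)
    (ΓD ΓN : Set (DG.E d)) (hΓD : ΓD ⊆ frontier Ω) (hΓD_meas : MeasurableSet ΓD)
    (hΓD_pos : 0 < DG.surf d ΓD) (hΓN : ΓN = frontier Ω \ ΓD)
    (A : DG.E d → DG.E d → (DG.E d →L[ℝ] DG.E d))
    (hA_meas : Measurable (Function.uncurry A))
    (hA_bdd : ∃ B : ℝ, ∀ x ∈ closure Ω, ∀ v, ‖A x v‖ ≤ B)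
    (CA MA : ℝ) (hMA : 0 < MA) (hCA : MA ≤ CA)
    (hA_lip : ∀ x ∈ closure Ω, ∀ v₁ v₂, ‖A x v₁ v₁ - A x v₂ v₂‖ ≤ CA * ‖v₁ - v₂‖)
    (hA_mono : ∀ x ∈ closure Ω, ∀ v₁ v₂,
      MA * ‖v₁ - v₂‖ ^ 2 ≤ ⟪A x v₁ v₁ - A x v₂ v₂, v₁ - v₂⟫)
    (f gD gN : DG.E d → ℝ) (hf : MemLp f 2 (volume.restrict Ω))
    (hgD : MemLp gD 2 ((DG.surf d).restrict ΓD)) (hgN : MemLp gN 2 ((DG.surf d).restrict ΓN))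
    (M : DG.HpMesh Ω) (β₁ β₂ β₃ : ℝ) (hM : M.Admissible β₁ β₂ β₃)
    (θ : ℝ) (hθ : θ ∈ Set.Icc (-1 : ℝ) 1) :
    (∃ C, M.IsInvTraceConst ΓD ΓN C) ∧
    ∀ C, M.IsInvTraceConst ΓD ΓN C →
      ∀ α, 2 * C * (1 + (1 + |1 + θ|) * CA / MA) ^ 2 < α →
        ∃! u, u ∈ M.V ∧ ∀ v ∈ M.V, M.N A θ α ΓD gD u v = M.load ΓN f gN v := by
  -- A linear coordinate map supplies the Hilbert space structure for the abstract theorem; the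
  -- choice of norm is immaterial in finite dimension.
  obtain ⟨m, Φ, hinj, hrange⟩ := DG.HpMesh.exists_parametrization M
  have hΦ : ∀ w, Φ w ∈ M.V := fun w => hrange ▸ mem_range_self w
  have hΓN_meas : MeasurableSet ΓN := hΓN ▸ isClosed_frontier.measurableSet.diff hΓD_meas
  refine ⟨?_, fun C hC α hα => ?_⟩
  · obtain ⟨C, hC⟩ := DG.HpMesh.exists_traceSum_le hΦ hM hd hΓD_meas hΓN_meas
    refine ⟨C, fun v hv => ?_⟩
    obtain ⟨w, rfl⟩ := hrange.symm ▸ hv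
    exact hC w
  obtain ⟨B, hB⟩ := hA_bdd
  have hA : DG.IsMonotoneCoeff A (closure Ω) B CA MA := ⟨hA_meas, hB, hA_lip, hA_mono, hMA, hCA⟩
  have hne : Nonempty (Fin M.n) := by
    obtain ⟨x, hx⟩ := hΩ_conn.nonempty
    have := subset_closure hx
    rw [M.closure_eq] at this
    exact ⟨(mem_iUnion.1 this).choose⟩
  have hC0 := DG.HpMesh.invTraceConst_nonneg hrange hM hd hne hC
  have hα0 : 0 < α := lt_of_le_of_lt (by positivity) hα
  have hc₁ := DG.energy_weight_pos hMA hCA hC0 (abs_nonneg (1 + θ)) hα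
  have hQ₁ := DG.HpMesh.isQuad_gradient hΦ hM hd
  have hQ₂ := DG.HpMesh.isQuad_faceEnergy hΦ hM hd hα0 hΓD_meas
  have hQ := (hQ₁.const_mul hc₁.le).add (hQ₂.const_mul (half_pos hMA).le)
  -- Both weights are positive, so zero energy kills the gradient and face parts separately.
  -- Definiteness then gives a bound below by a multiple of the squared coordinate norm.
  obtain ⟨c, hc, hcQ⟩ := DG.exists_pos_mul_norm_sq_le hQ.cont hQ.smul fun w hw => by
    refine lt_of_le_of_ne (hQ.nonneg w) fun h => hw (hinj ?_)
    obtain ⟨h1, h2⟩ := (add_eq_zero_iff_of_nonneg (mul_nonneg hc₁.le (hQ₁.nonneg w))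
      (mul_nonneg (half_pos hMA).le (hQ₂.nonneg w))).1 h.symm
    rw [map_zero]
    exact DG.HpMesh.eq_zero_of_energy hΦ hM hd hΩ_open hΩ_conn.isPreconnected hα0 hΓD hΓD_meas
      hΓD_pos ((mul_eq_zero.1 h1).resolve_left hc₁.ne')
      ((mul_eq_zero.1 h2).resolve_left (half_pos hMA).ne')
  obtain ⟨ℓ, hℓ⟩ := DG.HpMesh.exists_linear_load hΦ hM hd hΓN_meas hf hgN
  obtain ⟨u, hu, huniq⟩ := (DG.HpMesh.isLipForm_N (θ := θ) hΦ hM hd hA hα0 hΓD_meas hgD).existsUnique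
    hc (fun w w' => (hcQ (w - w')).trans
      (DG.HpMesh.le_N_sub hΦ hM hd hA hα0 hθ.1 hΓD_meas hgD hC w w')) ℓ
  refine ⟨Φ u, ⟨hΦ u, ?_⟩, ?_⟩
  · intro v hv
    obtain ⟨v, rfl⟩ := hrange.symm ▸ hv
    exact (hu v).trans (hℓ v)
  · rintro y ⟨hy, hyv⟩
    obtain ⟨w, rfl⟩ := hrange.symm ▸ hy
    rw [huniq w fun v => (hyv _ (hΦ v)).trans (hℓ v).symm]
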